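/- **Model.** Time is slotted and indexed by $\mathbb N$. There are $n$ identical parties; party $u$ is woken up at a time $t_u\in\mathbb N$ chosen by an adversary. An acknowledgment-based GlobalClock protocol is a family $\mathcal D=(\mathcal D_{t^*})_{t^*\in\mathbb N}$ of probability distributions on infinite $0/1$-sequences; a LocalClock protocol is a single such distribution $\mathcal D$ (i.e. a constant family). When woken up at time $t_u$, party $u$ draws, independently of the other parties, a sequence $X^{(u)}=(X^{(u)}_1,X^{(u)}_2,\ldots)\sim\mathcal D_{t_u}$, and at each time $t>t_u$ it grabs the resource iff $X^{(u)}_{t-t_u}=1$ and it has not succeeded before time $t$. A party succeeds at time $t$ iff it is the only one that grabs the resource at time $t$; $t_u^{\rm succ}$ is the time of its success ($\infty$ if there is none), and $t_u^{\rm succ}-t_u$ is its latency. An oblivious adversary fixes $n$ and all wake-up times in advance. An adaptive adversary has $n$ parties at its disposal and decides at each time $t$ which sleeping parties to wake up, as a function of the history before $t$: the previous wake-up times and the bits $X^{(u)}_i$, $1\le i<t-t_u$, of all awake parties $u$. For a class of adversaries and a failure probability $q$, let $L_{\mathcal D}(n,q)\in\mathbb N\cup\{\infty\}$ be the least $L$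 such that against every adversary of the class with $n$ parties, each party $u$ satisfies $\Pr[t_u^{\rm succ}-t_u\le L]\ge 1-q$ (a party that is never woken up counts as satisfying the bound). "Latency with high probability" means $L_{\mathcal D}(n,n^{-k})$ for a constant $k>0$, which is arbitrary. $g=\Omega(f)$ means that there is a constant $c>0$ with $g(n)\ge c f(n)$ for infinitely many $n$ (the negation of $g=o(f)$). **Statement.** GlobalClock is strictly more powerful than LocalClock for acknowledgment-based Contention Resolution, in the following sense. 1. There is a GlobalClock protocol $\mathcal D$ such that for every constant $k>0$, against adaptive adversaries, $L_{\mathcal D}(n,n^{-k})\le n(\log\log n)^{1+o(1)}$ as $n\to\infty$. 2. For every LocalClock protocol $\mathcal D$ (not necessarily memoryless) and every constant $k>0$, already against oblivious adversaries, $L_{\mathcal D}(n,n^{-k})=\Omega\!\left(\frac{n\log n}{(\log\log n)^2}\right)$. 3. Consequently, for no LocalClock protocol $\mathcal D$ and no constant $k>0$ does $L_{\mathcal D}(n,n^{-k})\le n(\log\log n)^{1+o(1)}$ hold as $n\to\infty$, even against oblivious adversaries. -/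

import Mathlib

open MeasureTheory Filter Topology
open scoped ENNReal

namespace ContentionResolution

/-- An infinite binary attempt sequence `X₁, X₂, …`: its holder wants to grab the resource at local
time `i ≥ 1` iff `x i = true`.  The entry `x 0` is never used. -/
abbrev AttemptSeq : Type := ℕ → Bool

/-- A (randomized, acknowledgment-based) protocol in the LocalClock model: a distribution over
attempt sequences.  No memorylessness is required. -/
abbrev LocalProtocol : Type := ProbabilityMeasure AttemptSeq

/-- A (randomized, acknowledgment-based) protocol in the GlobalClock model: for each global wake-up
time, a distribution over attempt sequences. -/
abbrev GlobalProtocol : Type := ℕ → ProbabilityMeasure AttemptSeq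

/-- A LocalClock protocol, viewed as a GlobalClock protocol that ignores the global clock. -/
def LocalProtocol.toGlobal (D : LocalProtocol) : GlobalProtocol := fun _ => D

/-- The coins of `n` parties: `ω u w` is the attempt sequence that party `u` follows if it is woken
up at global time `w`.  (Only the sequence of the actual wake-up time is ever used.) -/
abbrev Coins (n : ℕ) : Type := Fin n → ℕ → AttemptSeq

/-- The law of the coins: the parties are independent, and the sequence that a party follows when
woken up at time `w` has law `D w`. -/
noncomputable def coinLaw (D : GlobalProtocol) (n : ℕ) : Measure (Coins n) :=
  Measure.pi fun _ : Fin n => Measure.infinitePi fun w : ℕ => (D w : Measure AttemptSeq)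

/-- An adaptive adversary with `n` parties at its disposal.  `A t W h` is the set of parties it
chooses to wake up at time `t`, given the history prior to time `t`, which consists of
the wake-up times before `t` (`W u = none` if `u` is still asleep), and the
attempt bits `h u i = X_i^(u)` of every awake party `u` at its local times `1 ≤ i < t - t_u`
(`h u i = false` for other `i`).  Successes prior to `t` are a function of these data. -/
abbrev Adversary (n : ℕ) : Type :=
  ℕ → (Fin n → Option ℕ) → (Fin n → ℕ → Bool) → Finset (Fin n)

/-- The oblivious adversary that fixes the wake-up time `τ u` of every party `u` in advance. -/
def obliviousAdversary {n : ℕ} (τ : Fin n → ℕ) : Adversary n :=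
  fun t _ _ => Finset.univ.filter fun u => τ u = t

/-- The attempt bits revealed before global time `t`, given the wake-up times `W` before `t`. -/
def revealed {n : ℕ} (ω : Coins n) (W : Fin n → Option ℕ) (t : ℕ) : Fin n → ℕ → Bool :=
  fun u i => match W u with
    | some w => decide (1 ≤ i ∧ w + i < t) && ω u w i
    | none => false

/-- The wake-up times before global time `t` in the run of adversary `A` on the coins `ω`.
A party is woken up at most once. -/
def wakeBefore {n : ℕ} (A : Adversary n) (ω : Coins n) : ℕ → Fin n → Option ℕ
  | 0 => fun _ => none
  | t + 1 => fun u => match wakeBefore A ω t u with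
    | some w => some w
    | none =>
      if u ∈ A t (wakeBefore A ω t) (revealed ω (wakeBefore A ω t) t) then some t else none

/-- Party `u` has been woken up at some time `w < t` and its attempt sequence has a one at
local time `t - w`. -/
def Wants {n : ℕ} (A : Adversary n) (ω : Coins n) (u : Fin n) (t : ℕ) : Prop :=
  ∃ w, wakeBefore A ω t u = some w ∧ ω u w (t - w) = true

/-- The parties (awake or not) that have not achieved success at any time before `t`.  A party
achieves success at time `t` iff it is the only one that grabs the resource at time `t`, where only
parties without previous success grab the resource. -/
def pending {n : ℕ} (A : Adversary n) (ω : Coins n) : ℕ → Set (Fin n)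
  | 0 => Set.univ
  | t + 1 => {u | u ∈ pending A ω t ∧ {v | v ∈ pending A ω t ∧ Wants A ω v t} ≠ {u}}

/-- Party `u` achieves success at time `t`: it is the only party that grabs the resource then. -/
def Succeeds {n : ℕ} (A : Adversary n) (ω : Coins n) (u : Fin n) (t : ℕ) : Prop :=
  {v | v ∈ pending A ω t ∧ Wants A ω v t} = {u}

/-- The latency `t_u^succ - t_u` of party `u` is at most `L`.  (No requirement is made on a party
that is never woken up.) -/
def LatencyAtMost {n : ℕ} (A : Adversary n) (ω : Coins n) (u : Fin n) (L : ℕ) : Prop :=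
  ∀ w, (∃ t, wakeBefore A ω t u = some w) → ∃ d ≤ L, Succeeds A ω u (w + d)

/-- Adversaries for every number of parties. -/
abbrev AdversaryClass : Type := (n : ℕ) → Set (Adversary n)

/-- All adaptive adversaries. -/
def adaptive : AdversaryClass := fun _ => Set.univ

/-- All oblivious adversaries. -/
def oblivious : AdversaryClass := fun _ => Set.range obliviousAdversary

/-- `L_D(n, q)`: the least `L` such that against every adversary of the class with `n` parties,
each party has latency at most `L` with probability at least `1 - q`; it is `⊤` if there is no such
`L`. -/
noncomputable def latency (D : GlobalProtocol) (𝒜 : AdversaryClass) (n : ℕ) (q : ℝ) : ℕ∞ :=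
  sInf {ℓ : ℕ∞ | ∃ L : ℕ, ℓ = (L : ℕ∞) ∧
    ∀ A ∈ 𝒜 n, ∀ u : Fin n, 1 - q ≤ (coinLaw D n).real {ω | LatencyAtMost A ω u L}}

/-- The latency bound with failure probability `n ^ (-k)`. -/
noncomputable def whpLatency (D : GlobalProtocol) (𝒜 : AdversaryClass) (k : ℝ) (n : ℕ) : ℕ∞ :=
  latency D 𝒜 n ((n : ℝ) ^ (-k))

/-- `ℓ n ≤ n (log log n) ^ (1 + o(1))` as `n → ∞`. -/
def IsNearLinear (ℓ : ℕ → ℕ∞) : Prop :=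
  ∃ ε : ℕ → ℝ, Tendsto ε atTop (𝓝 0) ∧
    ∀ᶠ n : ℕ in atTop,
      (ℓ n : ℝ≥0∞) ≤ ENNReal.ofReal ((n : ℝ) * Real.log (Real.log n) ^ (1 + ε n))

/-- `ℓ = Ω(f)` in the sense of Aho, Hopcroft and Ullman (the negation of `ℓ = o(f)`): for some
constant `c > 0`, `ℓ n ≥ c f n` holds for infinitely many `n`. -/
def IsOmega (ℓ : ℕ → ℕ∞) (f : ℕ → ℝ) : Prop :=
  ∃ c : ℝ, 0 < c ∧ ∃ᶠ n : ℕ in atTop, ENNReal.ofReal (c * f n) ≤ (ℓ n : ℝ≥0∞)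

end ContentionResolution

namespace ContentionResolution

/-! Upper bound. In `levelProtocol` a party of age `i` grabs with probability of order `(log i)^2 /
i`, divided by `2 ^ r` in a slot of level `r`. The level is read off the global clock, so all
parties damp simultaneously. Every window of length about `R (log R)^2` contains all levels up to
`R`. The undamped probabilities of one party add up to `O((log n)^3)` over `O(n)` ages, so among
`132 n` equally spaced times at most `n` have contention above a suitable multiple of `(log n)^3`.
Hence levels up to `O(log log n)` suffice, and blocks of length about `log log n (log log log n)^2`
contain all of them.

All but `4 n` of the `132 n` blocks after a wake-up have no wake-up nearby, no success and no
overload. Contention varies there by at most a factor two, so some slot is busy (damped contention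
of constant order) or quiet (level zero and low contention), and one of the two kinds occurs `64 n`
times (`many_good_slots`). Many busy slots would force more than `n` successes; in many quiet slots
the given party would succeed, because of the `(log i)^2` in its grab probability. Both tails follow
from `measureReal_many_marked_few_success`, which only conditions on the past and therefore
tolerates adaptive adversaries.

Lower bound. Let `a` be the first age at which a LocalClock protocol attempts with positive
probability `p`; if there is none, nobody ever succeeds. A group of order `log n` parties woken up
`a` slots before a given slot hits that slot almost surely, and this jams the first `n / polylog n`
slots cheaply. Put `n = 2 ^ l` and `x = Nat.log 2 l`, and consider the expected number of attempts
at ages between `n / 4 ^ x` and `n * 4 ^ x`.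

If this number is below a small multiple of `l / x` for infinitely many `l`, the victim makes few
late attempts with probability at least `1 / 2`. Parties with guessed wake-up times block each of
them by their own first attempt, with probability exceeding `n ^ (-k)` (`le_latency_of_lottery`).
Otherwise all large scales are heavy. Summing over disjoint windows (`le_sum_of_window_sums`) gives
a prefix sum of order `(l / x)^2`, and parties woken up at uniform times then jam all slots up to
order `n l / x^2` (`le_latency_of_uniform_jam`). The third claim compares the two rates. -/

instance (D : GlobalProtocol) (n : ℕ) : IsProbabilityMeasure (coinLaw D n) := by
  unfold coinLaw; infer_instance

/-! ### Protocols with independent bits. -/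

/-- The GlobalClock protocol whose bits are independent: a party woken up at time `w` grabs the
resource at its local time `i` with probability `q w i`. -/
noncomputable def bitProtocol (q : ℕ → ℕ → unitInterval) : GlobalProtocol := fun w =>
  ⟨Measure.infinitePi fun i => ProbabilityTheory.bernoulliMeasure true false (q w i),
    inferInstance⟩

theorem coinLaw_bitProtocol_box (q : ℕ → ℕ → unitInterval) (n T : ℕ)
    (A : Fin n → ℕ → ℕ → Set Bool) :
    (coinLaw (bitProtocol q) n).real
      {ω | ∀ u, ∀ w ∈ Finset.range T, ∀ i ∈ Finset.range T, ω u w i ∈ A u w i} =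
    ∏ u, ∏ w ∈ Finset.range T, ∏ i ∈ Finset.range T,
      (ProbabilityTheory.bernoulliMeasure true false (q w i)).real (A u w i) := by
  have hset : {ω : Coins n | ∀ u, ∀ w ∈ Finset.range T, ∀ i ∈ Finset.range T,
      ω u w i ∈ A u w i} = Set.univ.pi fun u => Set.pi (Finset.range T : Set ℕ) fun w =>
        Set.pi (Finset.range T : Set ℕ) fun i => A u w i := by
    ext ω; simp [Set.mem_pi]
  have hm : ∀ u w, MeasurableSet (Set.pi (Finset.range T : Set ℕ) fun i => A u w i) :=
    fun u w => MeasurableSet.pi (Set.to_countable _) fun i _ => Set.Finite.measurableSet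
      (Set.toFinite _)
  rw [measureReal_def, hset, coinLaw, Measure.pi_pi, ENNReal.toReal_prod]
  refine Finset.prod_congr rfl fun u _ => ?_
  rw [Measure.infinitePi_pi _ fun w _ => hm u w, ENNReal.toReal_prod]
  refine Finset.prod_congr rfl fun w _ => ?_
  change ENNReal.toReal ((Measure.infinitePi fun i =>
    ProbabilityTheory.bernoulliMeasure true false (q w i)) _) = _
  rw [Measure.infinitePi_pi _ fun i _ => Set.Finite.measurableSet (Set.toFinite _),
    ENNReal.toReal_prod]
  rfl

/-! ### The filtration of bits revealed before a given time. -/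

/-- The coins `ω` and `ω'` have the same bits before global time `t`. -/
def Agree {n : ℕ} (t : ℕ) (ω ω' : Coins n) : Prop :=
  ∀ u w i, w + i < t → ω u w i = ω' u w i

/-- The event `G` is determined by the bits before global time `t`. -/
def Det {n : ℕ} (t : ℕ) (G : Set (Coins n)) : Prop :=
  ∀ ω ω', Agree t ω ω' → (ω ∈ G ↔ ω' ∈ G)

theorem Agree.symm {n t : ℕ} {ω ω' : Coins n} (h : Agree t ω ω') : Agree t ω' ω :=
  fun u w i hi => (h u w i hi).symm

theorem Agree.mono {n s t : ℕ} {ω ω' : Coins n} (h : Agree t ω ω') (hst : s ≤ t) :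
    Agree s ω ω' :=
  fun u w i hi => h u w i (hi.trans_le hst)

theorem Det.mono {n s t : ℕ} {G : Set (Coins n)} (h : Det s G) (hst : s ≤ t) : Det t G :=
  fun ω ω' hω => h ω ω' (hω.mono hst)

theorem Det.inter {n t : ℕ} {G H : Set (Coins n)} (hG : Det t G) (hH : Det t H) :
    Det t (G ∩ H) :=
  fun ω ω' h => and_congr (hG ω ω' h) (hH ω ω' h)

theorem Det.compl {n t : ℕ} {G : Set (Coins n)} (hG : Det t G) : Det t Gᶜ :=
  fun ω ω' h => not_congr (hG ω ω' h)

/-- The bits before global time `t`. -/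
def past {n : ℕ} (t : ℕ) (ω : Coins n) : Fin n → Fin t → Fin t → Bool :=
  fun u w i => decide ((w : ℕ) + i < t) && ω u w i

theorem past_eq_iff {n t : ℕ} {ω ω' : Coins n} : past t ω = past t ω' ↔ Agree t ω ω' := by
  constructor
  · intro h u w i hi
    have := congrFun (congrFun (congrFun h u) ⟨w, by omega⟩) ⟨i, by omega⟩
    simpa [past, hi] using this
  · intro h
    ext u w i
    by_cases hi : (w : ℕ) + i < t
    · simp [past, hi, h u w i hi]
    · simp [past, hi]

theorem measurable_past {n : ℕ} (t : ℕ) : Measurable (past (n := n) t) := by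
  refine measurable_pi_iff.2 fun u => measurable_pi_iff.2 fun w => measurable_pi_iff.2 fun i => ?_
  have h : Measurable fun ω : Coins n => ω u w i := by fun_prop
  exact (measurable_of_finite fun b : Bool => decide ((w : ℕ) + i < t) && b).comp h

theorem Det.preimage_image {n t : ℕ} {G : Set (Coins n)} (hG : Det t G) :
    past t ⁻¹' (past t '' G) = G := by
  refine Set.Subset.antisymm ?_ (Set.subset_preimage_image _ _)
  rintro ω ⟨ω', hω', h⟩
  exact (hG _ _ (past_eq_iff.1 h)).1 hω'

theorem Det.measurableSet {n t : ℕ} {G : Set (Coins n)} (hG : Det t G) : MeasurableSet G := by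
  rw [← hG.preimage_image]
  exact measurable_past t (Set.toFinite _).measurableSet

/-- A lower bound on the conditional probability of `E` that holds on each atom of a determined
event `G` holds on `G`. -/
theorem Det.mul_measureReal_le {n t : ℕ} {G : Set (Coins n)} (hG : Det t G)
    {μ : Measure (Coins n)} [IsFiniteMeasure μ] {E : Set (Coins n)} {c : ℝ}
    (h : ∀ ω ∈ G, c * μ.real {ω' | Agree t ω ω'} ≤ μ.real ({ω' | Agree t ω ω'} ∩ E)) :
    c * μ.real G ≤ μ.real (G ∩ E) := by
  classical
  have hm : ∀ y, MeasurableSet (past (n := n) t ⁻¹' {y}) := fun y =>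
    measurable_past t (Set.toFinite _).measurableSet
  set s : Finset (Fin n → Fin t → Fin t → Bool) := (past t '' G).toFinset with hs
  have h1 := sum_measureReal_preimage_singleton (μ := μ) s fun y _ => hm y
  have h2 := sum_measureReal_preimage_singleton (μ := μ.restrict E) s fun y _ => hm y
  have hsG : past t ⁻¹' (s : Set (Fin n → Fin t → Fin t → Bool)) = G := by
    rw [hs, Set.coe_toFinset, hG.preimage_image]
  rw [hsG] at h1 h2
  rw [measureReal_restrict_apply hG.measurableSet] at h2
  rw [← h1, ← h2, Finset.mul_sum]
  refine Finset.sum_le_sum fun y hy => ?_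
  rw [measureReal_restrict_apply (hm y)]
  obtain ⟨ω, hω, rfl⟩ : y ∈ past t '' G := by simpa [hs] using hy
  have : past t ⁻¹' {past t ω} = {ω' | Agree t ω ω'} := by
    ext ω'
    rw [Set.mem_preimage, Set.mem_singleton_iff, past_eq_iff]
    exact ⟨Agree.symm, Agree.symm⟩
  rw [this]
  exact h ω hω

/-! ### A tail bound for adaptively marked slots. -/

open Classical in
/-- The number of marked slots in `[t, T)`. -/
noncomputable def slotCount {n : ℕ} (M : ℕ → Set (Coins n)) (t T : ℕ) (ω : Coins n) : ℕ :=
  ((Finset.Ico t T).filter fun i => ω ∈ M i).card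

theorem slotCount_self {n : ℕ} (M : ℕ → Set (Coins n)) (T : ℕ) (ω : Coins n) :
    slotCount M T T ω = 0 := by
  simp [slotCount]

theorem slotCount_of_mem {n : ℕ} {M : ℕ → Set (Coins n)} {t T : ℕ} (h : t < T) {ω : Coins n}
    (hω : ω ∈ M t) : slotCount M t T ω = slotCount M (t + 1) T ω + 1 := by
  classical
  rw [slotCount, slotCount, ← Finset.insert_Ico_add_one_left_eq_Ico h, Finset.filter_insert, if_pos hω,
    Finset.card_insert_of_notMem (by simp)]

theorem slotCount_of_notMem {n : ℕ} {M : ℕ → Set (Coins n)} {t T : ℕ} (h : t < T) {ω : Coins n}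
    (hω : ω ∉ M t) : slotCount M t T ω = slotCount M (t + 1) T ω := by
  classical
  rw [slotCount, slotCount, ← Finset.insert_Ico_add_one_left_eq_Ico h, Finset.filter_insert, if_neg hω]

/-- An exponential-moment argument run backwards from `T`: each marked slot multiplies the
conditional mean of `2 ^ (-hits)` by at most `1 - c / 2`. Carrying an arbitrary determined event `G`
makes the induction hypothesis available on each outcome of the current slot. -/
theorem measureReal_many_marked_few_success_aux {n : ℕ} {μ : Measure (Coins n)}
    [IsProbabilityMeasure μ] {M E : ℕ → Set (Coins n)} {c : ℝ} (hc0 : 0 ≤ c) (hc1 : c ≤ 1)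
    (hM : ∀ t, Det t (M t)) (hE : ∀ t, Det (t + 1) (E t))
    (h : ∀ t, ∀ ω ∈ M t,
      c * μ.real {ω' | Agree t ω ω'} ≤ μ.real ({ω' | Agree t ω ω'} ∩ E t)) (T : ℕ) :
    ∀ d t, t + d = T → ∀ A s : ℕ, ∀ G : Set (Coins n), Det t G →
      μ.real (G ∩ {ω | A ≤ slotCount M t T ω ∧ slotCount (fun i => M i ∩ E i) t T ω ≤ s}) ≤
        2 ^ s * (1 - c / 2) ^ A * μ.real G := by
  have hr0 : 0 ≤ 1 - c / 2 := by linarith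
  have hr1 : 1 - c / 2 ≤ 1 := by linarith
  intro d
  induction d with
  | zero =>
    intro t ht A s G hG
    rw [add_zero] at ht
    subst ht
    simp only [slotCount_self]
    rcases Nat.eq_zero_or_pos A with rfl | hA
    · simp only [le_refl, zero_le, and_self, Set.ofPred_true, Set.inter_univ, pow_zero, mul_one]
      exact le_mul_of_one_le_left measureReal_nonneg (one_le_pow₀ one_le_two)
    · have : {ω : Coins n | A ≤ 0 ∧ 0 ≤ s} = ∅ := by ext; simp; omega
      rw [this]
      simp only [Set.inter_empty, measureReal_empty]
      positivity
  | succ d ih =>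
    intro t ht A s G hG
    have htT : t < T := by omega
    have ih' := ih (t + 1) (by omega)
    set Q := {ω | A ≤ slotCount M t T ω ∧ slotCount (fun i => M i ∩ E i) t T ω ≤ s} with hQ
    have hMe := (hM t).mono (Nat.le_succ t)
    have hGe := hG.mono (Nat.le_succ t)
    -- Three outcomes of slot `t`: unmarked leaves `(A, s)` unchanged, a hit lowers both, a miss
    -- lowers only `A`.
    have hcover : G ∩ Q ⊆ ((G ∩ (M t)ᶜ) ∩ Q) ∪ (((G ∩ M t ∩ E t) ∩ Q) ∪ ((G ∩ M t ∩ (E t)ᶜ) ∩ Q)) := by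
      rintro ω ⟨hg, hq⟩
      by_cases h1 : ω ∈ M t <;> by_cases h2 : ω ∈ E t <;> simp [hg, hq, h1, h2]
    have hsplit := (measureReal_mono (μ := μ) hcover).trans
      ((measureReal_union_le _ _).trans (add_le_add_right (measureReal_union_le _ _) _))
    have hdec : μ.real G = μ.real (G ∩ M t) + μ.real (G ∩ (M t)ᶜ) := by
      rw [← Set.sdiff_eq, measureReal_inter_add_sdiff (hM t).measurableSet]
    have hdec2 : μ.real (G ∩ M t) = μ.real (G ∩ M t ∩ E t) + μ.real (G ∩ M t ∩ (E t)ᶜ) := by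
      rw [← Set.sdiff_eq, measureReal_inter_add_sdiff (hE t).measurableSet]
    have hhit : c * μ.real (G ∩ M t) ≤ μ.real (G ∩ M t ∩ E t) :=
      (hG.inter (hM t)).mul_measureReal_le fun ω hω => h t ω hω.2
    have hP : (0 : ℝ) ≤ 2 ^ s * (1 - c / 2) ^ A := by positivity
    have h1 : μ.real ((G ∩ (M t)ᶜ) ∩ Q) ≤ 2 ^ s * (1 - c / 2) ^ A * μ.real (G ∩ (M t)ᶜ) := by
      refine le_trans (measureReal_mono ?_) (ih' A s _ (hGe.inter hMe.compl))
      rintro ω ⟨hg, hq⟩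
      refine ⟨hg, ?_⟩
      have hnot : ω ∉ M t := hg.2
      rw [hQ, Set.mem_ofPred_eq, slotCount_of_notMem htT hnot,
        slotCount_of_notMem (M := fun i => M i ∩ E i) htT fun hh => hnot hh.1] at hq
      exact hq
    have h3 : μ.real ((G ∩ M t ∩ (E t)ᶜ) ∩ Q) ≤
        2 ^ s * (1 - c / 2) ^ (A - 1) * μ.real (G ∩ M t ∩ (E t)ᶜ) := by
      refine le_trans (measureReal_mono ?_) (ih' (A - 1) s _ ((hGe.inter hMe).inter (hE t).compl))
      rintro ω ⟨hg, hq⟩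
      refine ⟨hg, ?_⟩
      rw [hQ, Set.mem_ofPred_eq, slotCount_of_mem htT hg.1.2,
        slotCount_of_notMem (M := fun i => M i ∩ E i) htT fun hh => hg.2 hh.2] at hq
      exact ⟨by omega, hq.2⟩
    have h2 : μ.real ((G ∩ M t ∩ E t) ∩ Q) ≤
        2 ^ s * (1 - c / 2) ^ (A - 1) / 2 * μ.real (G ∩ M t ∩ E t) := by
      rcases Nat.eq_zero_or_pos s with rfl | hs
      · have : (G ∩ M t ∩ E t) ∩ Q = ∅ := by
          ext ω
          simp only [Set.mem_inter_iff, Set.mem_empty_iff_false, iff_false, not_and]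
          intro hg hq
          rw [hQ, Set.mem_ofPred_eq,
            slotCount_of_mem (M := fun i => M i ∩ E i) htT ⟨hg.1.2, hg.2⟩] at hq
          omega
        rw [this, measureReal_empty]
        positivity
      · refine le_trans (measureReal_mono (s₂ := (G ∩ M t ∩ E t) ∩ {ω | A - 1 ≤ slotCount M (t + 1) T ω ∧
            slotCount (fun i => M i ∩ E i) (t + 1) T ω ≤ s - 1}) ?_)
          ((ih' (A - 1) (s - 1) _ ((hGe.inter hMe).inter (hE t))).trans_eq ?_)
        · rintro ω ⟨hg, hq⟩
          refine ⟨hg, ?_⟩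
          rw [hQ, Set.mem_ofPred_eq, slotCount_of_mem htT hg.1.2,
            slotCount_of_mem (M := fun i => M i ∩ E i) htT ⟨hg.1.2, hg.2⟩] at hq
          exact ⟨by omega, by omega⟩
        · obtain ⟨s, rfl⟩ : ∃ s', s = s' + 1 := ⟨s - 1, by omega⟩
          simp only [Nat.add_sub_cancel, pow_succ]
          ring
    -- For `A = 0` the truncated `A - 1` is useless, but the claimed bound is then at least the
    -- measure of `G`.
    rcases Nat.eq_zero_or_pos A with rfl | hA
    · have hle : μ.real (G ∩ Q) ≤ μ.real G := measureReal_mono Set.inter_subset_left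
      refine hle.trans (le_mul_of_one_le_left measureReal_nonneg ?_)
      simpa using one_le_pow₀ (M₀ := ℝ) one_le_two
    · obtain ⟨A, rfl⟩ : ∃ A', A = A' + 1 := ⟨A - 1, by omega⟩
      simp only [Nat.add_sub_cancel, pow_succ] at h1 h2 h3 ⊢
      have hK : (0 : ℝ) ≤ 2 ^ s * (1 - c / 2) ^ A := by positivity
      set K : ℝ := 2 ^ s * (1 - c / 2) ^ A
      calc μ.real (G ∩ Q) ≤ 2 ^ s * ((1 - c / 2) ^ A * (1 - c / 2)) * μ.real (G ∩ (M t)ᶜ) +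
            (K / 2 * μ.real (G ∩ M t ∩ E t) + K * μ.real (G ∩ M t ∩ (E t)ᶜ)) := by linarith
        _ = K * ((1 - c / 2) * μ.real (G ∩ (M t)ᶜ)) +
            K * (μ.real (G ∩ M t) - μ.real (G ∩ M t ∩ E t) / 2) := by rw [hdec2]; ring
        _ ≤ K * ((1 - c / 2) * μ.real (G ∩ (M t)ᶜ)) +
            K * ((1 - c / 2) * μ.real (G ∩ M t)) := by
          gcongr; linarith
        _ = _ := by rw [hdec]; ring

/-- If each marked slot has conditional success probability at least `c` given the past, then it is
unlikely that many slots are marked but few of them are successful. -/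
theorem measureReal_many_marked_few_success {n : ℕ} {μ : Measure (Coins n)}
    [IsProbabilityMeasure μ] {M E : ℕ → Set (Coins n)} {c : ℝ} (hc0 : 0 ≤ c) (hc1 : c ≤ 1)
    (hM : ∀ t, Det t (M t)) (hE : ∀ t, Det (t + 1) (E t))
    (h : ∀ t, ∀ ω ∈ M t,
      c * μ.real {ω' | Agree t ω ω'} ≤ μ.real ({ω' | Agree t ω ω'} ∩ E t)) (T A s : ℕ) :
    μ.real {ω | A ≤ slotCount M 0 T ω ∧ slotCount (fun i => M i ∩ E i) 0 T ω ≤ s} ≤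
        2 ^ s * (1 - c / 2) ^ A := by
  have := measureReal_many_marked_few_success_aux hc0 hc1 hM hE h T T 0 (by omega) A s Set.univ
    fun _ _ _ => Iff.rfl
  simpa using this

/-- Prescribed bits at global time `t` are independent of the bits before time `t`. -/
theorem coinLaw_agree_inter {n : ℕ} (q : ℕ → ℕ → unitInterval) (t : ℕ) (ω₀ : Coins n)
    (S : Finset (Fin n)) (W : Fin n → ℕ) (hW : ∀ u ∈ S, W u ≤ t) (b : Fin n → Bool) :
    (coinLaw (bitProtocol q) n).real
      ({ω | Agree t ω₀ ω} ∩ {ω | ∀ u ∈ S, ω u (W u) (t - W u) = b u}) =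
    (coinLaw (bitProtocol q) n).real {ω | Agree t ω₀ ω} *
      ∏ u ∈ S, (ProbabilityTheory.bernoulliMeasure true false (q (W u) (t - W u))).real {b u} := by
  classical
  set A : Fin n → ℕ → ℕ → Set Bool := fun u w i =>
    if w + i < t then {ω₀ u w i} else Set.univ with hA
  set B : Fin n → ℕ → ℕ → Set Bool := fun u w i =>
    if u ∈ S ∧ w = W u ∧ i = t - W u then {b u} else Set.univ with hB
  have h1 : {ω | Agree t ω₀ ω} = {ω : Coins n | ∀ u, ∀ w ∈ Finset.range (t + 1),
      ∀ i ∈ Finset.range (t + 1), ω u w i ∈ A u w i} := by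
    ext ω
    constructor
    · intro h u w _ i _
      by_cases hi : w + i < t
      · simp [hA, hi, h u w i hi]
      · simp [hA, hi]
    · intro h u w i hi
      have := h u w (Finset.mem_range.2 (by omega)) i (Finset.mem_range.2 (by omega))
      simpa [hA, hi, eq_comm] using this
  have h2 : {ω : Coins n | ∀ u ∈ S, ω u (W u) (t - W u) = b u} =
      {ω : Coins n | ∀ u, ∀ w ∈ Finset.range (t + 1),
      ∀ i ∈ Finset.range (t + 1), ω u w i ∈ B u w i} := by
    ext ω
    constructor
    · intro h u w _ i _
      by_cases hi : u ∈ S ∧ w = W u ∧ i = t - W u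
      · obtain ⟨hu, rfl, rfl⟩ := hi
        simp [hB, h u hu, hu]
      · simp [hB, hi]
    · intro h u hu
      have hle := hW u hu
      have := h u (W u) (Finset.mem_range.2 (by omega)) (t - W u) (Finset.mem_range.2 (by omega))
      simpa [hB, hu] using this
  have h3 : {ω | Agree t ω₀ ω} ∩ {ω : Coins n | ∀ u ∈ S, ω u (W u) (t - W u) = b u} =
      {ω : Coins n | ∀ u, ∀ w ∈ Finset.range (t + 1),
      ∀ i ∈ Finset.range (t + 1), ω u w i ∈ A u w i ∩ B u w i} := by
    rw [h1, h2]
    ext ω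
    simp only [Set.mem_inter_iff, Set.mem_ofPred_eq]
    exact ⟨fun h u w hw i hi => ⟨h.1 u w hw i hi, h.2 u w hw i hi⟩,
      fun h => ⟨fun u w hw i hi => (h u w hw i hi).1, fun u w hw i hi => (h u w hw i hi).2⟩⟩
  have h4 : ∏ u ∈ S, (ProbabilityTheory.bernoulliMeasure true false
      (q (W u) (t - W u))).real {b u} =
      ∏ u, ∏ w ∈ Finset.range (t + 1), ∏ i ∈ Finset.range (t + 1),
      (ProbabilityTheory.bernoulliMeasure true false (q w i)).real (B u w i) := by
    rw [← Finset.prod_subset (Finset.subset_univ S)]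
    · refine Finset.prod_congr rfl fun u hu => ?_
      have hle := hW u hu
      rw [Finset.prod_eq_single_of_mem (W u) (Finset.mem_range.2 (by omega)),
        Finset.prod_eq_single_of_mem (t - W u) (Finset.mem_range.2 (by omega))]
      · simp [hB, hu]
      · intro i _ hi
        simp [hB, hi]
      · intro w _ hw
        refine Finset.prod_eq_one fun i _ => ?_
        simp [hB, hw]
    · intro u _ hu
      refine Finset.prod_eq_one fun w _ => Finset.prod_eq_one fun i _ => ?_
      simp [hB, hu]
  rw [h3, h1, coinLaw_bitProtocol_box, coinLaw_bitProtocol_box, h4, ← Finset.prod_mul_distrib]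
  refine Finset.prod_congr rfl fun u _ => ?_
  rw [← Finset.prod_mul_distrib]
  refine Finset.prod_congr rfl fun w _ => ?_
  rw [← Finset.prod_mul_distrib]
  refine Finset.prod_congr rfl fun i _ => ?_
  by_cases h : w + i < t
  · have : ¬(u ∈ S ∧ w = W u ∧ i = t - W u) := by omega
    have hBu : B u w i = Set.univ := if_neg this
    rw [hBu, Set.inter_univ, probReal_univ, mul_one]
  · have hAu : A u w i = Set.univ := if_neg h
    rw [hAu, Set.univ_inter, probReal_univ, one_mul]

/-! ### Undamped grab probabilities. -/

/-- The grab probability at age `i`, before it is damped by the level of the slot. -/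
noncomputable def baseProb (i : ℕ) : ℝ :=
  ((Nat.log 2 i : ℝ) + 3) ^ 2 / (18 * 2 ^ Nat.log 2 i)

theorem baseProb_pos (i : ℕ) : 0 < baseProb i := by
  unfold baseProb; positivity

/-- `baseProb` as a function of the binary logarithm of the age. -/
theorem logProb_antitone : Antitone fun l : ℕ => ((l : ℝ) + 3) ^ 2 / (18 * 2 ^ l) := by
  refine antitone_nat_of_succ_le fun l => ?_
  rw [div_le_div_iff₀ (by positivity) (by positivity), pow_succ (2 : ℝ), Nat.cast_succ]
  have h : ((l : ℝ) + 1 + 3) ^ 2 ≤ 2 * ((l : ℝ) + 3) ^ 2 := by nlinarith [Nat.cast_nonneg (α := ℝ) l]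
  have h2 : (0 : ℝ) < 2 ^ l := by positivity
  nlinarith [mul_le_mul_of_nonneg_right h h2.le]

theorem baseProb_antitone : Antitone baseProb := fun _ _ h =>
  logProb_antitone (Nat.log_mono_right h)

theorem baseProb_le_half (i : ℕ) : baseProb i ≤ 1 / 2 := by
  have := logProb_antitone (Nat.zero_le (Nat.log 2 i))
  refine this.trans ?_
  norm_num

/-- Doubling the age halves the denominator's reciprocal while the squared logarithm only grows.
This keeps contention stable throughout a block short compared with all ages in it. -/
theorem half_baseProb_le (i : ℕ) : baseProb i / 2 ≤ baseProb (2 * i) := by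
  rcases Nat.eq_zero_or_pos i with rfl | hi
  · have := baseProb_pos 0
    simp only [mul_zero]; linarith
  · have hl : Nat.log 2 (2 * i) = Nat.log 2 i + 1 := by
      rw [mul_comm, Nat.log_mul_base one_lt_two hi.ne']
    rw [baseProb, baseProb, hl, div_div, div_le_div_iff₀ (by positivity) (by positivity), pow_succ (2 : ℝ),
      Nat.cast_succ]
    have h2 : (0 : ℝ) < 2 ^ Nat.log 2 i := by positivity
    have h : ((Nat.log 2 i : ℝ) + 3) ^ 2 ≤ ((Nat.log 2 i : ℝ) + 1 + 3) ^ 2 := by gcongr; linarith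
    nlinarith [mul_le_mul_of_nonneg_right h h2.le]

/-- The probability is constant on the dyadic range of exponent `l`, which therefore contributes `(l
+ 3) ^ 2 / 18`. -/
theorem sum_baseProb_le (a : ℕ) :
    ∑ i ∈ Finset.range (2 ^ a - 1), baseProb (1 + i) ≤ ((a : ℝ) + 3) ^ 3 := by
  have key : ∑ i ∈ Finset.range (2 ^ a - 1), baseProb (1 + i) ≤ a * ((a : ℝ) + 3) ^ 2 := by
    induction a with
    | zero => simp
    | succ a ih =>
      have h1 : 2 ^ (a + 1) - 1 = (2 ^ a - 1) + 2 ^ a := by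
        have := Nat.one_le_two_pow (n := a); rw [pow_succ]; omega
      rw [h1, Finset.sum_range_add]
      have h2 : ∑ x ∈ Finset.range (2 ^ a), baseProb (1 + (2 ^ a - 1 + x)) ≤ ((a : ℝ) + 3) ^ 2 := by
        have : ∀ x ∈ Finset.range (2 ^ a), baseProb (1 + (2 ^ a - 1 + x)) ≤
            ((a : ℝ) + 3) ^ 2 / (18 * 2 ^ a) := by
          intro x hx
          have h3 : Nat.log 2 (1 + (2 ^ a - 1 + x)) = a := by
            have := Nat.one_le_two_pow (n := a)
            rw [Finset.mem_range] at hx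
            rw [Nat.log_eq_iff (Or.inr ⟨one_lt_two, by omega⟩), pow_succ]
            omega
          rw [baseProb, h3]
        refine (Finset.sum_le_sum this).trans ?_
        rw [Finset.sum_const, Finset.card_range, nsmul_eq_mul]
        push_cast
        rw [mul_div_assoc', div_le_iff₀ (by positivity)]
        have h2 : (0 : ℝ) < 2 ^ a := by positivity
        have h4 : 0 ≤ ((a : ℝ) + 3) ^ 2 := by positivity
        nlinarith [mul_nonneg h2.le h4]
      have h5 : (a : ℝ) * ((a : ℝ) + 3) ^ 2 ≤ a * ((a + 1 : ℝ) + 3) ^ 2 := by gcongr; linarith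
      have h6 : ((a : ℝ) + 3) ^ 2 ≤ ((a + 1 : ℝ) + 3) ^ 2 := by gcongr; linarith
      push_cast
      nlinarith
  refine key.trans ?_
  rw [pow_succ' _ 2]
  gcongr
  linarith

/-! ### Levels of the global clock. -/

/-- The level of a global time slot: every party divides its grab probability by two to the level.
Each level `r` occurs periodically, with a period close to `r`. -/
def level (t : ℕ) : ℕ :=
  let g := padicValNat 2 (t + 1)
  let a := (t + 1) / 2 ^ (g + 1)
  2 ^ (2 ^ g - 1 + a % 2 ^ g) - 1 + a / 2 ^ g % 2 ^ (2 ^ g - 1 + a % 2 ^ g)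

/-- The period with which level `r` occurs. -/
def levelPeriod (r : ℕ) : ℕ :=
  2 ^ (2 * Nat.log 2 (Nat.log 2 (r + 1) + 1) + Nat.log 2 (r + 1) + 1)

/-- The low binary digits of `t + 1` form a prefix-free code of Elias type for the level: `g` in
unary, then `g` digits `m'`, then `2 ^ g - 1 + m'` digits `r'`. The remaining digits `c` are free.
-/
theorem level_eq (g m' r' c : ℕ) (hm : m' < 2 ^ g) (hr : r' < 2 ^ (2 ^ g - 1 + m')) (t : ℕ)
    (ht : t + 1 = 2 ^ g * (2 * (2 ^ g * (2 ^ (2 ^ g - 1 + m') * c + r') + m') + 1)) :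
    level t = 2 ^ (2 ^ g - 1 + m') - 1 + r' := by
  have hg : padicValNat 2 (t + 1) = g := by
    rw [ht, padicValNat.mul (by positivity) (by omega), padicValNat.prime_pow,
      padicValNat.eq_zero_of_not_dvd (by omega), add_zero]
  have ha : (t + 1) / 2 ^ (g + 1) = 2 ^ g * (2 ^ (2 ^ g - 1 + m') * c + r') + m' := by
    rw [ht, pow_succ, Nat.mul_div_mul_left _ _ (by positivity)]
    omega
  have h1 : (2 ^ g * (2 ^ (2 ^ g - 1 + m') * c + r') + m') % 2 ^ g = m' := by
    rw [Nat.mul_add_mod, Nat.mod_eq_of_lt hm]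
  have h2 : (2 ^ g * (2 ^ (2 ^ g - 1 + m') * c + r') + m') / 2 ^ g =
      2 ^ (2 ^ g - 1 + m') * c + r' := by
    rw [Nat.mul_add_div (by positivity), Nat.div_eq_of_lt hm, add_zero]
  simp only [level, hg, ha, h1, h2]
  rw [Nat.mul_add_mod, Nat.mod_eq_of_lt hr]

/-- Fixing a code word fixes `t + 1` modulo a power of two, so the slots with this code form an
arithmetic progression. -/
theorem exists_level_eq (r s : ℕ) : ∃ t, s ≤ t ∧ t < s + levelPeriod r ∧ level t = r := by
  set m := Nat.log 2 (r + 1) with hm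
  set g := Nat.log 2 (m + 1) with hg
  have hm1 : 2 ^ m ≤ r + 1 := Nat.pow_log_le_self 2 (by omega)
  have hm2 : r + 1 < 2 ^ (m + 1) := Nat.lt_pow_succ_log_self one_lt_two _
  have hg1 : 2 ^ g ≤ m + 1 := Nat.pow_log_le_self 2 (by omega)
  have hg2 : m + 1 < 2 ^ (g + 1) := Nat.lt_pow_succ_log_self one_lt_two _
  rw [pow_succ] at hm2 hg2
  obtain ⟨m', hm'⟩ : ∃ m', m + 1 = 2 ^ g + m' := ⟨m + 1 - 2 ^ g, by omega⟩
  obtain ⟨r', hr'⟩ : ∃ r', r + 1 = 2 ^ m + r' := ⟨r + 1 - 2 ^ m, by omega⟩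
  have hgpos := Nat.one_le_two_pow (n := g)
  have hmpos := Nat.one_le_two_pow (n := m)
  have hmm : 2 ^ g - 1 + m' = m := by omega
  have hP : levelPeriod r = 2 ^ g * (2 * (2 ^ g * 2 ^ m)) := by
    rw [levelPeriod, ← hm, ← hg]; ring
  -- The slot with code word of `r` and free digits `c = 0`; it lies in the first period.
  set k := 2 ^ g * (2 * (2 ^ g * r' + m') + 1) - 1 with hk
  have hk1 : k + 1 = 2 ^ g * (2 * (2 ^ g * r' + m') + 1) := by
    have : 0 < 2 ^ g * (2 * (2 ^ g * r' + m') + 1) := by positivity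
    omega
  have hkP : k + 1 ≤ levelPeriod r := by
    rw [hk1, hP]
    refine Nat.mul_le_mul_left _ ?_
    have h1 : 2 ^ g * (r' + 1) ≤ 2 ^ g * 2 ^ m := Nat.mul_le_mul_left _ (by omega)
    rw [mul_add] at h1
    omega
  have hPpos : 0 < levelPeriod r := by omega
  have hlev : ∀ c, level (k + levelPeriod r * c) = r := by
    intro c
    have := level_eq g m' r' c (by omega) (by rw [hmm]; omega) (k + levelPeriod r * c) (by
      rw [hmm, hP, add_right_comm, hk1]; ring)
    rw [this, hmm]; omega
  rcases lt_or_ge k s with h | h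
  · set c := (s - k + levelPeriod r - 1) / levelPeriod r with hc
    refine ⟨k + levelPeriod r * c, ?_, ?_, hlev c⟩
    · have := Nat.lt_mul_div_succ (s - k + levelPeriod r - 1) hPpos
      rw [← hc, mul_add] at this
      omega
    · have := Nat.mul_div_le (s - k + levelPeriod r - 1) (levelPeriod r)
      rw [← hc] at this
      omega
  · exact ⟨k, h, by omega, by simpa using hlev 0⟩

theorem levelPeriod_le {r R : ℕ} (h : r ≤ R) :
    levelPeriod r ≤ 2 * (Nat.log 2 (R + 1) + 1) ^ 2 * (R + 1) := by
  have h1 : 2 ^ Nat.log 2 (r + 1) ≤ R + 1 := (Nat.pow_log_le_self 2 (by omega)).trans (by omega)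
  have h2 : 2 ^ Nat.log 2 (Nat.log 2 (r + 1) + 1) ≤ Nat.log 2 (R + 1) + 1 :=
    (Nat.pow_log_le_self 2 (by omega)).trans
      (Nat.add_le_add_right (Nat.log_mono_right (by omega)) 1)
  calc levelPeriod r = 2 * (2 ^ Nat.log 2 (Nat.log 2 (r + 1) + 1)) ^ 2 *
        2 ^ Nat.log 2 (r + 1) := by rw [levelPeriod]; ring
    _ ≤ _ := by gcongr

theorem slotProb_mem (w i : ℕ) : baseProb i / 2 ^ level (w + i) ∈ unitInterval := by
  have h0 := baseProb_pos i
  have h1 := baseProb_le_half i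
  have h2 : (1 : ℝ) ≤ 2 ^ level (w + i) := one_le_pow₀ one_le_two
  refine ⟨by positivity, ?_⟩
  rw [div_le_one (by positivity)]
  linarith

/-- A GlobalClock protocol: at age `i` and in a slot of level `r`, grab with probability
`baseProb i / 2 ^ r`. -/
noncomputable def levelProtocol : GlobalProtocol :=
  bitProtocol fun w i => ⟨baseProb i / 2 ^ level (w + i), slotProb_mem w i⟩

/-! ### Runs: monotonicity, and dependence on the past only. -/

section Runs

variable {n : ℕ} (A : Adversary n)

theorem wakeBefore_lt {ω : Coins n} {t : ℕ} {u : Fin n} {w : ℕ}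
    (h : wakeBefore A ω t u = some w) : w < t := by
  induction t with
  | zero => simp [wakeBefore] at h
  | succ t ih =>
    simp only [wakeBefore] at h
    split at h
    · next w' hw' => rw [hw'] at ih; exact (ih h).trans (Nat.lt_succ_self t)
    · split_ifs at h
      · cases h; exact Nat.lt_succ_self _

theorem wakeBefore_succ {ω : Coins n} {t : ℕ} {u : Fin n} {w : ℕ}
    (h : wakeBefore A ω t u = some w) : wakeBefore A ω (t + 1) u = some w := by
  simp only [wakeBefore, h]

theorem wakeBefore_mono {ω : Coins n} {t t' : ℕ} {u : Fin n} {w : ℕ} (htt : t ≤ t')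
    (h : wakeBefore A ω t u = some w) : wakeBefore A ω t' u = some w := by
  induction t', htt using Nat.le_induction with
  | base => exact h
  | succ t' _ ih => exact wakeBefore_succ A ih

theorem wakeBefore_of_lt {ω : Coins n} {t t' : ℕ} {u : Fin n} {w : ℕ}
    (h : wakeBefore A ω t u = some w) (hw : w < t') : wakeBefore A ω t' u = some w := by
  rcases le_total t t' with htt | htt
  · exact wakeBefore_mono A htt h
  · obtain ⟨d, rfl⟩ := Nat.exists_eq_add_of_le htt
    clear htt
    induction d with
    | zero => exact h
    | succ d ih =>
      refine ih ?_
      rw [← add_assoc] at h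
      simp only [wakeBefore] at h
      split at h
      · next w' hw' => rw [hw', h]
      · split_ifs at h
        cases h; omega

/-- Wake-up times never change once set, so the time-indexed record is the truncation of one
function of the party. -/
theorem exists_wakeTime (ω : Coins n) : ∃ W : Fin n → Option ℕ,
    ∀ t v w, wakeBefore A ω t v = some w ↔ W v = some w ∧ w < t := by
  classical
  refine ⟨fun v => if h : ∃ w t, wakeBefore A ω t v = some w then some h.choose else none, ?_⟩
  intro t v w
  constructor
  · intro h
    have hex : ∃ w t, wakeBefore A ω t v = some w := ⟨w, t, h⟩
    refine ⟨?_, wakeBefore_lt A h⟩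
    simp only [hex, dif_pos]
    obtain ⟨t', ht'⟩ := hex.choose_spec
    have h1 := wakeBefore_mono A (le_max_left t t') h
    have h2 := wakeBefore_mono A (le_max_right t t') ht'
    rw [h1] at h2
    exact h2.symm
  · rintro ⟨h, hw⟩
    dsimp only at h
    split_ifs at h with hex
    obtain ⟨t', ht'⟩ := hex.choose_spec
    cases h
    exact wakeBefore_of_lt A ht' hw

theorem pending_succ_subset (ω : Coins n) (t : ℕ) : pending A ω (t + 1) ⊆ pending A ω t :=
  fun _ h => h.1

theorem pending_antitone (ω : Coins n) : Antitone (pending A ω) :=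
  antitone_nat_of_succ_le (pending_succ_subset A ω)

theorem Succeeds.mem {ω : Coins n} {t : ℕ} {u : Fin n} (h : Succeeds A ω u t) :
    u ∈ pending A ω t ∧ Wants A ω u t := by
  have : u ∈ {v | v ∈ pending A ω t ∧ Wants A ω v t} := by rw [h]; rfl
  exact this

theorem mem_pending_of_no_success {ω : Coins n} {s t : ℕ} (hst : s ≤ t) {u : Fin n}
    (hs : u ∈ pending A ω s) (h : ∀ i, s ≤ i → i < t → ¬ Succeeds A ω u i) :
    u ∈ pending A ω t := by
  induction t, hst using Nat.le_induction with
  | base => exact hs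
  | succ t hst ih =>
    exact ⟨ih fun i h1 h2 => h i h1 (h2.trans (Nat.lt_succ_self t)),
      h t hst (Nat.lt_succ_self t)⟩

theorem Succeeds.unique_time {ω : Coins n} {s t : ℕ} {u : Fin n} (hs : Succeeds A ω u s)
    (ht : Succeeds A ω u t) : s = t := by
  by_contra hne
  wlog h : s < t generalizing s t
  · exact this ht hs (Ne.symm hne) (by omega)
  exact (pending_antitone A ω h (Succeeds.mem A ht).1).2 hs

theorem Succeeds.unique_party {ω : Coins n} {t : ℕ} {u v : Fin n} (hu : Succeeds A ω u t)
    (hv : Succeeds A ω v t) : u = v := by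
  have : ({u} : Set (Fin n)) = {v} := hu.symm.trans hv
  exact Set.singleton_injective this

/-- The adversary does not anticipate: its decision at time `t` reads only bits of slots before `t`.
All determinedness statements about runs rest on this. -/
theorem Agree.wakeBefore_eq {t : ℕ} {ω ω' : Coins n} (h : Agree t ω ω') :
    wakeBefore A ω t = wakeBefore A ω' t := by
  induction t with
  | zero => rfl
  | succ t ih =>
    have ih' := ih (h.mono (Nat.le_succ t))
    have hr : revealed ω (wakeBefore A ω' t) t = revealed ω' (wakeBefore A ω' t) t := by
      ext u i
      simp only [revealed]
      split
      · next w _ =>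
        by_cases hi : 1 ≤ i ∧ w + i < t
        · rw [h u w i (by omega)]
        · simp [hi]
      · rfl
    ext1 u
    simp only [wakeBefore, ih', hr]

theorem Agree.wants_iff {t : ℕ} {ω ω' : Coins n} (h : Agree (t + 1) ω ω') (u : Fin n) :
    Wants A ω u t ↔ Wants A ω' u t := by
  simp only [Wants, (h.mono (Nat.le_succ t)).wakeBefore_eq A]
  refine exists_congr fun w => and_congr_right fun hw => ?_
  have := wakeBefore_lt A hw
  rw [h u w (t - w) (by omega)]

theorem Agree.pending_eq {t : ℕ} {ω ω' : Coins n} (h : Agree t ω ω') :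
    pending A ω t = pending A ω' t := by
  induction t with
  | zero => rfl
  | succ t ih =>
    simp only [pending, ih (h.mono (Nat.le_succ t)), h.wants_iff A]

theorem Agree.succeeds_iff {t : ℕ} {ω ω' : Coins n} (h : Agree (t + 1) ω ω') (u : Fin n) :
    Succeeds A ω u t ↔ Succeeds A ω' u t := by
  simp only [Succeeds, (h.mono (Nat.le_succ t)).pending_eq A, h.wants_iff A]

/-! ### Contention and conditional success probabilities. -/

open Classical in
/-- The undamped grab probability of party `v` at time `t`. -/
noncomputable def weight (ω : Coins n) (t : ℕ) (v : Fin n) : ℝ :=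
  if v ∈ pending A ω t then
    match wakeBefore A ω t v with
    | some w => baseProb (t - w)
    | none => 0
  else 0

/-- The undamped contention at time `t`. -/
noncomputable def contention (ω : Coins n) (t : ℕ) : ℝ := ∑ v, weight A ω t v

theorem weight_of_wake {ω : Coins n} {t : ℕ} {v : Fin n} {w : ℕ} (hv : v ∈ pending A ω t)
    (hw : wakeBefore A ω t v = some w) : weight A ω t v = baseProb (t - w) := by
  simp [weight, hv, hw]

theorem weight_of_notMem {ω : Coins n} {t : ℕ} {v : Fin n} (hv : v ∉ pending A ω t) :
    weight A ω t v = 0 := by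
  simp [weight, hv]

theorem weight_of_asleep {ω : Coins n} {t : ℕ} {v : Fin n} (hv : wakeBefore A ω t v = none) :
    weight A ω t v = 0 := by
  simp [weight, hv]

theorem weight_nonneg (ω : Coins n) (t : ℕ) (v : Fin n) : 0 ≤ weight A ω t v := by
  unfold weight
  split
  · split
    · exact (baseProb_pos _).le
    · exact le_rfl
  · exact le_rfl

theorem contention_nonneg (ω : Coins n) (t : ℕ) : 0 ≤ contention A ω t :=
  Finset.sum_nonneg fun _ _ => weight_nonneg A ω t _

theorem Agree.contention_eq {t : ℕ} {ω ω' : Coins n} (h : Agree t ω ω') :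
    contention A ω t = contention A ω' t := by
  refine Finset.sum_congr rfl fun v _ => ?_
  rw [weight, weight, h.pending_eq A, h.wakeBefore_eq A]

theorem one_sub_sum_le_prod_one_sub {ι : Type*} (s : Finset ι) (f : ι → ℝ) (h0 : ∀ i ∈ s, 0 ≤ f i)
    (h1 : ∀ i ∈ s, f i ≤ 1) : 1 - ∑ i ∈ s, f i ≤ ∏ i ∈ s, (1 - f i) := by
  classical
  induction s using Finset.induction_on with
  | empty => simp
  | insert a s ha ih =>
    rw [Finset.sum_insert ha, Finset.prod_insert ha]
    have ih' := ih (fun i hi => h0 i (Finset.mem_insert_of_mem hi))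
      fun i hi => h1 i (Finset.mem_insert_of_mem hi)
    have ha0 := h0 a (Finset.mem_insert_self a s)
    have ha1 := h1 a (Finset.mem_insert_self a s)
    have hs : 0 ≤ ∑ i ∈ s, f i := Finset.sum_nonneg fun i hi => h0 i (Finset.mem_insert_of_mem hi)
    nlinarith [mul_le_mul_of_nonneg_left ih' (sub_nonneg.2 ha1), mul_nonneg ha0 hs]

/-- If the damped contention is at most `1 / 2`, then each party has success probability at least
half its grab probability. -/
theorem succeeds_measureReal_ge (ω₀ : Coins n) (t : ℕ)
    (hC : contention A ω₀ t / 2 ^ level t ≤ 1 / 2) (v : Fin n) :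
    weight A ω₀ t v / 2 ^ level t / 2 * (coinLaw levelProtocol n).real {ω | Agree t ω₀ ω} ≤
      (coinLaw levelProtocol n).real ({ω | Agree t ω₀ ω} ∩ {ω | Succeeds A ω v t}) := by
  classical
  set P := (coinLaw levelProtocol n).real {ω | Agree t ω₀ ω} with hP
  have hP0 : 0 ≤ P := measureReal_nonneg
  set S : Finset (Fin n) := Finset.univ.filter fun u =>
    u ∈ pending A ω₀ t ∧ (wakeBefore A ω₀ t u).isSome with hS
  by_cases hv : v ∈ S
  swap
  · have : weight A ω₀ t v = 0 := by
      simp only [hS, Finset.mem_filter, Finset.mem_univ, true_and, not_and,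
        Option.not_isSome_iff_eq_none] at hv
      by_cases h : v ∈ pending A ω₀ t
      · exact weight_of_asleep A (hv h)
      · exact weight_of_notMem A h
    rw [this]
    simp [measureReal_nonneg]
  -- The default `0` is irrelevant, since parties in `S` are awake.
  set W : Fin n → ℕ := fun u => (wakeBefore A ω₀ t u).getD 0 with hW
  have hWS : ∀ u ∈ S, wakeBefore A ω₀ t u = some (W u) := by
    intro u hu
    obtain ⟨w, hw⟩ := Option.isSome_iff_exists.1 (Finset.mem_filter.1 hu).2.2
    simp [hW, hw]
  have hWt : ∀ u ∈ S, W u < t := fun u hu => wakeBefore_lt A (hWS u hu)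
  have hpend : ∀ u ∈ S, u ∈ pending A ω₀ t := fun u hu => (Finset.mem_filter.1 hu).2.1
  -- Given the past, `v` succeeds as soon as it is the only member of `S` whose current bit is one;
  -- these bits are independent of the past.
  have hincl : {ω | Agree t ω₀ ω} ∩ {ω | ∀ u ∈ S, ω u (W u) (t - W u) = decide (u = v)} ⊆
      {ω | Agree t ω₀ ω} ∩ {ω | Succeeds A ω v t} := by
    rintro ω ⟨hag, hb⟩
    refine ⟨hag, ?_⟩
    have hag' : Agree t ω₀ ω := hag
    have h1 := hag'.wakeBefore_eq A
    have h2 := hag'.pending_eq A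
    change {x | x ∈ pending A ω t ∧ Wants A ω x t} = {v}
    ext u
    simp only [Set.mem_ofPred_eq, Set.mem_singleton_iff, Wants, ← h1, ← h2]
    constructor
    · rintro ⟨hu, w, hw, hx⟩
      have huS : u ∈ S := by simp [hS, hu, hw]
      have := hb u huS
      have hww : W u = w := by simp [hW, hw]
      rw [hww, hx] at this
      simpa using this.symm
    · rintro rfl
      refine ⟨hpend u hv, W u, hWS u hv, ?_⟩
      simpa using hb u hv
  refine le_trans ?_ (measureReal_mono hincl)
  rw [levelProtocol, coinLaw_agree_inter _ t ω₀ S W (fun u hu => (hWt u hu).le), mul_comm]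
  refine mul_le_mul_of_nonneg_left ?_ hP0
  set q : Fin n → ℝ := fun u => weight A ω₀ t u / 2 ^ level t with hq
  have hq0 : ∀ u, 0 ≤ q u := fun u => div_nonneg (weight_nonneg A ω₀ t u) (by positivity)
  have hqsum : ∑ u ∈ S, q u ≤ 1 / 2 := by
    refine le_trans ?_ hC
    rw [contention, Finset.sum_div]
    exact Finset.sum_le_univ_sum_of_nonneg hq0
  have hq1 : ∀ u ∈ S, q u ≤ 1 := fun u hu => by
    have := Finset.single_le_sum (f := q) (fun i _ => hq0 i) hu
    linarith
  have hfac : ∀ u ∈ S, (ProbabilityTheory.bernoulliMeasure true false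
      (⟨baseProb (t - W u) / 2 ^ level (W u + (t - W u)), slotProb_mem _ _⟩ : unitInterval)).real
        {decide (u = v)} = if u = v then q u else 1 - q u := by
    intro u hu
    have h1 : W u + (t - W u) = t := by have := hWt u hu; omega
    have h2 : q u = baseProb (t - W u) / 2 ^ level t := by
      rw [hq]; simp only [weight_of_wake A (hpend u hu) (hWS u hu)]
    by_cases huv : u = v
    · subst huv
      simp [h2, h1]
    · simp [huv, h2, h1]
  rw [Finset.prod_congr rfl hfac, ← Finset.mul_prod_erase S _ hv, if_pos rfl,
    Finset.prod_congr (g := fun u => 1 - q u) rfl fun u hu => if_neg (Finset.ne_of_mem_erase hu)]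
  have h3 := one_sub_sum_le_prod_one_sub (S.erase v) q (fun i _ => hq0 i)
    fun i hi => hq1 i (Finset.mem_of_mem_erase hi)
  have h4 : ∑ u ∈ S.erase v, q u ≤ ∑ u ∈ S, q u :=
    Finset.sum_le_sum_of_subset_of_nonneg (Finset.erase_subset v S) fun i _ _ => hq0 i
  have h5 := hq0 v
  change q v / 2 ≤ _
  nlinarith

theorem det_succeeds (v : Fin n) (t : ℕ) : Det (t + 1) {ω | Succeeds A ω v t} :=
  fun _ _ h => h.succeeds_iff A v

/-- Successes of different parties in one slot are disjoint events, so the individual bounds add up.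
-/
theorem exists_succeeds_measureReal_ge (ω₀ : Coins n) (t : ℕ)
    (hC : contention A ω₀ t / 2 ^ level t ≤ 1 / 2) :
    contention A ω₀ t / 2 ^ level t / 2 * (coinLaw levelProtocol n).real {ω | Agree t ω₀ ω} ≤
      (coinLaw levelProtocol n).real ({ω | Agree t ω₀ ω} ∩ {ω | ∃ v, Succeeds A ω v t}) := by
  have h : {ω | Agree t ω₀ ω} ∩ {ω | ∃ v, Succeeds A ω v t} =
      ⋃ v, {ω | Agree t ω₀ ω} ∩ {ω | Succeeds A ω v t} := by
    ext ω; simp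
  have hdet : Det t {ω | Agree t ω₀ ω} := fun ω ω' hω =>
    ⟨fun h u w i hi => (h u w i hi).trans (hω u w i hi),
      fun h u w i hi => (h u w i hi).trans (hω u w i hi).symm⟩
  rw [h, measureReal_iUnion_fintype]
  · rw [contention, Finset.sum_div, Finset.sum_div, Finset.sum_mul]
    exact Finset.sum_le_sum fun v _ => succeeds_measureReal_ge A ω₀ t hC v
  · intro u v huv
    refine Set.disjoint_left.2 fun ω hu hv => huv ?_
    exact Succeeds.unique_party A hu.2 hv.2
  · exact fun v => hdet.measurableSet.inter (det_succeeds A v t).measurableSet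

end Runs

/-! ### Busy and quiet slots in blocks. -/

/-- In slot `t` some party succeeds with at least constant probability. -/
def BusySlot {n : ℕ} (A : Adversary n) (ω : Coins n) (t : ℕ) : Prop :=
  1 / 8 ≤ contention A ω t / 2 ^ level t ∧ contention A ω t / 2 ^ level t ≤ 1 / 2

/-- In slot `t` each party succeeds with probability at least half its undamped grab
probability. -/
def QuietSlot {n : ℕ} (A : Adversary n) (ω : Coins n) (t : ℕ) : Prop :=
  level t = 0 ∧ contention A ω t ≤ 1 / 2

/-- Sampling every `B` slots gives ages at least `1, 2, 3, …` from the first sample after the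
wake-up time `x` on, and `baseProb` decreases. Samples up to `x` contribute nothing and are dropped
one at a time. -/
theorem sum_baseProb_progression_le {B : ℕ} (hB : 1 ≤ B) (x N a : ℕ) :
    ∑ k ∈ Finset.range N, (if x < a + k * B then baseProb (a + k * B - x) else 0) ≤
      ∑ i ∈ Finset.range N, baseProb (1 + i) := by
  induction N generalizing a with
  | zero => simp
  | succ N ih =>
    rcases lt_or_ge x a with h | h
    · refine Finset.sum_le_sum fun k _ => ?_
      rw [if_pos (by omega)]
      refine baseProb_antitone ?_
      have : k ≤ k * B := Nat.le_mul_of_pos_right k hB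
      omega
    · rw [Finset.sum_range_succ', Finset.sum_range_succ]
      rw [if_neg (by omega), add_zero]
      refine (le_of_eq ?_).trans ((ih (a + B)).trans (le_add_of_nonneg_right (baseProb_pos _).le))
      refine Finset.sum_congr rfl fun k _ => ?_
      have : a + (k + 1) * B = a + B + k * B := by ring
      rw [this]

theorem exists_slotCount_eq_card {n : ℕ} (M : ℕ → Set (Coins n)) (T : ℕ) (ω : Coins n) :
    ∃ S : Finset ℕ, slotCount M 0 T ω = S.card ∧ ∀ t, t ∈ S ↔ t < T ∧ ω ∈ M t := by
  classical
  refine ⟨_, rfl, fun t => ?_⟩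
  rw [Finset.mem_filter, Finset.mem_Ico]
  simp

theorem card_le_slotCount {n : ℕ} {M : ℕ → Set (Coins n)} {T : ℕ} {ω : Coins n} {S : Finset ℕ}
    (h : ∀ t ∈ S, t < T ∧ ω ∈ M t) : S.card ≤ slotCount M 0 T ω := by
  obtain ⟨S', h1, h2⟩ := exists_slotCount_eq_card M T ω
  rw [h1]
  exact Finset.card_le_card fun t ht => (h2 t).2 (h t ht)

section Blocks

variable {n : ℕ} (A : Adversary n) (ω : Coins n)

/-- A wake-up spoils only the block that contains it and the next one. -/
theorem card_blocks_near_wake_le {W : Fin n → Option ℕ} {B : ℕ} (hB : 1 ≤ B) (a N : ℕ) :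
    ((Finset.range N).filter fun k => ∃ v x, W v = some x ∧ a + k * B ≤ x + B ∧
      x < a + k * B + B).card ≤ 2 * n := by
  set b : Fin n → ℕ := fun v => ((W v).getD 0 + B - a) / B with hb
  have hsub : ((Finset.range N).filter fun k => ∃ v x, W v = some x ∧ a + k * B ≤ x + B ∧
      x < a + k * B + B) ⊆ Finset.univ.biUnion fun v => {b v - 1, b v} := by
    intro k hk
    obtain ⟨v, x, hv, h1, h2⟩ := (Finset.mem_filter.1 hk).2
    refine Finset.mem_biUnion.2 ⟨v, Finset.mem_univ v, ?_⟩
    have hbv : b v = (x + B - a) / B := by simp [hb, hv]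
    have h3 : k ≤ b v := by
      rw [hbv, Nat.le_div_iff_mul_le hB]; omega
    have h4 : b v < k + 2 := by
      rw [hbv, Nat.div_lt_iff_lt_mul hB, add_mul]; omega
    simp only [Finset.mem_insert, Finset.mem_singleton]
    omega
  calc _ ≤ _ := Finset.card_le_card hsub
    _ ≤ (Finset.univ : Finset (Fin n)).card * 2 :=
      Finset.card_biUnion_le_card_mul _ _ _ fun v _ => Finset.card_le_two
    _ = 2 * n := by rw [Finset.card_univ, Fintype.card_fin, mul_comm]

theorem card_blocks_with_success_le {B : ℕ} (a N : ℕ) [DecidablePred fun k =>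
      ∃ v t, a + k * B ≤ t ∧ t < a + k * B + B ∧ Succeeds A ω v t] :
    ((Finset.range N).filter fun k => ∃ v t, a + k * B ≤ t ∧ t < a + k * B + B ∧
      Succeeds A ω v t).card ≤ n := by
  classical
  rcases Nat.eq_zero_or_pos n with rfl | hn
  · rw [Finset.filter_false_of_mem]
    · simp
    · rintro k _ ⟨v, _⟩
      exact v.elim0
  have : Nonempty (Fin n) := ⟨⟨0, hn⟩⟩
  have hch : ∀ k, ∃ v, (∃ v t, a + k * B ≤ t ∧ t < a + k * B + B ∧ Succeeds A ω v t) →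
      ∃ t, a + k * B ≤ t ∧ t < a + k * B + B ∧ Succeeds A ω v t := fun k => by
    by_cases h : ∃ v t, a + k * B ≤ t ∧ t < a + k * B + B ∧ Succeeds A ω v t
    · exact ⟨h.choose, fun _ => h.choose_spec⟩
    · exact ⟨Classical.arbitrary _, fun h' => absurd h' h⟩
  choose f hf using hch
  have := Finset.card_le_card_of_injOn (t := (Finset.univ : Finset (Fin n))) f
    (s := (Finset.range N).filter fun k => ∃ v t, a + k * B ≤ t ∧ t < a + k * B + B ∧
      Succeeds A ω v t) (fun _ _ => Finset.mem_coe.2 (Finset.mem_univ _)) ?_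
  · simpa using this
  · intro k hk k' hk' h
    obtain ⟨t, h1, h2, h3⟩ := hf k (Finset.mem_filter.1 hk).2
    obtain ⟨t', h1', h2', h3'⟩ := hf k' (Finset.mem_filter.1 hk').2
    rw [h] at h3
    obtain rfl := Succeeds.unique_time A h3 h3'
    have e1 : k < k' + 1 := by
      have : k * B < (k' + 1) * B := by rw [add_mul]; omega
      exact lt_of_mul_lt_mul_right this (Nat.zero_le B)
    have e2 : k' < k + 1 := by
      have : k' * B < (k + 1) * B := by rw [add_mul]; omega
      exact lt_of_mul_lt_mul_right this (Nat.zero_le B)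
    omega

theorem sum_contention_le {B : ℕ} (hB : 1 ≤ B) (a N : ℕ) :
    ∑ k ∈ Finset.range N, contention A ω (a + k * B) ≤
      n * ∑ i ∈ Finset.range N, baseProb (1 + i) := by
  obtain ⟨W, hW⟩ := exists_wakeTime A ω
  simp only [contention]
  rw [Finset.sum_comm]
  have : ∀ v ∈ (Finset.univ : Finset (Fin n)),
      ∑ k ∈ Finset.range N, weight A ω (a + k * B) v ≤
        ∑ i ∈ Finset.range N, baseProb (1 + i) := by
    intro v _
    refine le_trans (Finset.sum_le_sum fun k _ => ?_)
      (sum_baseProb_progression_le hB ((W v).getD 0) N a)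
    by_cases hp : v ∈ pending A ω (a + k * B)
    · rcases hw : wakeBefore A ω (a + k * B) v with _ | w
      · rw [weight_of_asleep A hw]
        split_ifs
        · exact (baseProb_pos _).le
        · exact le_rfl
      · rw [weight_of_wake A hp hw]
        obtain ⟨h1, h2⟩ := (hW _ _ _).1 hw
        rw [h1, Option.getD_some, if_pos h2]
    · rw [weight_of_notMem A hp]
      split_ifs
      · exact (baseProb_pos _).le
      · exact le_rfl
  refine (Finset.sum_le_sum this).trans_eq ?_
  simp

/-- Markov's inequality for the contention summed over block starts, which is at most `n * 2 ^ R`.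
-/
theorem card_blocks_overloaded_le {B R N : ℕ} (hB : 1 ≤ B) (a : ℕ)
    (hR : ∑ i ∈ Finset.range N, baseProb (1 + i) ≤ 2 ^ R)
    [DecidablePred fun k => (2 : ℝ) ^ R < contention A ω (a + k * B)] :
    ((Finset.range N).filter fun k => (2 : ℝ) ^ R < contention A ω (a + k * B)).card ≤ n := by
  have h1 : ((Finset.range N).filter fun k => (2 : ℝ) ^ R < contention A ω (a + k * B)).card •
      (2 : ℝ) ^ R ≤ ∑ k ∈ (Finset.range N).filter fun k =>
        (2 : ℝ) ^ R < contention A ω (a + k * B), contention A ω (a + k * B) :=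
    Finset.card_nsmul_le_sum _ _ _ fun k hk => (Finset.mem_filter.1 hk).2.le
  have h2 := Finset.sum_le_sum_of_subset_of_nonneg (Finset.filter_subset (fun k =>
    (2 : ℝ) ^ R < contention A ω (a + k * B)) (Finset.range N))
    fun k _ _ => contention_nonneg A ω (a + k * B)
  have h3 := sum_contention_le A ω hB a N
  have h4 : (n : ℝ) * ∑ i ∈ Finset.range N, baseProb (1 + i) ≤ n * 2 ^ R := by gcongr
  have h5 := h1.trans (h2.trans (h3.trans h4))
  rw [nsmul_eq_mul] at h5
  exact_mod_cast le_of_mul_le_mul_right h5 (by positivity)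

/-- Without wake-ups and successes the set of competing parties is constant in the block. All of
them are older than `B` at its start, so no age more than doubles. -/
theorem weight_bounds_of_calm {W : Fin n → Option ℕ}
    (hW : ∀ t v w, wakeBefore A ω t v = some w ↔ W v = some w ∧ w < t) {B s t : ℕ} (hst : s ≤ t)
    (ht : t < s + B) (hwake : ¬ ∃ v x, W v = some x ∧ s ≤ x + B ∧ x < s + B)
    (hsucc : ¬ ∃ v i, s ≤ i ∧ i < s + B ∧ Succeeds A ω v i) (v : Fin n) :
    weight A ω s v / 2 ≤ weight A ω t v ∧ weight A ω t v ≤ weight A ω s v := by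
  by_cases hp : v ∈ pending A ω s
  swap
  · have hp' : v ∉ pending A ω t := fun h => hp (pending_antitone A ω hst h)
    rw [weight_of_notMem A hp, weight_of_notMem A hp']
    norm_num
  have hp' : v ∈ pending A ω t := mem_pending_of_no_success A hst hp fun i h1 h2 h3 =>
    hsucc ⟨v, i, h1, by omega, h3⟩
  rcases hw : wakeBefore A ω s v with _ | x
  · have hw' : wakeBefore A ω t v = none := by
      by_contra hne
      obtain ⟨x, hx⟩ := Option.ne_none_iff_exists'.1 hne
      obtain ⟨h1, h2⟩ := (hW _ _ _).1 hx
      by_cases hxs : x < s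
      · rw [(hW s v x).2 ⟨h1, hxs⟩] at hw
        cases hw
      · exact hwake ⟨v, x, h1, by omega, by omega⟩
    rw [weight_of_asleep A hw, weight_of_asleep A hw']
    norm_num
  · obtain ⟨h1, h2⟩ := (hW _ _ _).1 hw
    have hw' := (hW t v x).2 ⟨h1, by omega⟩
    rw [weight_of_wake A hp hw, weight_of_wake A hp' hw']
    have hfar : x + B < s := by
      by_contra h
      exact hwake ⟨v, x, h1, by omega, by omega⟩
    refine ⟨(half_baseProb_le _).trans (baseProb_antitone (by omega)),
      baseProb_antitone (by omega)⟩

/-- If the contention at the block start is at most `1 / 2`, a slot of level zero is quiet.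
Otherwise a slot whose level matches the binary logarithm of the contention is busy. -/
theorem exists_good_slot {W : Fin n → Option ℕ}
    (hW : ∀ t v w, wakeBefore A ω t v = some w ↔ W v = some w ∧ w < t) {B R s : ℕ}
    (hB : ∀ r ≤ R + 1, levelPeriod r ≤ B)
    (hwake : ¬ ∃ v x, W v = some x ∧ s ≤ x + B ∧ x < s + B)
    (hsucc : ¬ ∃ v i, s ≤ i ∧ i < s + B ∧ Succeeds A ω v i)
    (hC : contention A ω s ≤ 2 ^ R) :
    ∃ t, s ≤ t ∧ t < s + B ∧ (BusySlot A ω t ∨ QuietSlot A ω t) := by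
  have hb : ∀ t, s ≤ t → t < s + B →
      contention A ω s / 2 ≤ contention A ω t ∧ contention A ω t ≤ contention A ω s := by
    intro t h1 h2
    have := weight_bounds_of_calm A ω hW h1 h2 hwake hsucc
    rw [contention, contention, Finset.sum_div]
    exact ⟨Finset.sum_le_sum fun v _ => (this v).1, Finset.sum_le_sum fun v _ => (this v).2⟩
  rcases le_or_gt (contention A ω s) (1 / 2) with h | h
  · obtain ⟨t, h1, h2, h3⟩ := exists_level_eq 0 s
    have h2' : t < s + B := h2.trans_le (Nat.add_le_add_left (hB 0 (by omega)) s)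
    exact ⟨t, h1, h2', Or.inr ⟨h3, (hb t h1 h2').2.trans h⟩⟩
  · classical
    have hex : ∃ r, contention A ω s ≤ 2 ^ r := ⟨R, hC⟩
    set r := Nat.find hex with hr
    have hr1 : contention A ω s ≤ 2 ^ r := Nat.find_spec hex
    have hrR : r ≤ R := Nat.find_min' hex hC
    have hr2 : 2 ^ r / 2 < contention A ω s := by
      rcases Nat.eq_zero_or_pos r with h0 | h0
      · rw [h0]; simpa using h
      · have h3 := Nat.find_min hex (m := r - 1) (by omega)
        rw [not_le] at h3
        refine lt_of_eq_of_lt ?_ h3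
        obtain ⟨q, hq⟩ : ∃ q, r = q + 1 := ⟨r - 1, by omega⟩
        rw [hq, Nat.add_sub_cancel, pow_succ]
        ring
    -- The initial contention lies in `(2 ^ r / 2, 2 ^ r]` and may halve within the block. Level `r
    -- + 1` thus puts the damped contention between `1 / 8` and `1 / 2`.
    obtain ⟨t, h1, h2, h3⟩ := exists_level_eq (r + 1) s
    have h2' : t < s + B := h2.trans_le (Nat.add_le_add_left (hB (r + 1) (by omega)) s)
    refine ⟨t, h1, h2', Or.inl ?_⟩
    obtain ⟨h4, h5⟩ := hb t h1 h2'
    have h6 : (0 : ℝ) < 2 ^ r := by positivity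
    rw [BusySlot, h3, pow_succ]
    constructor
    · rw [le_div_iff₀ (by positivity)]
      linarith
    · rw [div_le_iff₀ (by positivity)]
      linarith

open Classical in
/-- A window of `132 n` blocks that each contain all levels up to `R + 1` has many busy or many
quiet slots. -/
theorem many_good_slots {B R : ℕ} (hB : ∀ r ≤ R + 1, levelPeriod r ≤ B)
    (hR : ∑ i ∈ Finset.range (132 * n), baseProb (1 + i) ≤ 2 ^ R) (a : ℕ) :
    64 * n ≤ ((Finset.Ico a (a + 132 * n * B)).filter fun t => BusySlot A ω t).card ∨
    64 * n ≤ ((Finset.Ico a (a + 132 * n * B)).filter fun t => QuietSlot A ω t).card := by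
  obtain ⟨W, hW⟩ := exists_wakeTime A ω
  have hB1 : 1 ≤ B := (Nat.one_le_two_pow).trans (hB 0 (by omega))
  set N := 132 * n with hN
  set B1 := (Finset.range N).filter fun k => ∃ v x, W v = some x ∧ a + k * B ≤ x + B ∧
      x < a + k * B + B with hB1def
  set B2 := (Finset.range N).filter fun k => ∃ v t, a + k * B ≤ t ∧ t < a + k * B + B ∧
      Succeeds A ω v t with hB2def
  set B3 := (Finset.range N).filter fun k => (2 : ℝ) ^ R < contention A ω (a + k * B) with hB3def
  have c1 : B1.card ≤ 2 * n := by
    have := card_blocks_near_wake_le (W := W) hB1 a N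
    convert this
  have c2 : B2.card ≤ n := card_blocks_with_success_le A ω a N
  have c3 : B3.card ≤ n := card_blocks_overloaded_le A ω hB1 a hR
  set K := Finset.range N \ (B1 ∪ B2 ∪ B3) with hK
  -- At most `2 n + n + n` of the `132 n` blocks are discarded.
  have hKcard : 128 * n ≤ K.card := by
    have h1 := Finset.le_card_sdiff (B1 ∪ B2 ∪ B3) (Finset.range N)
    have h2 := Finset.card_union_le (B1 ∪ B2) B3
    have h3 := Finset.card_union_le B1 B2
    rw [Finset.card_range] at h1
    rw [hK]
    omega
  have hgood : ∀ k ∈ K, ∃ t, a + k * B ≤ t ∧ t < a + k * B + B ∧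
      (BusySlot A ω t ∨ QuietSlot A ω t) := by
    intro k hk
    rw [hK, Finset.mem_sdiff, Finset.mem_union, Finset.mem_union, not_or, not_or] at hk
    obtain ⟨hkN, ⟨h1, h2⟩, h3⟩ := hk
    rw [hB1def, Finset.mem_filter, not_and] at h1
    rw [hB2def, Finset.mem_filter, not_and] at h2
    rw [hB3def, Finset.mem_filter, not_and] at h3
    exact exists_good_slot A ω hW hB (h1 hkN) (h2 hkN) (not_lt.1 (h3 hkN))
  choose! f hf using hgood
  set G1 := (Finset.Ico a (a + N * B)).filter fun t => BusySlot A ω t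
  set G2 := (Finset.Ico a (a + N * B)).filter fun t => QuietSlot A ω t
  have hinj : K.card ≤ (G1 ∪ G2).card := by
    refine Finset.card_le_card_of_injOn f ?_ ?_
    · intro k hk
      obtain ⟨h1, h2, h3⟩ := hf k hk
      have hkN : k < N := Finset.mem_range.1 (Finset.mem_sdiff.1 hk).1
      have h4 : (k + 1) * B ≤ N * B := Nat.mul_le_mul_right B hkN
      rw [add_mul, one_mul] at h4
      have hmem : f k ∈ Finset.Ico a (a + N * B) := Finset.mem_Ico.2 ⟨by omega, by omega⟩
      refine Finset.mem_coe.2 (Finset.mem_union.2 ?_)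
      rcases h3 with h3 | h3
      · exact Or.inl (Finset.mem_filter.2 ⟨hmem, h3⟩)
      · exact Or.inr (Finset.mem_filter.2 ⟨hmem, h3⟩)
    · intro k hk k' hk' h
      obtain ⟨h1, h2, _⟩ := hf k hk
      obtain ⟨h1', h2', _⟩ := hf k' hk'
      rw [h] at h1 h2
      have e1 : k < k' + 1 := by
        have : k * B < (k' + 1) * B := by rw [add_mul]; omega
        exact lt_of_mul_lt_mul_right this (Nat.zero_le B)
      have e2 : k' < k + 1 := by
        have : k' * B < (k + 1) * B := by rw [add_mul]; omega
        exact lt_of_mul_lt_mul_right this (Nat.zero_le B)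
      omega
  have := Finset.card_union_le G1 G2
  omega

end Blocks

/-! ### The failure probability of the level protocol. -/

section Tail

variable {n : ℕ} (A : Adversary n) (u : Fin n) (L : ℕ)

/-- Party `u` is pending at time `t`, and was woken up at most `L` slots ago. -/
def Active (ω : Coins n) (t : ℕ) : Prop :=
  ∃ w, wakeBefore A ω t u = some w ∧ t ≤ w + L ∧ u ∈ pending A ω t

theorem Agree.active_iff {t : ℕ} {ω ω' : Coins n} (h : Agree t ω ω') :
    Active A u L ω t ↔ Active A u L ω' t := by
  simp only [Active, h.wakeBefore_eq A, h.pending_eq A]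

/-- Each party succeeds at most once, so at most `n` marked slots are hit although each is hit with
conditional probability at least `1 / 16`. -/
theorem measureReal_many_busy_le (T : ℕ) :
    (coinLaw levelProtocol n).real {ω | 64 * n ≤
      slotCount (fun t => {ω | Active A u L ω t ∧ BusySlot A ω t}) 0 T ω} ≤ (1 / 2) ^ n := by
  have h := measureReal_many_marked_few_success (μ := coinLaw levelProtocol n)
    (M := fun t => {ω | Active A u L ω t ∧ BusySlot A ω t})
    (E := fun t => {ω | ∃ v, Succeeds A ω v t}) (c := 1 / 16) (by norm_num) (by norm_num) ?_ ?_ ?_ T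
    (64 * n) n
  · refine (measureReal_mono ?_).trans (h.trans ?_)
    · intro ω hω
      refine ⟨hω, ?_⟩
      obtain ⟨S, hS, hmem⟩ := exists_slotCount_eq_card
        (fun t => {ω | Active A u L ω t ∧ BusySlot A ω t} ∩ {ω | ∃ v, Succeeds A ω v t}) T ω
      rw [hS]
      have hex : ∀ i ∈ S, ∃ v, Succeeds A ω v i := fun i hi => ((hmem i).1 hi).2.2
      have : Nonempty (Fin n) := ⟨u⟩
      choose! f hf using hex
      have := Finset.card_le_card_of_injOn (t := (Finset.univ : Finset (Fin n))) f (s := S)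
        (fun _ _ => Finset.mem_coe.2 (Finset.mem_univ _)) fun i hi j hj hij => by
          have h1 := hf i hi
          rw [hij] at h1
          exact Succeeds.unique_time A h1 (hf j hj)
      simpa using this
    -- The bound is `(2 * (31 / 32) ^ 64) ^ n`, and the base is below `1 / 2`.
    · rw [pow_mul, ← mul_pow]
      refine pow_le_pow_left₀ (by norm_num) ?_ n
      norm_num
  · intro t ω ω' h
    simp only [Set.mem_ofPred_eq, BusySlot, h.active_iff A u L, h.contention_eq A]
  · intro t ω ω' h
    simp only [Set.mem_ofPred_eq, h.succeeds_iff A]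
  · rintro t ω ⟨_, h1, h2⟩
    refine le_trans ?_ (exists_succeeds_measureReal_ge A ω t h2)
    refine mul_le_mul_of_nonneg_right ?_ measureReal_nonneg
    linarith

/-- While `u` is active its age is at most `L`, so each quiet slot is a success of `u` with
conditional probability at least `baseProb L / 2`. -/
theorem measureReal_many_quiet_le (T : ℕ) :
    (coinLaw levelProtocol n).real {ω | 64 * n ≤
      slotCount (fun t => {ω | Active A u L ω t ∧ QuietSlot A ω t}) 0 T ω ∧
      ∀ t < T, Active A u L ω t → ¬ Succeeds A ω u t} ≤ (1 - baseProb L / 4) ^ (64 * n) := by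
  have hb0 := baseProb_pos L
  have hb1 := baseProb_le_half L
  have h := measureReal_many_marked_few_success (μ := coinLaw levelProtocol n)
    (M := fun t => {ω | Active A u L ω t ∧ QuietSlot A ω t})
    (E := fun t => {ω | Succeeds A ω u t}) (c := baseProb L / 2) (by linarith) (by linarith)
    ?_ ?_ ?_ T (64 * n) 0
  · refine (measureReal_mono ?_).trans (h.trans_eq ?_)
    · rintro ω ⟨hω, hs⟩
      refine ⟨hω, ?_⟩
      obtain ⟨S, hS, hmem⟩ := exists_slotCount_eq_card
        (fun t => {ω | Active A u L ω t ∧ QuietSlot A ω t} ∩ {ω | Succeeds A ω u t}) T ω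
      rw [hS, Nat.le_zero, Finset.card_eq_zero, Finset.eq_empty_iff_forall_notMem]
      intro t ht
      obtain ⟨h0, h1, h2⟩ := (hmem t).1 ht
      exact hs t h0 h1.1 h2
    · rw [pow_zero, one_mul]
      congr 1
      ring
  · intro t ω ω' h
    simp only [Set.mem_ofPred_eq, QuietSlot, h.active_iff A u L, h.contention_eq A]
  · exact fun t => det_succeeds A u t
  · rintro t ω ⟨⟨w, hw, hL, hp⟩, h1, h2⟩
    have h3 := succeeds_measureReal_ge A ω t (by rw [h1]; simpa using h2) u
    refine le_trans ?_ h3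
    rw [h1, pow_zero, div_one, weight_of_wake A hp hw]
    gcongr
    exact baseProb_antitone (by omega)

theorem measure_not_latencyAtMost_le {B R : ℕ} (hB : ∀ r ≤ R + 1, levelPeriod r ≤ B)
    (hR : ∑ i ∈ Finset.range (132 * n), baseProb (1 + i) ≤ 2 ^ R) :
    (coinLaw levelProtocol n).real {ω | ¬ LatencyAtMost A ω u (132 * n * B)} ≤
      (1 / 2) ^ n + (1 - baseProb (132 * n * B) / 4) ^ (64 * n) := by
  classical
  set L := 132 * n * B with hL
  set δ := (1 / 2 : ℝ) ^ n + (1 - baseProb L / 4) ^ (64 * n) with hδ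
  have hb1 := baseProb_le_half L
  have hδ0 : 0 ≤ δ := add_nonneg (by positivity) (pow_nonneg (by linarith) _)
  -- Failures that are visible before `T`. The adversary may delay waking `u` without bound, so the
  -- tail bounds are applied for finite `T` and passed to the increasing union.
  set F : ℕ → Set (Coins n) := fun T => {ω | ∃ w, wakeBefore A ω T u = some w ∧ w + L < T ∧
    u ∈ pending A ω (w + L + 1)} with hF
  have hFmono : Monotone F := by
    rintro T T' hT ω ⟨w, h1, h2, h3⟩
    exact ⟨w, wakeBefore_mono A hT h1, by omega, h3⟩
  have hsub : {ω | ¬ LatencyAtMost A ω u L} ⊆ ⋃ T, F T := by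
    intro ω hω
    simp only [Set.mem_ofPred_eq, LatencyAtMost, not_forall, not_exists, not_and] at hω
    obtain ⟨w, ⟨t, ht⟩, hs⟩ := hω
    refine Set.mem_iUnion.2 ⟨w + L + 1, w, wakeBefore_of_lt A ht (by omega), by omega, ?_⟩
    refine mem_pending_of_no_success A (Nat.zero_le _) (Set.mem_univ u) fun i _ hi hsi => ?_
    obtain ⟨w', hw', _⟩ := (Succeeds.mem A hsi).2
    have hlt := wakeBefore_lt A hw'
    have h1 := wakeBefore_mono A (le_max_left t i) ht
    have h2 := wakeBefore_mono A (le_max_right t i) hw'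
    rw [h1] at h2
    cases h2
    exact hs (i - w) (by omega) (by rwa [Nat.add_sub_cancel' hlt.le])
  have hFT : ∀ T, (coinLaw levelProtocol n).real (F T) ≤ δ := by
    intro T
    refine le_trans ?_ (add_le_add (measureReal_many_busy_le A u L T)
      (measureReal_many_quiet_le A u L T))
    refine le_trans (measureReal_mono ?_) (measureReal_union_le _ _)
    rintro ω ⟨w, h1, h2, h3⟩
    have hact : ∀ t ∈ Finset.Ico (w + 1) (w + 1 + 132 * n * B), Active A u L ω t := by
      intro t ht
      rw [Finset.mem_Ico] at ht
      exact ⟨w, wakeBefore_of_lt A h1 (by omega), by omega,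
        pending_antitone A ω (by omega) h3⟩
    have hIco : ∀ t ∈ Finset.Ico (w + 1) (w + 1 + 132 * n * B), t < T := by
      intro t ht
      rw [Finset.mem_Ico] at ht
      omega
    rcases many_good_slots A ω hB hR (w + 1) with h | h
    · left
      refine h.trans ?_
      refine card_le_slotCount fun t ht => ?_
      rw [Finset.mem_filter] at ht
      exact ⟨hIco t ht.1, hact t ht.1, ht.2⟩
    · right
      refine ⟨h.trans ?_, ?_⟩
      · refine card_le_slotCount fun t ht => ?_
        rw [Finset.mem_filter] at ht
        exact ⟨hIco t ht.1, hact t ht.1, ht.2⟩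
      · rintro t ht ⟨w', hw', hle, _⟩ hs
        have h4 := wakeBefore_mono A ht.le hw'
        rw [h1] at h4
        cases h4
        exact (pending_antitone A ω (show t + 1 ≤ w + L + 1 by omega) h3).2 hs
  refine (measureReal_mono hsub).trans ?_
  rw [measureReal_def, hFmono.measure_iUnion]
  refine ENNReal.toReal_le_of_le_ofReal hδ0 (iSup_le fun T => ?_)
  rw [← ofReal_measureReal]
  exact ENNReal.ofReal_le_ofReal (hFT T)

end Tail

theorem latency_le_of_measureReal {D : GlobalProtocol} {𝒜 : AdversaryClass} {n L : ℕ} {q : ℝ}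
    (h : ∀ A ∈ 𝒜 n, ∀ u : Fin n, (coinLaw D n).real {ω | ¬ LatencyAtMost A ω u L} ≤ q) :
    latency D 𝒜 n q ≤ L := by
  refine sInf_le ⟨L, rfl, fun A hA u => ?_⟩
  have h1 := h A hA u
  have h2 : (1 : ℝ) ≤ (coinLaw D n).real {ω | LatencyAtMost A ω u L} +
      (coinLaw D n).real {ω | ¬ LatencyAtMost A ω u L} := by
    refine le_trans ?_ (measureReal_union_le _ _)
    have : {ω | LatencyAtMost A ω u L} ∪ {ω | ¬ LatencyAtMost A ω u L} = Set.univ :=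
      Set.union_compl_self _
    rw [this, probReal_univ]
  linarith

/-! ### Asymptotics of the upper bound. -/

/-- A number `R` such that `2 ^ R` bounds the total grab probability of a party at the first
`132 n` ages. -/
def topLevel (n : ℕ) : ℕ := 3 * Nat.log 2 (Nat.log 2 n + 12) + 3

/-- A window of this length contains a slot of each level up to `topLevel n + 1`. -/
def blockLength (n : ℕ) : ℕ :=
  2 * (Nat.log 2 (topLevel n + 2) + 1) ^ 2 * (topLevel n + 2)

theorem one_le_levelPeriod (r : ℕ) : 1 ≤ levelPeriod r := Nat.one_le_two_pow

theorem levelPeriod_le_blockLength (n : ℕ) :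
    ∀ r ≤ topLevel n + 1, levelPeriod r ≤ blockLength n := fun _ hr => levelPeriod_le hr

theorem sum_baseProb_le_topLevel (n : ℕ) :
    ∑ i ∈ Finset.range (132 * n), baseProb (1 + i) ≤ 2 ^ topLevel n := by
  set l := Nat.log 2 n with hl
  have h1 : n < 2 ^ (l + 1) := Nat.lt_pow_succ_log_self one_lt_two n
  have h2 : 132 * n ≤ 2 ^ (l + 9) - 1 := by
    have : 2 ^ (l + 9) = 256 * 2 ^ (l + 1) := by ring
    omega
  have h3 : l + 12 < 2 ^ (Nat.log 2 (l + 12) + 1) := Nat.lt_pow_succ_log_self one_lt_two _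
  calc ∑ i ∈ Finset.range (132 * n), baseProb (1 + i)
      ≤ ∑ i ∈ Finset.range (2 ^ (l + 9) - 1), baseProb (1 + i) :=
        Finset.sum_le_sum_of_subset_of_nonneg (Finset.range_mono h2)
          fun i _ _ => (baseProb_pos _).le
    _ ≤ (((l + 9 : ℕ) : ℝ) + 3) ^ 3 := sum_baseProb_le (l + 9)
    _ = ((l + 12 : ℕ) : ℝ) ^ 3 := by push_cast; ring
    _ ≤ ((2 ^ (Nat.log 2 (l + 12) + 1) : ℕ) : ℝ) ^ 3 := by gcongr
    _ = 2 ^ topLevel n := by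
      rw [topLevel, ← hl]; push_cast; rw [← pow_mul]; congr 1; ring

theorem tendsto_log_natCast : Tendsto (fun n : ℕ => Real.log n) atTop atTop :=
  Real.tendsto_log_atTop.comp tendsto_natCast_atTop_atTop

theorem tendsto_log_log_natCast : Tendsto (fun n : ℕ => Real.log (Real.log n)) atTop atTop :=
  Real.tendsto_log_atTop.comp tendsto_log_natCast

theorem tendsto_log_log_log_natCast :
    Tendsto (fun n : ℕ => Real.log (Real.log (Real.log n))) atTop atTop :=
  Real.tendsto_log_atTop.comp tendsto_log_log_natCast

theorem natLog_two_le {m : ℕ} {x : ℝ} (hm : 0 < m) (h : (m : ℝ) ≤ x) :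
    (Nat.log 2 m : ℝ) ≤ 3 / 2 * Real.log x := by
  have h1 := Real.natLog_le_logb m 2
  have h2 : Real.log m ≤ Real.log x := Real.log_le_log (by exact_mod_cast hm) h
  have h3 : 0 ≤ Real.log m := Real.log_natCast_nonneg m
  -- The factor `3 / 2` is an upper bound for `1 / log 2`.
  have h4 := Real.log_two_gt_d9
  rw [Real.logb, Nat.cast_ofNat] at h1
  refine h1.trans ?_
  rw [div_le_iff₀ (by linarith)]
  nlinarith

theorem eventually_blockLength_le : ∀ᶠ n : ℕ in atTop, (blockLength n : ℝ) ≤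
    300 * (Real.log (Real.log n) * Real.log (Real.log (Real.log n)) ^ 2) := by
  filter_upwards [tendsto_log_natCast.eventually_ge_atTop 20,
    tendsto_log_log_natCast.eventually_ge_atTop 20,
    tendsto_log_log_log_natCast.eventually_ge_atTop 20, eventually_gt_atTop 0] with n hx hy hz hn
  set x := Real.log n with hxdef
  set y := Real.log x with hydef
  set z := Real.log y with hzdef
  have hl : (Nat.log 2 n : ℝ) ≤ 3 / 2 * x := natLog_two_le hn le_rfl
  have h1 : ((Nat.log 2 n + 12 : ℕ) : ℝ) ≤ x ^ 2 := by push_cast; nlinarith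
  have h2 : (Nat.log 2 (Nat.log 2 n + 12) : ℝ) ≤ 3 * y := by
    have := natLog_two_le (Nat.succ_pos _) h1
    rw [Real.log_pow] at this
    push_cast at this
    linarith
  have h3 : ((topLevel n + 2 : ℕ) : ℝ) ≤ 10 * y := by
    rw [topLevel]; push_cast; linarith
  have h4 : (Nat.log 2 (topLevel n + 2) : ℝ) + 1 ≤ 3 * z := by
    have h6 : ((topLevel n + 2 : ℕ) : ℝ) ≤ y * Real.exp 4 := by
      refine h3.trans ?_
      have h7 : Real.exp 4 = Real.exp 2 * Real.exp 2 := by rw [← Real.exp_add]; norm_num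
      have h9 : Real.exp 2 = Real.exp 1 * Real.exp 1 := by rw [← Real.exp_add]; norm_num
      have h10 := Real.exp_one_gt_d9
      have h11 : (7 : ℝ) ≤ Real.exp 2 := by nlinarith
      have h12 : (10 : ℝ) ≤ Real.exp 4 := by nlinarith
      rw [mul_comm]
      exact mul_le_mul_of_nonneg_left h12 (by linarith)
    have := natLog_two_le (Nat.succ_pos _) h6
    rw [Real.log_mul (by linarith) (Real.exp_pos _).ne', Real.log_exp] at this
    linarith
  have h5 : (blockLength n : ℝ) = 2 * ((Nat.log 2 (topLevel n + 2) : ℝ) + 1) ^ 2 *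
      ((topLevel n + 2 : ℕ) : ℝ) := by
    rw [blockLength, Nat.cast_mul, Nat.cast_mul, Nat.cast_pow, Nat.cast_add, Nat.cast_one,
      Nat.cast_ofNat]
  rw [h5]
  generalize Nat.log 2 (topLevel n + 2) = a at h4
  generalize topLevel n + 2 = b at h3
  calc 2 * ((a : ℝ) + 1) ^ 2 * b ≤ 2 * (3 * z) ^ 2 * (10 * y) := by gcongr
    _ ≤ _ := by nlinarith [mul_nonneg (show 0 ≤ y by linarith) (sq_nonneg z)]

/-- The block length is polynomial in `log log n`, hence `o(log n)`. This slack makes the quiet-slot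
bound smaller than every power of `n`. -/
theorem eventually_mul_blockLength_le (C : ℝ) :
    ∀ᶠ n : ℕ in atTop, C * blockLength n ≤ Nat.log 2 n := by
  have h1 : ∀ᶠ x : ℝ in atTop, |C| * 300 * Real.log x ^ 3 ≤ 1 / 2 * x := by
    have := (Real.isLittleO_pow_log_id_atTop (n := 3)).def
      (show (0 : ℝ) < 1 / (2 * (|C| * 300 + 1)) by positivity)
    filter_upwards [this, eventually_gt_atTop 1] with x hx hx1
    have hlog : 0 ≤ Real.log x := Real.log_nonneg hx1.le
    rw [id, Real.norm_of_nonneg (by positivity), Real.norm_of_nonneg (by linarith)] at hx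
    rw [div_mul_eq_mul_div, one_mul, le_div_iff₀ (by positivity)] at hx
    nlinarith [pow_nonneg hlog 3]
  filter_upwards [eventually_blockLength_le, tendsto_log_natCast.eventually h1,
    tendsto_log_log_natCast.eventually_ge_atTop 20,
    tendsto_log_log_log_natCast.eventually_ge_atTop 20,
    tendsto_log_natCast.eventually_ge_atTop 20, eventually_gt_atTop 0] with n hb h hy hz hx hn
  set x := Real.log n with hxdef
  set y := Real.log x with hydef
  set z := Real.log y with hzdef
  have hzy : z ≤ y := Real.log_le_self (by linarith)
  have h2 : y * z ^ 2 ≤ y ^ 3 := by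
    have : z ^ 2 ≤ y ^ 2 := by gcongr
    nlinarith
  have h3 : x ≤ (Nat.log 2 n : ℝ) + 1 := by
    have h4 : (n : ℝ) ≤ 2 ^ (Nat.log 2 n + 1) := by
      exact_mod_cast (Nat.lt_pow_succ_log_self one_lt_two n).le
    have h5 := Real.log_le_log (by exact_mod_cast hn) h4
    rw [Real.log_pow] at h5
    have h6 := Real.log_two_lt_d9
    push_cast at h5
    have h7 : (0 : ℝ) ≤ (Nat.log 2 n : ℝ) + 1 := by positivity
    nlinarith
  calc C * blockLength n ≤ |C| * (300 * (y * z ^ 2)) :=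
        mul_le_mul (le_abs_self C) hb (by positivity) (abs_nonneg C)
    _ ≤ |C| * (300 * y ^ 3) := by gcongr
    _ = |C| * 300 * y ^ 3 := by ring
    _ ≤ 1 / 2 * x := h
    _ ≤ _ := by linarith

theorem eventually_half_pow_le (k : ℝ) :
    ∀ᶠ n : ℕ in atTop, (1 / 2 : ℝ) ^ n ≤ (n : ℝ) ^ (-k) / 2 := by
  have h1 := (isLittleO_rpow_exp_pos_mul_atTop k (Real.log_pos one_lt_two)).def
    (show (0 : ℝ) < 1 / 2 by norm_num)
  filter_upwards [tendsto_natCast_atTop_atTop.eventually h1, eventually_gt_atTop 0] with n h hn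
  have hn' : (0 : ℝ) < n := by exact_mod_cast hn
  rw [Real.norm_of_nonneg (by positivity), Real.norm_of_nonneg (by positivity), mul_comm (Real.log 2),
    Real.exp_mul, mul_comm] at h
  have h2 : Real.exp n ^ Real.log 2 = 2 ^ n := by
    rw [← Real.exp_mul, mul_comm, Real.exp_mul, Real.exp_log two_pos, Real.rpow_natCast]
  rw [h2] at h
  rw [Real.rpow_neg hn'.le, one_div, inv_pow, ← one_div, ← one_div, div_div,
    div_le_div_iff₀ (by positivity) (by positivity)]
  linarith

theorem eventually_tail_le (k : ℝ) : ∀ᶠ n : ℕ in atTop,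
    (1 / 2 : ℝ) ^ n + (1 - baseProb (132 * n * blockLength n) / 4) ^ (64 * n) ≤
      (n : ℝ) ^ (-k) := by
  filter_upwards [eventually_half_pow_le k, eventually_mul_blockLength_le (300 * (|k| + 1)),
    eventually_ge_atTop 2] with n h1 h2 hn
  have hn' : (2 : ℝ) ≤ n := by exact_mod_cast hn
  have hBpos : 1 ≤ blockLength n :=
    (one_le_levelPeriod 0).trans (levelPeriod_le_blockLength n 0 (Nat.zero_le _))
  set B := blockLength n
  clear_value B
  set l := Nat.log 2 n with hl
  have hB' : (1 : ℝ) ≤ B := by exact_mod_cast hBpos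
  set L := 132 * n * B with hL
  have hLn : n ≤ L := by
    rw [hL]; nlinarith
  have hb : (l : ℝ) ^ 2 / (18 * L) ≤ baseProb L := by
    have e1 : 2 ^ Nat.log 2 L ≤ L := Nat.pow_log_le_self 2 (by omega)
    have e2 : l ≤ Nat.log 2 L := Nat.log_mono_right hLn
    have e1' : (2 : ℝ) ^ Nat.log 2 L ≤ L := by exact_mod_cast e1
    have e2' : (l : ℝ) ≤ Nat.log 2 L := by exact_mod_cast e2
    rw [baseProb]
    gcongr
    linarith
  have hb2 := baseProb_le_half L
  have hlog : Real.log n ≤ 2 * l := by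
    have h4 : (n : ℝ) ≤ 2 ^ (l + 1) := by
      exact_mod_cast (Nat.lt_pow_succ_log_self one_lt_two n).le
    have h5 := Real.log_le_log (by linarith) h4
    rw [Real.log_pow] at h5
    have h6 := Real.log_two_lt_d9
    push_cast at h5
    have h7 : (1 : ℝ) ≤ l := by
      exact_mod_cast Nat.log_pos one_lt_two hn
    nlinarith
  -- With `baseProb L` at least `l ^ 2 / (18 * L)` and `L = 132 * n * B`, the right side is at least
  -- a constant times `l ^ 2 / B`, and `B` is small compared with `l`. The extra `1` next to `k`
  -- yields the factor `1 / n`, used as `1 / 2`.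
  have hexp : (k + 1) * Real.log n ≤ 64 * n * (baseProb L / 4) := by
    have e1 : 64 * n * ((l : ℝ) ^ 2 / (18 * L) / 4) ≤ 64 * n * (baseProb L / 4) := by gcongr
    refine le_trans ?_ e1
    have e2 : 64 * n * ((l : ℝ) ^ 2 / (18 * L) / 4) = 16 * (l : ℝ) ^ 2 / (18 * 132 * B) := by
      rw [hL]; push_cast; field_simp; ring
    rw [e2, le_div_iff₀ (by positivity)]
    have e3 : (k + 1) * Real.log n ≤ (|k| + 1) * (2 * l) :=
      mul_le_mul (by linarith [le_abs_self k]) hlog (Real.log_natCast_nonneg n) (by positivity)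
    have e4 : (k + 1) * Real.log n * (18 * 132 * B) ≤ (|k| + 1) * (2 * l) * (18 * 132 * B) := by
      gcongr
    have e5 : 300 * (|k| + 1) * B * l ≤ l * l := by gcongr
    nlinarith
  have h3 : (1 - baseProb L / 4) ^ (64 * n) ≤ (n : ℝ) ^ (-k) / 2 := by
    have e1 : 1 - baseProb L / 4 ≤ Real.exp (-(baseProb L / 4)) := by
      have := Real.add_one_le_exp (-(baseProb L / 4)); linarith
    calc (1 - baseProb L / 4) ^ (64 * n) ≤ Real.exp (-(baseProb L / 4)) ^ (64 * n) :=
          pow_le_pow_left₀ (by linarith) e1 _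
      _ = Real.exp (-(64 * n * (baseProb L / 4))) := by
          rw [← Real.exp_nat_mul]; push_cast; ring_nf
      _ ≤ Real.exp (-((k + 1) * Real.log n)) := by gcongr
      _ = (n : ℝ) ^ (-k) / n := by
          rw [Real.rpow_def_of_pos (by linarith), eq_div_iff (by linarith)]
          nth_rewrite 2 [← Real.exp_log (show (0 : ℝ) < n by linarith)]
          rw [← Real.exp_add]
          ring_nf
      _ ≤ (n : ℝ) ^ (-k) / 2 := by gcongr
  linarith

theorem whpLatency_levelProtocol_le (k : ℝ) : ∀ᶠ n : ℕ in atTop,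
    whpLatency levelProtocol adaptive k n ≤ ((132 * n * blockLength n : ℕ) : ℕ∞) := by
  filter_upwards [eventually_tail_le k] with n h
  exact latency_le_of_measureReal fun A _ u => (measure_not_latencyAtMost_le A u
    (levelPeriod_le_blockLength n) (sum_baseProb_le_topLevel n)).trans h

theorem isNearLinear_levelProtocol (k : ℝ) :
    IsNearLinear (whpLatency levelProtocol adaptive k) := by
  -- `39600 = 132 * 300`. The exponent correction is chosen so that `y ^ (1 + ε) = C * y * z ^ 2`
  -- with `y = log log n` and `z = log y`.
  set C : ℝ := 39600 with hC
  refine ⟨fun n => (Real.log C + 2 * Real.log (Real.log (Real.log (Real.log n)))) /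
    Real.log (Real.log (Real.log n)), ?_, ?_⟩
  · have h : Tendsto (fun z : ℝ => (Real.log C + 2 * Real.log z) / z) atTop (𝓝 0) := by
      have h1 : Tendsto (fun z : ℝ => Real.log C / z) atTop (𝓝 0) :=
        tendsto_const_nhds.div_atTop tendsto_id
      have h2 := Real.isLittleO_log_id_atTop.tendsto_div_nhds_zero
      have h3 := h1.add (h2.const_mul 2)
      rw [mul_zero, add_zero] at h3
      refine h3.congr fun z => ?_
      simp only [id]; ring
    exact h.comp tendsto_log_log_log_natCast
  · filter_upwards [whpLatency_levelProtocol_le k, eventually_blockLength_le,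
      tendsto_log_log_natCast.eventually_ge_atTop 20,
      tendsto_log_log_log_natCast.eventually_ge_atTop 20] with n h hb hy hz
    have h1 : ((whpLatency levelProtocol adaptive k n : ℕ∞) : ℝ≥0∞) ≤
        (((132 * n * blockLength n : ℕ) : ℕ∞) : ℝ≥0∞) := ENat.toENNReal_le.2 h
    refine h1.trans ?_
    rw [ENat.toENNReal_coe, ← ENNReal.ofReal_natCast]
    refine ENNReal.ofReal_le_ofReal ?_
    set y := Real.log (Real.log n) with hydef
    set z := Real.log y with hzdef
    have hz0 : z ≠ 0 := by linarith
    have e : y ^ (1 + (Real.log C + 2 * Real.log z) / z) = C * (y * z ^ 2) := by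
      rw [Real.rpow_def_of_pos (by linarith), ← hzdef, mul_add, mul_one, mul_div_cancel₀ _ hz0,
        Real.exp_add, Real.exp_add, hzdef, Real.exp_log (by linarith), ← hzdef,
        Real.exp_log (by norm_num), mul_comm 2, Real.exp_mul, Real.exp_log (by linarith)]
      norm_cast
      ring
    rw [e]
    push_cast
    have hn : (0 : ℝ) ≤ n := Nat.cast_nonneg n
    nlinarith [mul_le_mul_of_nonneg_left hb hn]

/-! ### Oblivious adversaries and failure certificates. -/

theorem wakeBefore_obliviousAdversary {n : ℕ} (τ : Fin n → ℕ) (ω : Coins n) (t : ℕ) (u : Fin n) :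
    wakeBefore (obliviousAdversary τ) ω t u = if τ u < t then some (τ u) else none := by
  induction t with
  | zero => simp [wakeBefore]
  | succ t ih =>
    simp only [wakeBefore, ih]
    by_cases h : τ u < t
    · simp [h, h.trans (Nat.lt_succ_self t)]
    · by_cases h' : τ u = t
      · simp [obliviousAdversary, h']
      · have : ¬ τ u < t + 1 := by omega
        simp [obliviousAdversary, h, h', this]

theorem wants_obliviousAdversary_iff {n : ℕ} {τ : Fin n → ℕ} {ω : Coins n} {t : ℕ} {u : Fin n} :
    Wants (obliviousAdversary τ) ω u t ↔ τ u < t ∧ ω u (τ u) (t - τ u) = true := by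
  simp only [Wants, wakeBefore_obliviousAdversary]
  constructor
  · rintro ⟨w, hw, h⟩
    split_ifs at hw with hlt
    cases hw
    exact ⟨hlt, h⟩
  · rintro ⟨h1, h2⟩
    exact ⟨τ u, by simp [h1], h2⟩

section Raw

variable {ι : Type*}

/-- With wake-up times `τ` and attempt sequences `X`, party `i` makes an attempt at time `t` if it
has not succeeded before. -/
def RawAttempt (τ : ι → ℕ) (X : ι → AttemptSeq) (i : ι) (t : ℕ) : Prop :=
  τ i < t ∧ X i (t - τ i) = true

/-- No slot up to time `T` has exactly one raw attempt. -/
def FullyJammed (τ : ι → ℕ) (X : ι → AttemptSeq) (T : ℕ) : Prop :=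
  ∀ t ≤ T, ∀ i, RawAttempt τ X i t → ∃ j, j ≠ i ∧ RawAttempt τ X j t

/-- Each raw attempt of `u` up to time `T` collides with the first attempt of another party. -/
def BlockedByFresh (τ : ι → ℕ) (X : ι → AttemptSeq) (u : ι) (T : ℕ) : Prop :=
  ∀ t ≤ T, RawAttempt τ X u t →
    ∃ j, j ≠ u ∧ RawAttempt τ X j t ∧ ∀ s < t, ¬ RawAttempt τ X j s

variable {n : ℕ} {τ' : Fin n → ℕ} {ω : Coins n} {T : ℕ} {τ : ι → ℕ} {e : ι → Fin n}

/-- By strong induction nobody has succeeded before `t`, so raw attempts coincide with grabs and the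
jam persists. -/
theorem not_succeeds_of_fullyJammed (he : Function.Injective e) (hτ : ∀ i, τ' (e i) = τ i)
    (hlate : ∀ v, v ∉ Set.range e → T ≤ τ' v)
    (h : FullyJammed τ (fun i => ω (e i) (τ i)) T) :
    ∀ t ≤ T, ∀ v, ¬ Succeeds (obliviousAdversary τ') ω v t := by
  intro t
  induction t using Nat.strong_induction_on with
  | _ t ih =>
    intro htT v hv
    have hpend : ∀ v, v ∈ pending (obliviousAdversary τ') ω t := fun v =>
      mem_pending_of_no_success _ (Nat.zero_le t) (Set.mem_univ v) fun i _ hi =>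
        ih i hi (hi.le.trans htT) v
    have hw := wants_obliviousAdversary_iff.1 (Succeeds.mem _ hv).2
    by_cases hr : v ∈ Set.range e
    · obtain ⟨i, rfl⟩ := hr
      rw [hτ] at hw
      obtain ⟨j, hj, h1, h2⟩ := h t htT i hw
      have hmem : e j ∈ ({v | v ∈ pending (obliviousAdversary τ') ω t ∧
          Wants (obliviousAdversary τ') ω v t} : Set (Fin n)) :=
        ⟨hpend _, wants_obliviousAdversary_iff.2 (by rw [hτ]; exact ⟨h1, h2⟩)⟩
      rw [show _ = _ from hv] at hmem
      exact hj (he hmem)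
    · have := hlate v hr
      omega

/-- A party at its first attempt cannot have succeeded yet, so it surely grabs. The other parties'
history is irrelevant, and others may succeed meanwhile. -/
theorem not_succeeds_of_blockedByFresh (he : Function.Injective e) (hτ : ∀ i, τ' (e i) = τ i)
    {u : ι} (h : BlockedByFresh τ (fun i => ω (e i) (τ i)) u T) :
    ∀ t ≤ T, ¬ Succeeds (obliviousAdversary τ') ω (e u) t := by
  intro t htT hu
  have hw := wants_obliviousAdversary_iff.1 (Succeeds.mem _ hu).2
  rw [hτ] at hw
  obtain ⟨j, hj, ⟨h1, h2⟩, h3⟩ := h t htT hw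
  have hmem : e j ∈ ({v | v ∈ pending (obliviousAdversary τ') ω t ∧
      Wants (obliviousAdversary τ') ω v t} : Set (Fin n)) := by
    refine ⟨mem_pending_of_no_success _ (Nat.zero_le t) (Set.mem_univ _) fun i _ hi hs => ?_,
      wants_obliviousAdversary_iff.2 (by rw [hτ]; exact ⟨h1, h2⟩)⟩
    have := wants_obliviousAdversary_iff.1 (Succeeds.mem _ hs).2
    rw [hτ] at this
    exact h3 i hi this
  rw [show _ = _ from hu] at hmem
  exact hj (he hmem)

end Raw

/-- This is where the lack of a global clock enters: the law of the sequences actually used does not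
depend on the wake-up times. -/
theorem map_coinLaw_toGlobal (D : LocalProtocol) {n : ℕ} {ι : Type*} [Fintype ι] {e : ι → Fin n}
    (he : Function.Injective e) (τ : ι → ℕ) :
    (coinLaw D.toGlobal n).map (fun ω i => ω (e i) (τ i)) =
      Measure.pi fun _ : ι => (D : Measure AttemptSeq) := by
  classical
  symm
  refine Measure.pi_eq fun s hs => ?_
  rw [Measure.map_apply (by fun_prop) (MeasurableSet.univ_pi hs)]
  have hset : (fun (ω : Coins n) i => ω (e i) (τ i)) ⁻¹' Set.univ.pi s = Set.univ.pi fun v =>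
      {y : ℕ → AttemptSeq | ∀ i, e i = v → y (τ i) ∈ s i} := by
    ext ω
    simp only [Set.mem_preimage, Set.mem_pi, Set.mem_univ, true_imp_iff, Set.mem_ofPred_eq]
    exact ⟨fun h v i hi => hi ▸ h i, fun h i => h (e i) i rfl⟩
  rw [hset, coinLaw, Measure.pi_pi, ← Finset.prod_subset (Finset.subset_univ (Finset.univ.image e)),
    Finset.prod_image fun i _ j _ h => he h]
  · refine Finset.prod_congr rfl fun i _ => ?_
    have : {y : ℕ → AttemptSeq | ∀ i', e i' = e i → y (τ i') ∈ s i'} =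
        (fun y => y (τ i)) ⁻¹' s i := by
      ext y
      simp only [Set.mem_ofPred_eq, Set.mem_preimage]
      exact ⟨fun h => h i rfl, fun h i' hi' => by rw [he hi']; exact h⟩
    have hev : Measurable fun y : ℕ → AttemptSeq => y (τ i) := by fun_prop
    have hmap := Measure.infinitePi_map_eval (fun w => (D.toGlobal w : Measure AttemptSeq)) (τ i)
    rw [this, ← Measure.map_apply hev (hs i)]
    exact congrArg (fun ν : Measure AttemptSeq => ν (s i)) hmap
  · intro v _ hv
    have : {y : ℕ → AttemptSeq | ∀ i, e i = v → y (τ i) ∈ s i} = Set.univ := by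
      ext y
      simp only [Set.mem_ofPred_eq, Set.mem_univ, iff_true]
      intro i hi
      exact absurd (Finset.mem_image.2 ⟨i, Finset.mem_univ i, hi⟩) hv
    rw [this, measure_univ]

theorem le_latency_of_fail {D : GlobalProtocol} {𝒜 : AdversaryClass} {n L : ℕ} {q : ℝ}
    {A : Adversary n} (hA : A ∈ 𝒜 n) (u : Fin n) {F : Set (Coins n)} (hF : MeasurableSet F)
    (hq : q < (coinLaw D n).real F) (hfail : ∀ ω ∈ F, ¬ LatencyAtMost A ω u L) :
    (L : ℕ∞) ≤ latency D 𝒜 n q := by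
  refine le_sInf ?_
  rintro _ ⟨L', rfl, h⟩
  by_contra hlt
  have hL : L' < L := by exact_mod_cast not_le.1 hlt
  have h1 := h A hA u
  have h2 : {ω | LatencyAtMost A ω u L'} ⊆ Fᶜ := by
    intro ω hω hF
    refine hfail ω hF fun w hw => ?_
    obtain ⟨d, hd, hs⟩ := hω w hw
    exact ⟨d, hd.trans hL.le, hs⟩
  have h3 := measureReal_mono (μ := coinLaw D n) h2
  rw [probReal_compl_eq_one_sub hF] at h3
  linarith

/-- A lower bound on the latency from a set of attempt sequences, for at most `n` parties, on which
party `u` fails. -/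
theorem le_latency_of_pi {D : LocalProtocol} {ι : Type*} [Fintype ι] {n : ℕ}
    (hcard : Fintype.card ι ≤ n) (τ : ι → ℕ) (u : ι) (L : ℕ) {q : ℝ} {F : Set (ι → AttemptSeq)}
    (hF : MeasurableSet F)
    (hq : q < (Measure.pi fun _ : ι => (D : Measure AttemptSeq)).real F)
    (hfail : ∀ X ∈ F, FullyJammed τ X (τ u + L) ∨ BlockedByFresh τ X u (τ u + L)) :
    (L : ℕ∞) ≤ latency D.toGlobal oblivious n q := by
  classical
  obtain ⟨e⟩ : Nonempty (ι ↪ Fin n) :=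
    Function.Embedding.nonempty_of_card_le (by rwa [Fintype.card_fin])
  -- Surplus parties are woken up too late to attempt by the deadline.
  set τ' : Fin n → ℕ := Function.extend e τ fun _ => τ u + L with hτ'
  have hτ : ∀ i, τ' (e i) = τ i := fun i => e.injective.extend_apply _ _ i
  have hlate : ∀ v, v ∉ Set.range e → τ u + L ≤ τ' v := fun v hv => by
    rw [hτ', Function.extend_apply' _ _ _ hv]
  have hmeas : Measurable fun (ω : Coins n) i => ω (e i) (τ i) := by fun_prop
  refine le_latency_of_fail (A := obliviousAdversary τ') ⟨τ', rfl⟩ (e u) (hmeas hF)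
    (F := (fun (ω : Coins n) i => ω (e i) (τ i)) ⁻¹' F) ?_ ?_
  · rwa [measureReal_def, ← Measure.map_apply hmeas hF, map_coinLaw_toGlobal D e.injective τ,
      ← measureReal_def]
  · intro ω hω hlat
    obtain ⟨d, hd, hs⟩ := hlat (τ u) ⟨τ u + 1, by
      rw [wakeBefore_obliviousAdversary, hτ, if_pos (Nat.lt_succ_self _)]⟩
    rcases hfail _ hω with h | h
    · exact not_succeeds_of_fullyJammed e.injective hτ hlate h _ (by omega) _ hs
    · exact not_succeeds_of_blockedByFresh e.injective hτ h _ (by omega) hs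

/-! ### Marginals of a LocalClock protocol. -/

/-- The probability that the bit at local time `i` is a one. -/
noncomputable def oneProb (D : LocalProtocol) (i : ℕ) : ℝ :=
  (D : Measure AttemptSeq).real {x | x i = true}

theorem oneProb_nonneg (D : LocalProtocol) (i : ℕ) : 0 ≤ oneProb D i := measureReal_nonneg

theorem oneProb_le_one (D : LocalProtocol) (i : ℕ) : oneProb D i ≤ 1 := measureReal_le_one

theorem measurableSet_bit (i : ℕ) (b : Bool) : MeasurableSet {x : AttemptSeq | x i = b} := by
  have h : Measurable fun x : AttemptSeq => x i := by fun_prop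
  exact h (measurableSet_singleton b)

theorem measureReal_zero_bit (D : LocalProtocol) (i : ℕ) :
    (D : Measure AttemptSeq).real {x | x i = false} = 1 - oneProb D i := by
  rw [oneProb, ← probReal_compl_eq_one_sub (measurableSet_bit i true)]
  congr 1
  ext x
  simp

/-- The bits at the local times `1 ≤ i < a` are zero. -/
def silentBefore (a : ℕ) : Set AttemptSeq := {x | ∀ i, 1 ≤ i → i < a → x i = false}

theorem measurableSet_silentBefore (a : ℕ) : MeasurableSet (silentBefore a) := by
  have : silentBefore a = ⋂ i, ⋂ (_ : 1 ≤ i), ⋂ (_ : i < a), {x : AttemptSeq | x i = false} := by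
    ext x; simp [silentBefore]
  rw [this]
  exact MeasurableSet.iInter fun i => MeasurableSet.iInter fun _ => MeasurableSet.iInter fun _ =>
    measurableSet_bit i false

theorem ae_mem_silentBefore {D : LocalProtocol} {a : ℕ}
    (h : ∀ i, 1 ≤ i → i < a → oneProb D i = 0) :
    ∀ᵐ x ∂(D : Measure AttemptSeq), x ∈ silentBefore a := by
  simp only [silentBefore, Set.mem_ofPred_eq, ae_all_iff]
  intro i h1 h2
  have := h i h1 h2
  rw [oneProb, measureReal_eq_zero_iff] at this
  rw [ae_iff]
  convert this using 2
  ext x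
  simp

theorem measureReal_inter_silentBefore {D : LocalProtocol} {a : ℕ}
    (h : ∀ i, 1 ≤ i → i < a → oneProb D i = 0) (S : Set AttemptSeq) :
    (D : Measure AttemptSeq).real (S ∩ silentBefore a) = (D : Measure AttemptSeq).real S := by
  refine measureReal_congr ?_
  filter_upwards [ae_mem_silentBefore h] with x hx
  exact propext ⟨fun h => h.1, fun h => ⟨h, hx⟩⟩

theorem pi_measureReal_box (D : LocalProtocol) {ι : Type*} [Fintype ι] (S : ι → Set AttemptSeq) :
    (Measure.pi fun _ : ι => (D : Measure AttemptSeq)).real {X | ∀ i, X i ∈ S i} =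
      ∏ i, (D : Measure AttemptSeq).real (S i) := by
  have : {X : ι → AttemptSeq | ∀ i, X i ∈ S i} = Set.univ.pi S := by ext; simp
  rw [measureReal_def, this, Measure.pi_pi, ENNReal.toReal_prod]
  rfl

theorem pi_measureReal_box_comp (D : LocalProtocol) {ι κ : Type*} [Fintype ι] [Fintype κ]
    {f : κ → ι} (hf : Function.Injective f) (S : κ → Set AttemptSeq) :
    (Measure.pi fun _ : ι => (D : Measure AttemptSeq)).real {X | ∀ r, X (f r) ∈ S r} =
      ∏ r, (D : Measure AttemptSeq).real (S r) := by
  classical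
  have hset : {X : ι → AttemptSeq | ∀ r, X (f r) ∈ S r} =
      {X | ∀ i, X i ∈ {x | ∀ r, f r = i → x ∈ S r}} := by
    ext X
    exact ⟨fun h i r hr => hr ▸ h r, fun h r => h (f r) r rfl⟩
  rw [hset, pi_measureReal_box, ← Finset.prod_subset (Finset.subset_univ (Finset.univ.image f)),
    Finset.prod_image fun i _ j _ h => hf h]
  · refine Finset.prod_congr rfl fun r _ => ?_
    congr 1
    ext x
    exact ⟨fun h => h r rfl, fun h r' hr' => by rw [hf hr']; exact h⟩
  · intro i _ hi
    have : {x : AttemptSeq | ∀ r, f r = i → x ∈ S r} = Set.univ := by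
      ext x
      simp only [Set.mem_ofPred_eq, Set.mem_univ, iff_true]
      intro r hr
      exact absurd (Finset.mem_image.2 ⟨r, Finset.mem_univ r, hr⟩) hi
    rw [this, probReal_univ]

/-! ### Jamming with uniform wake-up times. -/

/-- The probability that a party woken up at time `w + 1` makes an attempt at time `t`. -/
noncomputable def attemptProb (D : LocalProtocol) (t w : ℕ) : ℝ :=
  if w + 1 < t then oneProb D (t - (w + 1)) else 0

theorem attemptProb_nonneg (D : LocalProtocol) (t w : ℕ) : 0 ≤ attemptProb D t w := by
  unfold attemptProb
  split_ifs
  · exact oneProb_nonneg D _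
  · exact le_rfl

theorem attemptProb_le_one (D : LocalProtocol) (t w : ℕ) : attemptProb D t w ≤ 1 := by
  unfold attemptProb
  split_ifs
  · exact oneProb_le_one D _
  · exact zero_le_one

theorem measureReal_no_attempt (D : LocalProtocol) (t w : ℕ) :
    (D : Measure AttemptSeq).real {x | ¬ (w + 1 < t ∧ x (t - (w + 1)) = true)} =
      1 - attemptProb D t w := by
  by_cases h : w + 1 < t
  · simp only [h, true_and, Bool.not_eq_true, attemptProb, if_true]
    exact measureReal_zero_bit D _
  · simp [h, attemptProb]

/-- Every age from `1` to `m` is the age at time `t` of some admissible wake-up time; this needs `m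
< t`, which is why the first `m` slots require dedicated groups. -/
theorem sum_oneProb_le_sum_attemptProb (D : LocalProtocol) {m t T : ℕ} (hm : m < t) (ht : t ≤ T) :
    ∑ i ∈ Finset.Icc 1 m, oneProb D i ≤ ∑ w : Fin T, attemptProb D t w := by
  rw [Fin.sum_univ_eq_sum_range (fun w => attemptProb D t w) T]
  calc ∑ i ∈ Finset.Icc 1 m, oneProb D i
      = ∑ i ∈ Finset.Icc 1 m, attemptProb D t (t - 1 - i) := by
        refine Finset.sum_congr rfl fun i hi => ?_
        rw [Finset.mem_Icc] at hi
        rw [attemptProb, if_pos (by omega)]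
        congr 1
        omega
    _ = ∑ w ∈ (Finset.Icc 1 m).image fun i => t - 1 - i, attemptProb D t w := by
        rw [Finset.sum_image]
        intro i hi j hj h
        simp only [Finset.coe_Icc, Set.mem_Icc] at hi hj h
        omega
    _ ≤ _ := by
        refine Finset.sum_le_sum_of_subset_of_nonneg ?_ fun w _ _ => attemptProb_nonneg D t w
        intro w hw
        obtain ⟨i, hi, rfl⟩ := Finset.mem_image.1 hw
        rw [Finset.mem_Icc] at hi
        rw [Finset.mem_range]
        omega

/-- The average, over uniform wake-up times of two groups of `h` parties, of the probability that
no party of group `s` makes an attempt at time `t`. -/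
theorem sum_prod_no_attempt_le (D : LocalProtocol) {m t T : ℕ} (hm : m < t) (ht : t ≤ T) (h : ℕ)
    (s : Bool) :
    ∑ o : Bool × Fin h → Fin T, ∏ r, (1 - attemptProb D t (o (s, r))) ≤
      Fintype.card (Bool × Fin h → Fin T) * (1 - (∑ i ∈ Finset.Icc 1 m, oneProb D i) / T) ^ h := by
  classical
  have hT : (0 : ℝ) < T := by exact_mod_cast (Nat.zero_lt_of_lt hm).trans_le ht
  set φ : Bool × Fin h → Fin T → ℝ := fun v w => if v.1 = s then 1 - attemptProb D t w else 1
    with hφ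
  have h1 : ∀ o : Bool × Fin h → Fin T, ∏ r, (1 - attemptProb D t (o (s, r))) =
      ∏ v, φ v (o v) := by
    intro o
    rw [Fintype.prod_prod_type, Fintype.prod_bool]
    cases s <;> simp [hφ]
  have h2 := Finset.prod_univ_sum (fun _ : Bool × Fin h => (Finset.univ : Finset (Fin T))) φ
  rw [Fintype.piFinset_univ] at h2
  simp only [h1]
  rw [← h2, Fintype.prod_prod_type, Fintype.prod_bool]
  set σ := ∑ w : Fin T, attemptProb D t w with hσ
  have hs : ∑ w : Fin T, (1 - attemptProb D t w) = T - σ := by simp [hσ]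
  have hle : (∏ r : Fin h, ∑ w : Fin T, φ (true, r) w) *
      (∏ r : Fin h, ∑ w : Fin T, φ (false, r) w) =
      (T : ℝ) ^ h * (T - σ) ^ h := by
    cases s <;> simp [hφ, hs, mul_comm]
  have hσT : σ ≤ T := by
    have := Finset.sum_le_sum fun (w : Fin T) (_ : w ∈ Finset.univ) => attemptProb_le_one D t w
    simpa using this
  have hSσ := sum_oneProb_le_sum_attemptProb D hm ht
  have hcard : (Fintype.card (Bool × Fin h → Fin T) : ℝ) = (T : ℝ) ^ h * (T : ℝ) ^ h := by
    simp only [Fintype.card_fun, Fintype.card_prod, Fintype.card_bool, Fintype.card_fin]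
    push_cast
    rw [← pow_add]; congr 1; ring
  refine hle.trans_le ?_
  have hfac : (1 - (∑ i ∈ Finset.Icc 1 m, oneProb D i) / T) ^ h * (T : ℝ) ^ h =
      (T - ∑ i ∈ Finset.Icc 1 m, oneProb D i) ^ h := by
    rw [← mul_pow, sub_mul, one_mul, div_mul_cancel₀ _ hT.ne']
  rw [hcard, mul_assoc, mul_comm ((T : ℝ) ^ h) ((1 - _) ^ h), hfac]
  exact mul_le_mul_of_nonneg_left (pow_le_pow_left₀ (by linarith) (by linarith) h) (by positivity)

/-- The parties used to jam: the victim, for each of the first `m` slots two groups of `g` parties,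
and a third kind of parties. -/
abbrev JamParty (m g : ℕ) (κ : Type) : Type := Unit ⊕ ((Fin m × Bool × Fin g) ⊕ κ)

/-- Wake-up times of the jamming parties: the groups of slot `b` are woken up at time `b + 1`, and
the victim at time `a`. -/
def jamWake {m g : ℕ} {κ : Type} (a : ℕ) (o : κ → ℕ) : JamParty m g κ → ℕ :=
  Sum.elim (fun _ => a) (Sum.elim (fun x => x.1 + 1) fun y => o y + 1)

/-- Two disjoint groups hit every slot after `a`, so whoever attempts meets another party. Up to
time `a` silence at ages below `a` excludes all attempts. -/
theorem fullyJammed_of_groups {m g h L a : ℕ} (ha : 1 ≤ a) {o : Bool × Fin h → ℕ}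
    {X : JamParty m g (Bool × Fin h) → AttemptSeq} (hX : ∀ i, X i ∈ silentBefore a)
    (h1 : ∀ b s, ∃ r, X (.inr (.inl (b, s, r))) a = true)
    (h2 : ∀ b < L, m ≤ b → ∀ s, ∃ r,
      RawAttempt (jamWake a o) X (.inr (.inr (s, r))) (a + (b + 1))) :
    FullyJammed (jamWake a o) X (a + L) := by
  intro t ht i hi
  have hat : a < t := by
    obtain ⟨h3, h4⟩ := hi
    rcases i with i | i
    · exact h3
    · have h5 : 1 ≤ jamWake a o (.inr i) := by
        rcases i with i | i <;> simp [jamWake]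
      by_contra hlt
      have := hX (.inr i) (t - jamWake a o (.inr i)) (by omega) (by omega)
      rw [this] at h4
      cases h4
  obtain ⟨b, rfl⟩ : ∃ b, t = a + (b + 1) := ⟨t - a - 1, by omega⟩
  have key : ∃ j : Bool → JamParty m g (Bool × Fin h), j true ≠ j false ∧
      ∀ s, RawAttempt (jamWake a o) X (j s) (a + (b + 1)) := by
    by_cases hb : b < m
    · choose r hr using h1 ⟨b, hb⟩
      refine ⟨fun s => .inr (.inl (⟨b, hb⟩, s, r s)), by simp, fun s => ?_⟩
      constructor
      · simp [jamWake]; omega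
      · have : a + (b + 1) - jamWake a o (.inr (.inl (⟨b, hb⟩, s, r s)) :
            JamParty m g (Bool × Fin h)) = a := by simp [jamWake]
        rw [this]
        exact hr s
    · choose r hr using h2 b (by omega) (by omega)
      exact ⟨fun s => .inr (.inr (s, r s)), by simp, hr⟩
  obtain ⟨j, hj, hr⟩ := key
  by_cases hji : j true = i
  · exact ⟨j false, fun hh => hj (hji.trans hh.symm), hr false⟩
  · exact ⟨j true, hji, hr true⟩

/-- A union bound over slots and over both groups. Dedicated groups serve the first `m` slots;
afterwards a uniformly woken party hits a given slot with probability at least the prefix sum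
divided by `T`. -/
theorem le_latency_of_uniform_jam (D : LocalProtocol) {a : ℕ} (ha : 1 ≤ a)
    (hsil : ∀ i, 1 ≤ i → i < a → oneProb D i = 0) {n m g h L T : ℕ}
    (hcard : 1 + (m * (2 * g) + 2 * h) ≤ n) (hmT : m ≤ T) (hT : a + L ≤ T) {q : ℝ}
    (hq : q < 1 - (m * (2 * (1 - oneProb D a) ^ g) +
      L * (2 * (1 - (∑ i ∈ Finset.Icc 1 m, oneProb D i) / T) ^ h))) :
    (L : ℕ∞) ≤ latency D.toGlobal oblivious n q := by
  classical
  set P := Measure.pi fun _ : JamParty m g (Bool × Fin h) => (D : Measure AttemptSeq) with hP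
  set S := ∑ i ∈ Finset.Icc 1 m, oneProb D i with hS
  set κ := Bool × Fin h → Fin T with hκ
  have hTpos : 0 < T := by omega
  have hT' : (0 : ℝ) < T := by exact_mod_cast hTpos
  set E1 : Fin m × Bool → Set (JamParty m g (Bool × Fin h) → AttemptSeq) := fun x =>
    {X | ∀ r, X (.inr (.inl (x.1, x.2, r))) ∈ {y : AttemptSeq | y a = false}} with hE1
  set E2 : κ → Fin L × Bool → Set (JamParty m g (Bool × Fin h) → AttemptSeq) := fun o x =>
    {X | ∀ r, X (.inr (.inr (x.2, r))) ∈ {y : AttemptSeq | ¬ ((o (x.2, r) : ℕ) + 1 < a + (x.1 + 1) ∧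
      y (a + (x.1 + 1) - ((o (x.2, r) : ℕ) + 1)) = true)}} with hE2
  set I := (Finset.univ : Finset (Fin L × Bool)).filter fun x => m ≤ x.1 with hI
  set Z : Set (JamParty m g (Bool × Fin h) → AttemptSeq) := {X | ∀ i, X i ∈ silentBefore a} with hZ
  set bad : κ → Set (JamParty m g (Bool × Fin h) → AttemptSeq) := fun o =>
    (⋃ x ∈ (Finset.univ : Finset (Fin m × Bool)), E1 x) ∪ ⋃ x ∈ I, E2 o x with hbad
  have hZm : MeasurableSet Z := by
    have : Z = Set.univ.pi fun _ => silentBefore a := by ext; simp [hZ]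
    rw [this]
    exact MeasurableSet.univ_pi fun _ => measurableSet_silentBefore a
  have hbitm : ∀ (j : JamParty m g (Bool × Fin h)) (i : ℕ) (b : Bool),
      MeasurableSet {X : JamParty m g (Bool × Fin h) → AttemptSeq | X j i = b} := by
    intro j i b
    have : Measurable fun X : JamParty m g (Bool × Fin h) → AttemptSeq => X j i := by fun_prop
    exact this (measurableSet_singleton b)
  have hbadm : ∀ o, MeasurableSet (bad o) := by
    intro o
    refine MeasurableSet.union ?_ ?_
    · refine Finset.measurableSet_biUnion _ fun x _ => ?_
      have : E1 x = ⋂ r, {X | X (.inr (.inl (x.1, x.2, r))) a = false} := by ext; simp [hE1]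
      rw [this]
      exact MeasurableSet.iInter fun r => hbitm _ _ _
    · refine Finset.measurableSet_biUnion _ fun x _ => ?_
      have : E2 o x = ⋂ r, {X | ¬ ((o (x.2, r) : ℕ) + 1 < a + (x.1 + 1) ∧
          X (.inr (.inr (x.2, r))) (a + (x.1 + 1) - ((o (x.2, r) : ℕ) + 1)) = true)} := by
        ext; simp [hE2]
      rw [this]
      refine MeasurableSet.iInter fun r => MeasurableSet.compl ?_
      exact (MeasurableSet.const _).inter (hbitm _ _ _)
  have hZ1 : P.real Z = 1 := by
    rw [hZ, hP, pi_measureReal_box]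
    refine Finset.prod_eq_one fun i _ => ?_
    have := measureReal_inter_silentBefore hsil Set.univ
    rwa [Set.univ_inter, probReal_univ] at this
  have hP1 : ∀ x, P.real (E1 x) = (1 - oneProb D a) ^ g := by
    intro x
    refine (pi_measureReal_box_comp D
      (f := fun r => (.inr (.inl (x.1, x.2, r)) : JamParty m g (Bool × Fin h)))
      (fun r r' h => by simpa using h) fun _ => {y : AttemptSeq | y a = false}).trans ?_
    rw [Finset.prod_const, measureReal_zero_bit, Finset.card_univ, Fintype.card_fin]
  have hP2 : ∀ o x, P.real (E2 o x) =
      ∏ r, (1 - attemptProb D (a + ((x.1 : ℕ) + 1)) (o (x.2, r))) := by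
    intro o x
    refine (pi_measureReal_box_comp D
      (f := fun r => (.inr (.inr (x.2, r)) : JamParty m g (Bool × Fin h)))
      (fun r r' h => by simpa using h) fun r => {y : AttemptSeq |
        ¬ ((o (x.2, r) : ℕ) + 1 < a + (x.1 + 1) ∧
      y (a + (x.1 + 1) - ((o (x.2, r) : ℕ) + 1)) = true)}).trans ?_
    exact Finset.prod_congr rfl fun r _ => measureReal_no_attempt D _ _
  have hSp : S ≤ T := by
    have h1 := Finset.sum_le_sum fun (i : ℕ) (_ : i ∈ Finset.Icc 1 m) => oneProb_le_one D i
    rw [Finset.sum_const, Nat.card_Icc, Nat.add_sub_cancel, nsmul_eq_mul, mul_one] at h1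
    exact h1.trans (by exact_mod_cast hmT)
  have hsum : ∑ o : κ, (m * (2 * (1 - oneProb D a) ^ g) + ∑ x ∈ I, P.real (E2 o x)) ≤
      ∑ _o : κ, (m * (2 * (1 - oneProb D a) ^ g) + L * (2 * (1 - S / T) ^ h)) := by
    rw [Finset.sum_add_distrib, Finset.sum_add_distrib]
    refine add_le_add le_rfl ?_
    rw [Finset.sum_comm, Finset.sum_const, Finset.card_univ, nsmul_eq_mul]
    have h1 : ∀ x ∈ I, ∑ o : κ, P.real (E2 o x) ≤ Fintype.card κ * (1 - S / T) ^ h := by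
      intro x hx
      simp only [hP2]
      have hmx : m ≤ x.1 := (Finset.mem_filter.1 hx).2
      have hxL := x.1.isLt
      exact sum_prod_no_attempt_le D (by omega) (by omega) h x.2
    refine (Finset.sum_le_sum h1).trans ?_
    rw [Finset.sum_const, nsmul_eq_mul]
    have hpow : 0 ≤ (1 - S / T) ^ h := pow_nonneg (by rw [sub_nonneg, div_le_one hT']; exact hSp) h
    have hIc : (I.card : ℝ) ≤ L * 2 := by
      have := Finset.card_filter_le (Finset.univ : Finset (Fin L × Bool)) fun x => m ≤ x.1
      rw [Finset.card_univ, Fintype.card_prod, Fintype.card_fin, Fintype.card_bool] at this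
      exact_mod_cast this
    calc (I.card : ℝ) * (Fintype.card κ * (1 - S / T) ^ h)
        ≤ L * 2 * (Fintype.card κ * (1 - S / T) ^ h) := by gcongr
      _ = _ := by ring
  have : Nonempty κ := ⟨fun _ => ⟨0, hTpos⟩⟩
  -- Derandomisation: some fixed choice of wake-up times is no worse than the average, which makes
  -- the adversary oblivious.
  obtain ⟨o, -, ho⟩ := Finset.exists_le_of_sum_le Finset.univ_nonempty hsum
  have hbadP : P.real (bad o) ≤ m * (2 * (1 - oneProb D a) ^ g) + L * (2 * (1 - S / T) ^ h) := by
    refine le_trans ?_ ho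
    refine (measureReal_union_le _ _).trans (add_le_add ?_ (measureReal_biUnion_finset_le _ _))
    refine (measureReal_biUnion_finset_le _ _).trans_eq ?_
    simp only [hP1]
    rw [Finset.sum_const, Finset.card_univ, Fintype.card_prod, Fintype.card_fin, Fintype.card_bool,
      nsmul_eq_mul]
    push_cast
    ring
  refine le_latency_of_pi (D := D) (F := Z \ bad o) (q := q) ?_ (jamWake a fun y => o y) (.inl ()) L
    (hZm.diff (hbadm o)) ?_ ?_
  · simp only [Fintype.card_sum, Fintype.card_prod, Fintype.card_bool, Fintype.card_fin,
      Fintype.card_unit]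
    linarith
  · have h1 : P.real Z ≤ P.real (Z \ bad o) + P.real (bad o) :=
      (measureReal_mono (by rw [Set.sdiff_union_self]; exact Set.subset_union_left)).trans
        (measureReal_union_le _ _)
    rw [← hP]
    linarith
  · rintro X ⟨hX, hnb⟩
    left
    simp only [hbad, Set.mem_union, Set.mem_iUnion, not_or, not_exists] at hnb
    refine fullyJammed_of_groups ha hX (fun b s => ?_) fun b hbL hmb s => ?_
    · have := hnb.1 (b, s) (Finset.mem_univ _)
      simpa [hE1] using this
    · have := hnb.2 (⟨b, hbL⟩, s) (by simp [hI, hmb])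
      simp only [hE2, Set.mem_ofPred_eq, not_forall, not_not] at this
      exact this

/-! ### Guessing the victim's late attempts. -/

/-- The slots `m ≤ b < M`, counted from zero, in which the sequence makes an attempt. -/
def lateAttempts (m M : ℕ) (x : AttemptSeq) : Finset ℕ :=
  (Finset.Ico m M).filter fun b => x (b + 1) = true

theorem measurableSet_lateAttempts_eq (m M : ℕ) (S : Finset ℕ) :
    MeasurableSet (lateAttempts m M ⁻¹' {S}) := by
  have : lateAttempts m M ⁻¹' {S} = ⋂ b, {x : AttemptSeq |
      (m ≤ b ∧ b < M) ∧ x (b + 1) = true ↔ b ∈ S} := by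
    ext x
    simp only [lateAttempts, Set.mem_preimage, Set.mem_singleton_iff, Set.mem_iInter,
      Set.mem_ofPred_eq, Finset.ext_iff, Finset.mem_filter, Finset.mem_Ico]
  rw [this]
  refine MeasurableSet.iInter fun b => ?_
  exact ((MeasurableSet.const _).inter (measurableSet_bit _ _)).iff (MeasurableSet.const _)

theorem half_le_measureReal_card_lateAttempts_le (D : LocalProtocol) {m M j : ℕ}
    (h : ∑ b ∈ Finset.Ico m M, oneProb D (b + 1) ≤ (j : ℝ) / 2) :
    1 / 2 ≤ (D : Measure AttemptSeq).real {x | (lateAttempts m M x).card ≤ j} := by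
  classical
  set μ := (D : Measure AttemptSeq)
  set f : AttemptSeq → ℝ := fun x =>
    ∑ b ∈ Finset.Ico m M, ({x : AttemptSeq | x (b + 1) = true}).indicator 1 x with hf
  have hfc : ∀ x, f x = (lateAttempts m M x).card := by
    intro x
    simp [hf, lateAttempts, Set.indicator_apply]
  have hint : ∀ b ∈ Finset.Ico m M,
      Integrable (fun x => ({x : AttemptSeq | x (b + 1) = true}).indicator (1 : AttemptSeq → ℝ) x)
        μ := fun b _ =>
    (integrable_const (1 : ℝ)).indicator (measurableSet_bit (b + 1) true)
  have hI : ∫ x, f x ∂μ = ∑ b ∈ Finset.Ico m M, oneProb D (b + 1) := by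
    rw [hf, integral_finsetSum _ hint]
    exact Finset.sum_congr rfl fun b _ => integral_indicator_one (measurableSet_bit _ _)
  have hmk := mul_meas_ge_le_integral_of_nonneg (μ := μ) (f := f)
    (Filter.Eventually.of_forall fun x => by rw [hfc]; exact Nat.cast_nonneg _)
    (integrable_finsetSum _ hint) ((j : ℝ) + 1)
  rw [hI] at hmk
  have hcompl : {x | (lateAttempts m M x).card ≤ j}ᶜ = {x | (j : ℝ) + 1 ≤ f x} := by
    ext x
    simp only [Set.mem_compl_iff, Set.mem_ofPred_eq, hfc, not_le]
    norm_cast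
  have hmeas : Measurable f := by
    rw [hf]
    exact Finset.measurable_fun_sum _ fun b _ =>
      measurable_one.indicator (measurableSet_bit (b + 1) true)
  have hms : MeasurableSet {x | (j : ℝ) + 1 ≤ f x} := measurableSet_le measurable_const hmeas
  have h1 := probReal_compl_eq_one_sub (μ := μ) hms
  rw [← hcompl, compl_compl, hcompl] at h1
  have hj : (0 : ℝ) ≤ j := Nat.cast_nonneg j
  have h2 : μ.real {x | (j : ℝ) + 1 ≤ f x} ≤ 1 / 2 := by
    change ((j : ℝ) + 1) * μ.real {x | (j : ℝ) + 1 ≤ f x} ≤ _ at hmk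
    by_contra hlt
    rw [not_le] at hlt
    nlinarith
  rw [h1]
  linarith

/-- A uniform function takes prescribed values at distinct points with probability `q ^ (-|W|)`.
Stated as an inequality, this also covers `q = 0`. -/
theorem card_functions_with_values_ge {V W : Type*} [Fintype V] [DecidableEq V] [Fintype W] {q : ℕ}
    {f : W → V} (hf : Function.Injective f) (w : W → Fin q)
    [DecidablePred fun o : V → Fin q => ∀ b, o (f b) = w b] :
    (Fintype.card (V → Fin q) : ℝ) * (1 / q) ^ Fintype.card W ≤
      ((Finset.univ : Finset (V → Fin q)).filter fun o => ∀ b, o (f b) = w b).card := by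
  classical
  set T : V → Finset (Fin q) := fun v => Finset.univ.filter fun c => ∀ b, f b = v → c = w b with hT
  have hset : ((Finset.univ : Finset (V → Fin q)).filter fun o => ∀ b, o (f b) = w b) =
      Fintype.piFinset T := by
    ext o
    simp only [Finset.mem_filter, Finset.mem_univ, true_and, Fintype.mem_piFinset, hT]
    exact ⟨fun h v b hb => hb ▸ h b, fun h b => h (f b) b rfl⟩
  have hcard : ∀ v, (T v).card = if v ∈ Finset.univ.image f then 1 else q := by
    intro v
    split_ifs with hv
    · obtain ⟨b, -, rfl⟩ := Finset.mem_image.1 hv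
      have : T (f b) = {w b} := by
        ext c
        simp only [hT, Finset.mem_filter, Finset.mem_univ, true_and, Finset.mem_singleton]
        exact ⟨fun h => h b rfl, fun h b' hb' => by rw [hf hb']; exact h⟩
      rw [this, Finset.card_singleton]
    · have : T v = Finset.univ := by
        ext c
        simp only [hT, Finset.mem_filter, Finset.mem_univ, true_and, iff_true]
        intro b hb
        exact absurd (Finset.mem_image.2 ⟨b, Finset.mem_univ b, hb⟩) hv
      rw [this, Finset.card_univ, Fintype.card_fin]
  have hW : (Finset.univ.image f).card = Fintype.card W := by
    rw [Finset.card_image_of_injective _ hf, Finset.card_univ]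
  rw [hset, Fintype.card_piFinset, Finset.prod_congr rfl fun v _ => hcard v]
  rw [Finset.prod_ite, Finset.prod_const_one, one_mul, Finset.prod_const]
  have hsplit : (Finset.univ.filter fun v => v ∉ Finset.univ.image f).card + Fintype.card W =
      Fintype.card V := by
    rw [← hW, ← Finset.card_univ (α := V), add_comm]
    have := Finset.card_filter_add_card_filter_not (s := (Finset.univ : Finset V)) fun v =>
      v ∈ Finset.univ.image f
    rw [Finset.filter_mem_eq_inter, Finset.univ_inter] at this
    exact this
  rw [Fintype.card_fun, Fintype.card_fin, ← hsplit, pow_add]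
  push_cast
  rcases Nat.eq_zero_or_pos q with rfl | hq
  · rcases Nat.eq_zero_or_pos (Fintype.card W) with h0 | h0
    · simp [h0]
    · rw [Nat.cast_zero, zero_pow h0.ne', mul_zero, zero_mul]
      positivity
  · have hq' : (q : ℝ) ≠ 0 := by exact_mod_cast hq.ne'
    rw [mul_assoc, ← mul_pow, mul_one_div_cancel hq', one_pow, mul_one]

/-- Each of the `N` cells of length `q` owns `j` parties, so even if all of `S` falls into one cell
its elements get different parties. -/
theorem exists_cell_assignment {N q j : ℕ} {S : Finset ℕ} (hS : ∀ b ∈ S, b < N * q)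
    (hc : S.card ≤ j) :
    ∃ f : S → Fin N × Fin j, Function.Injective f ∧ ∀ b : S, ((f b).1 : ℕ) = b / q := by
  refine ⟨fun b => (⟨b / q, Nat.div_lt_of_lt_mul (by rw [mul_comm]; exact hS b b.2)⟩,
    Fin.castLE hc (S.equivFin b)), ?_, fun b => rfl⟩
  intro b b' h
  have := (Prod.ext_iff.1 h).2
  exact S.equivFin.injective (Fin.castLE_injective hc this)

theorem blockedByFresh_of_first_attempts {m g M a : ℕ} (ha : 1 ≤ a) {κ : Type} {o : κ → ℕ}
    {X : JamParty m g κ → AttemptSeq} (hX : ∀ i, X i ∈ silentBefore a)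
    (h1 : ∀ b : Fin m, ∃ r, X (.inr (.inl (b, true, r))) a = true)
    (h2 : ∀ b ∈ lateAttempts m M (X (.inl ())), ∃ y, o y = b ∧ X (.inr (.inr y)) a = true) :
    BlockedByFresh (jamWake a o) X (.inl ()) (a + M) := by
  intro t ht hu
  have hat : a < t := hu.1
  obtain ⟨b, rfl⟩ : ∃ b, t = a + (b + 1) := ⟨t - a - 1, by omega⟩
  have hub : X (.inl ()) (b + 1) = true := by
    have := hu.2
    rwa [show a + (b + 1) - jamWake a o (.inl () : JamParty m g κ) = b + 1 by simp [jamWake]]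
      at this
  have key : ∃ i : (Fin m × Bool × Fin g) ⊕ κ, jamWake a o (.inr i : JamParty m g κ) = b + 1 ∧
      X (.inr i) a = true := by
    by_cases hb : b < m
    · obtain ⟨r, hr⟩ := h1 ⟨b, hb⟩
      exact ⟨.inl (⟨b, hb⟩, true, r), by simp [jamWake], hr⟩
    · obtain ⟨y, hy, hya⟩ := h2 b (by
        simp only [lateAttempts, Finset.mem_filter, Finset.mem_Ico]
        exact ⟨by omega, hub⟩)
      exact ⟨.inr y, by simp [jamWake, hy], hya⟩
  obtain ⟨i, hi, hia⟩ := key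
  refine ⟨.inr i, by simp, ⟨by omega, ?_⟩, ?_⟩
  · rw [hi, show a + (b + 1) - (b + 1) = a by omega]
    exact hia
  · rintro s hs ⟨h3, h4⟩
    rw [hi] at h3 h4
    have := hX (.inr i) (s - (b + 1)) (by omega) (by omega)
    rw [this] at h4
    cases h4

/-- Given the victim's late attempts `S`, with at most `j` elements, one party per element must have
the right offset in its cell (probability `1 / q`) and attempt at age `a` (probability `p`). The
factor `1 / 4` pays for Markov's bound on the size of `S` and for covering the first `m` slots. -/
theorem le_latency_of_lottery (D : LocalProtocol) {a : ℕ} (ha : 1 ≤ a)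
    (hsil : ∀ i, 1 ≤ i → i < a → oneProb D i = 0) {n m g q N j : ℕ} (hq0 : 0 < q)
    (hN : 0 < N) (hj : 0 < j) (hcard : 1 + (m * (2 * g) + N * j) ≤ n)
    (hsum : ∑ b ∈ Finset.Ico m (N * q), oneProb D (b + 1) ≤ (j : ℝ) / 2)
    (hg : m * (1 - oneProb D a) ^ g ≤ 1 / 2) {δ : ℝ} (hδ : δ < (oneProb D a / q) ^ j / 4) :
    ((N * q : ℕ) : ℕ∞) ≤ latency D.toGlobal oblivious n δ := by
  classical
  set p := oneProb D a with hp
  have hp0 : 0 ≤ p := oneProb_nonneg D a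
  have hp1 : p ≤ 1 := oneProb_le_one D a
  have hq1 : (1 : ℝ) ≤ q := by exact_mod_cast hq0
  set μ := (D : Measure AttemptSeq) with hμ
  set V := Fin N × Fin j with hV
  set Seqs := JamParty m g V → AttemptSeq with hSeqs
  set P : Measure Seqs := Measure.pi fun _ : JamParty m g V => μ with hP
  set M := N * q with hM
  set 𝒮 := (Finset.range M).powerset.filter fun S => S.card ≤ j with h𝒮
  have hex : ∀ S : Finset ℕ, ∃ f : S → V, S ∈ 𝒮 →
      Function.Injective f ∧ ∀ b : S, ((f b).1 : ℕ) = b / q := by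
    intro S
    by_cases hS : S ∈ 𝒮
    · obtain ⟨h1, h2⟩ := Finset.mem_filter.1 hS
      obtain ⟨f, hf⟩ := exists_cell_assignment (N := N) (q := q) (S := S)
        (fun b hb => Finset.mem_range.1 (Finset.mem_powerset.1 h1 hb)) h2
      exact ⟨f, fun _ => hf⟩
    · exact ⟨fun _ => (⟨0, hN⟩, ⟨0, hj⟩), fun h => absurd h hS⟩
  choose f hf using hex
  set O := V → Fin q with hO
  set offset : (S : Finset ℕ) → S → Fin q := fun S b => ⟨b % q, Nat.mod_lt _ hq0⟩ with hoff
  set Z : Set Seqs := {X | ∀ i, X i ∈ silentBefore a} with hZ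
  set E1 : Fin m → Set Seqs := fun b => {X | ∀ r, X (.inr (.inl (b, true, r))) a = false} with hE1
  set Bx : Finset ℕ → Set Seqs := fun S =>
    {X | lateAttempts m M (X (.inl ())) = S ∧ ∀ b : S, X (.inr (.inr (f S b))) a = true} with hBx
  -- These events are disjoint for different `S`, since the victim's sequence determines `S`; their
  -- probabilities therefore add up.
  set G : Finset ℕ → Set Seqs := fun S => Bx S \ ⋃ b ∈ (Finset.univ : Finset (Fin m)), E1 b with hG
  have hbitm : ∀ (i : JamParty m g V) (l : ℕ) (b : Bool),
      MeasurableSet {X : Seqs | X i l = b} := by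
    intro i l b
    have : Measurable fun X : Seqs => X i l := by fun_prop
    exact this (measurableSet_singleton b)
  have hE1m : ∀ b, MeasurableSet (E1 b) := by
    intro b
    have : E1 b = ⋂ r, {X : Seqs | X (.inr (.inl (b, true, r))) a = false} := by ext; simp [hE1]
    rw [this]
    exact MeasurableSet.iInter fun r => hbitm _ _ _
  have hBxm : ∀ S, MeasurableSet (Bx S) := by
    intro S
    have : Bx S = ((fun X : Seqs => X (.inl ())) ⁻¹' (lateAttempts m M ⁻¹' {S})) ∩
        ⋂ b : S, {X : Seqs | X (.inr (.inr (f S b))) a = true} := by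
      ext; simp [hBx]
    rw [this]
    have hu : Measurable fun X : Seqs => X (.inl ()) := by fun_prop
    exact (hu (measurableSet_lateAttempts_eq m M S)).inter
      (MeasurableSet.iInter fun b => hbitm _ _ _)
  have hGm : ∀ S, MeasurableSet (G S) := fun S =>
    (hBxm S).diff (Finset.measurableSet_biUnion _ fun b _ => hE1m b)
  have hZm : MeasurableSet Z := by
    have : Z = Set.univ.pi fun _ => silentBefore a := by
      ext X; exact ⟨fun h i _ => h i, fun h i => h i (Set.mem_univ i)⟩
    rw [this]
    exact MeasurableSet.univ_pi fun _ => measurableSet_silentBefore a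
  have hZ1 : P.real Z = 1 := by
    rw [hZ, hP, pi_measureReal_box]
    refine Finset.prod_eq_one fun i _ => ?_
    have := measureReal_inter_silentBefore hsil Set.univ
    rwa [Set.univ_inter, probReal_univ] at this
  set ν : Finset ℕ → ℝ := fun S => μ.real (lateAttempts m M ⁻¹' {S}) with hν
  have hν0 : ∀ S, 0 ≤ ν S := fun S => measureReal_nonneg
  have hPB : ∀ S ∈ 𝒮, P.real (Bx S) = ν S * p ^ S.card := by
    intro S hS
    have hfi := (hf S hS).1
    have h := pi_measureReal_box_comp D (ι := JamParty m g V) (κ := Option S)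
      (f := fun r => r.elim (.inl ()) fun b => .inr (.inr (f S b)))
      (by
        rintro (_ | b) (_ | b') hbb
        · rfl
        · simp at hbb
        · simp at hbb
        · simp only [Option.elim_some, Sum.inr.injEq] at hbb
          rw [hfi hbb])
      (fun r => r.elim (lateAttempts m M ⁻¹' {S}) fun _ => {y | y a = true})
    have hset : Bx S = {X : Seqs | ∀ r : Option S, X (r.elim (.inl ()) fun b => .inr (.inr (f S b))) ∈
        (r.elim (lateAttempts m M ⁻¹' {S}) fun _ => {y | y a = true} : Set AttemptSeq)} := by
      ext X
      simp only [hBx, Set.mem_ofPred_eq, Option.forall, Option.elim_none, Option.elim_some]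
      rfl
    rw [hset]
    refine h.trans ?_
    rw [Fintype.prod_option]
    simp only [Option.elim_none, Option.elim_some]
    rw [Finset.prod_const, Finset.card_univ, Fintype.card_coe]
    rfl
  have hPBE : ∀ S ∈ 𝒮, ∀ b, P.real (Bx S ∩ E1 b) = ν S * p ^ S.card * (1 - p) ^ g := by
    intro S hS b
    have hfi := (hf S hS).1
    have h := pi_measureReal_box_comp D (ι := JamParty m g V) (κ := Option S ⊕ Fin g)
      (f := Sum.elim (fun r => r.elim (.inl ()) fun b => .inr (.inr (f S b)))
        fun r => .inr (.inl (b, true, r)))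
      (by
        rintro ((_ | b) | r) ((_ | b') | r') hbb
        · rfl
        · simp at hbb
        · simp at hbb
        · simp at hbb
        · simp only [Sum.elim_inl, Option.elim_some, Sum.inr.injEq] at hbb
          rw [hfi hbb]
        · simp at hbb
        · simp at hbb
        · simp at hbb
        · simpa using hbb)
      (Sum.elim (fun r => r.elim (lateAttempts m M ⁻¹' {S}) fun _ => {y | y a = true})
        fun _ => {y | y a = false})
    have hset : Bx S ∩ E1 b = {X : Seqs | ∀ r : Option S ⊕ Fin g,
        X (Sum.elim (fun r => r.elim (.inl ()) fun b => .inr (.inr (f S b)))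
          (fun r => .inr (.inl (b, true, r))) r) ∈
        (Sum.elim (fun r => r.elim (lateAttempts m M ⁻¹' {S}) fun _ => {y | y a = true})
          (fun _ => {y | y a = false}) r : Set AttemptSeq)} := by
      ext X
      simp only [hBx, hE1, Set.mem_inter_iff, Set.mem_ofPred_eq, Sum.forall, Sum.elim_inl,
        Sum.elim_inr, Option.forall, Option.elim_none, Option.elim_some]
      rfl
    rw [hset]
    refine h.trans ?_
    rw [Fintype.prod_sum_type, Fintype.prod_option]
    simp only [Sum.elim_inl, Sum.elim_inr, Option.elim_none, Option.elim_some]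
    rw [Finset.prod_const, Finset.card_univ, Fintype.card_coe, Finset.prod_const, Finset.card_univ,
      Fintype.card_fin, measureReal_zero_bit]
    rfl
  have hPG : ∀ S ∈ 𝒮, ν S * p ^ S.card / 2 ≤ P.real (G S) := by
    intro S hS
    have h1 : P.real (Bx S) ≤ P.real (G S) +
        P.real (⋃ b ∈ (Finset.univ : Finset (Fin m)), Bx S ∩ E1 b) := by
      refine le_trans (measureReal_mono ?_) (measureReal_union_le _ _)
      intro X hX
      by_cases h : X ∈ ⋃ b ∈ (Finset.univ : Finset (Fin m)), E1 b
      · right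
        simp only [Set.mem_iUnion, Finset.mem_univ, exists_true_left] at h ⊢
        obtain ⟨b, hb⟩ := h
        exact ⟨b, hX, hb⟩
      · exact Or.inl ⟨hX, h⟩
    have h2 := measureReal_biUnion_finset_le (μ := P) (Finset.univ : Finset (Fin m))
      fun b => Bx S ∩ E1 b
    rw [Finset.sum_congr rfl fun b _ => hPBE S hS b, Finset.sum_const, Finset.card_univ,
      Fintype.card_fin, nsmul_eq_mul] at h2
    rw [hPB S hS] at h1
    have h3 : 0 ≤ ν S * p ^ S.card := mul_nonneg (hν0 S) (by positivity)
    nlinarith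
  have hdisj : ∀ S S', S ≠ S' → Disjoint (G S) (G S') := fun S S' hne =>
    Set.disjoint_left.2 fun X h h' => hne (h.1.1.symm.trans h'.1.1)
  set F : O → Finset (Finset ℕ) := fun o => 𝒮.filter fun S => ∀ b : S, o (f S b) = offset S b
    with hF
  have htotal : ∑ _o : O, (p / q) ^ j / 4 ≤ ∑ o : O, P.real (⋃ S ∈ F o, G S) := by
    have h1 : ∀ o, P.real (⋃ S ∈ F o, G S) =
        ∑ S ∈ 𝒮, if ∀ b : S, o (f S b) = offset S b then P.real (G S) else 0 := by
      intro o
      rw [measureReal_biUnion_finset (fun S _ S' _ hne => hdisj S S' hne) fun S _ => hGm S, hF,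
        Finset.sum_filter]
    rw [Finset.sum_congr rfl fun o _ => h1 o, Finset.sum_comm]
    have h2 : ∀ S ∈ 𝒮, (Fintype.card O : ℝ) * ((p / q) ^ j / 2) * ν S ≤
        ∑ o : O, if ∀ b : S, o (f S b) = offset S b then P.real (G S) else 0 := by
      intro S hS
      rw [← Finset.sum_filter, Finset.sum_const, nsmul_eq_mul]
      have h3 := card_functions_with_values_ge (hf S hS).1 (offset S)
      rw [Fintype.card_coe] at h3
      have h4 := hPG S hS
      have h5 : (p / q) ^ j ≤ (p / q) ^ S.card :=
        pow_le_pow_of_le_one (by positivity) ((div_le_one (by linarith)).2 (by linarith))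
          (Finset.mem_filter.1 hS).2
      calc (Fintype.card O : ℝ) * ((p / q) ^ j / 2) * ν S
          ≤ (Fintype.card O : ℝ) * ((p / q) ^ S.card / 2) * ν S := by
            gcongr
        _ = (Fintype.card O : ℝ) * (1 / q) ^ S.card * (ν S * p ^ S.card / 2) := by
            rw [div_pow, one_div, inv_pow]; ring
        _ ≤ _ := by
            refine mul_le_mul h3 h4 ?_ (Nat.cast_nonneg _)
            exact div_nonneg (mul_nonneg (hν0 S) (by positivity)) (by norm_num)
    refine le_trans ?_ (Finset.sum_le_sum h2)
    rw [← Finset.mul_sum, Finset.sum_const, Finset.card_univ, nsmul_eq_mul]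
    have h6 : ∑ S ∈ 𝒮, ν S = μ.real {x | (lateAttempts m M x).card ≤ j} := by
      rw [hν, sum_measureReal_preimage_singleton 𝒮 fun S _ => measurableSet_lateAttempts_eq m M S]
      congr 1
      ext x
      simp only [h𝒮, Set.mem_preimage, Finset.mem_coe, Finset.mem_filter, Finset.mem_powerset,
        Set.mem_ofPred_eq, and_iff_right_iff_imp]
      intro _ b hb
      simp only [lateAttempts, Finset.mem_filter, Finset.mem_Ico] at hb
      exact Finset.mem_range.2 hb.1.2
    rw [h6]
    have h7 := half_le_measureReal_card_lateAttempts_le D hsum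
    have h8 : 0 ≤ (Fintype.card O : ℝ) * ((p / q) ^ j / 2) := by positivity
    calc (Fintype.card O : ℝ) * ((p / q) ^ j / 4)
        = (Fintype.card O : ℝ) * ((p / q) ^ j / 2) * (1 / 2) := by ring
      _ ≤ _ := by gcongr
  have : Nonempty O := ⟨fun _ => ⟨0, hq0⟩⟩
  -- Averaging over the offsets fixes wake-up times that win the lottery at least as often as random
  -- ones.
  obtain ⟨o, -, ho⟩ := Finset.exists_le_of_sum_le Finset.univ_nonempty htotal
  refine le_latency_of_pi (D := D) (F := Z ∩ ⋃ S ∈ F o, G S) (q := δ) ?_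
    (jamWake a fun y => y.1 * q + o y) (.inl ()) M
    (hZm.inter (Finset.measurableSet_biUnion _ fun S _ => hGm S)) ?_ ?_
  · change Fintype.card (Unit ⊕ ((Fin m × Bool × Fin g) ⊕ (Fin N × Fin j))) ≤ n
    simp only [Fintype.card_sum, Fintype.card_prod, Fintype.card_bool, Fintype.card_fin,
      Fintype.card_unit]
    linarith
  · have hae : ∀ᵐ X ∂P, X ∈ Z := by
      rw [measureReal_def, ENNReal.toReal_eq_one_iff] at hZ1
      exact (prob_compl_eq_zero_iff hZm).2 hZ1
    have hcongr : P.real (Z ∩ ⋃ S ∈ F o, G S) = P.real (⋃ S ∈ F o, G S) := by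
      refine measureReal_congr ?_
      filter_upwards [hae] with X hX
      exact propext ⟨fun h => h.2, fun h => ⟨hX, h⟩⟩
    rw [← hP, hcongr]
    linarith
  · rintro X ⟨hX, hXG⟩
    right
    simp only [Set.mem_iUnion] at hXG
    obtain ⟨S, hS, ⟨h1, h2⟩, h3⟩ := hXG
    obtain ⟨hS1, hS2⟩ := Finset.mem_filter.1 hS
    refine blockedByFresh_of_first_attempts ha hX (fun b => ?_) fun b hb => ?_
    · by_contra hne
      refine h3 (Set.mem_iUnion₂.2 ⟨b, Finset.mem_univ b, fun r => ?_⟩)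
      rw [not_exists] at hne
      simpa using hne r
    · rw [h1] at hb
      refine ⟨f S ⟨b, hb⟩, ?_, h2 ⟨b, hb⟩⟩
      have h5 := congrArg Fin.val (hS2 ⟨b, hb⟩)
      rw [(hf S hS1).2 ⟨b, hb⟩, h5]
      exact Nat.div_add_mod' b q

/-! ### Parameters along powers of two, and the dichotomy. -/

theorem tendsto_natLog_two : Tendsto (Nat.log 2) atTop atTop :=
  tendsto_atTop.2 fun R => (eventually_ge_atTop (2 ^ R)).mono fun _ hl =>
    Nat.le_log_of_pow_le one_lt_two hl

theorem eventually_mul_sq_natLog_le (R : ℕ) : ∀ᶠ l : ℕ in atTop, R * Nat.log 2 l ^ 2 ≤ l := by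
  have h1 : Tendsto (fun x : ℕ => (x : ℝ) ^ 2 * (1 / 2 : ℝ) ^ x) atTop (𝓝 0) :=
    tendsto_pow_const_mul_const_pow_of_abs_lt_one 2 (by norm_num [abs_of_pos])
  have h2 : ∀ᶠ x : ℕ in atTop, (x : ℝ) ^ 2 * (1 / 2 : ℝ) ^ x ≤ 1 / (R + 1) :=
    h1.eventually_le_const (by positivity)
  filter_upwards [tendsto_natLog_two.eventually h2, eventually_ne_atTop 0] with l hl hl0
  refine le_trans ?_ (Nat.pow_log_le_self 2 hl0)
  generalize Nat.log 2 l = x at hl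
  rw [one_div_pow, mul_one_div, div_le_div_iff₀ (by positivity) (by positivity)] at hl
  have h3 : (R : ℝ) * x ^ 2 ≤ 2 ^ x := by nlinarith [sq_nonneg (x : ℝ)]
  exact_mod_cast h3

theorem rate_two_pow_le {l : ℕ} (hl : 2 ≤ Nat.log 2 l) :
    ((2 ^ l : ℕ) : ℝ) * Real.log (2 ^ l : ℕ) / Real.log (Real.log (2 ^ l : ℕ)) ^ 2 ≤
      16 * (2 ^ l * l / (Nat.log 2 l : ℝ) ^ 2) := by
  have hl0 : l ≠ 0 := by rintro rfl; simp at hl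
  have hpow : ((2 : ℝ) ^ Nat.log 2 l) ≤ l := by exact_mod_cast Nat.pow_log_le_self 2 hl0
  generalize Nat.log 2 l = x at hl hpow
  have hx : (2 : ℝ) ≤ x := by exact_mod_cast hl
  have hl1 : (0 : ℝ) < l := by positivity
  have h1 := Real.log_two_gt_d9
  have h2 := Real.log_two_lt_d9
  push_cast
  rw [Real.log_pow, Real.log_mul hl1.ne' (by positivity)]
  have h3 : (x : ℝ) * Real.log 2 ≤ Real.log l := by
    rw [← Real.log_pow]
    exact Real.log_le_log (by positivity) hpow
  have h4 : -Real.log 2 ≤ Real.log (Real.log 2) := by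
    rw [← Real.log_inv]
    exact Real.log_le_log (by norm_num) (by linarith)
  have h5 : (x : ℝ) / 4 ≤ Real.log l + Real.log (Real.log 2) := by nlinarith
  have h6 : ((x : ℝ) / 4) ^ 2 ≤ (Real.log l + Real.log (Real.log 2)) ^ 2 :=
    pow_le_pow_left₀ (by positivity) h5 2
  have h7 : (2 : ℝ) ^ l * (l * Real.log 2) ≤ 2 ^ l * l := by
    refine mul_le_mul_of_nonneg_left ?_ (by positivity)
    nlinarith
  calc (2 : ℝ) ^ l * (l * Real.log 2) / (Real.log l + Real.log (Real.log 2)) ^ 2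
      ≤ 2 ^ l * l / (x / 4 : ℝ) ^ 2 := div_le_div₀ (by positivity) h7 (by positivity) h6
    _ = 16 * (2 ^ l * l / (x : ℝ) ^ 2) := by field_simp; norm_num

theorem isOmega_of_frequently_two_pow {ℓ : ℕ → ℕ∞} {c : ℝ} (hc : 0 < c)
    (h : ∃ᶠ l : ℕ in atTop, ∃ L : ℕ, c * (2 ^ l * l / (Nat.log 2 l : ℝ) ^ 2) ≤ L ∧
      (L : ℕ∞) ≤ ℓ (2 ^ l)) :
    IsOmega ℓ fun n : ℕ => (n : ℝ) * Real.log n / Real.log (Real.log n) ^ 2 := by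
  refine ⟨c / 16, by positivity, ?_⟩
  have ht : Tendsto (fun l : ℕ => 2 ^ l) atTop (atTop : Filter ℕ) :=
    tendsto_pow_atTop_atTop_of_one_lt one_lt_two
  refine ht.frequently ((h.and_eventually (tendsto_natLog_two.eventually_ge_atTop 2)).mono ?_)
  rintro l ⟨⟨L, hL, hLℓ⟩, hl⟩
  have h1 : ENNReal.ofReal (c / 16 * (((2 ^ l : ℕ) : ℝ) * Real.log (2 ^ l : ℕ) /
      Real.log (Real.log (2 ^ l : ℕ)) ^ 2)) ≤ (L : ℝ≥0∞) := by
    refine ENNReal.ofReal_le_of_le_toReal ?_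
    rw [ENNReal.toReal_natCast]
    refine le_trans ?_ hL
    have := rate_two_pow_le hl
    calc _ ≤ c / 16 * (16 * (2 ^ l * l / (Nat.log 2 l : ℝ) ^ 2)) := by gcongr
      _ = _ := by ring
  refine h1.trans ?_
  have := ENat.toENNReal_le.2 hLℓ
  simpa using this

/-- Windows centred at exponents `4 * Λ` apart are disjoint. About `A / (16 * Λ)` of them between
the exponents `A / 2` and `A` contribute order `κ * A / Λ` each, so the total is quadratic in `A /
Λ`. -/
theorem le_sum_of_window_sums {s : ℕ → ℝ} (hs : ∀ i, 0 ≤ s i) {κ : ℝ} (hκ : 0 ≤ κ) {l₀ : ℕ}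
    (h : ∀ l, l₀ ≤ l → κ * l / Nat.log 2 l ≤
      ∑ b ∈ Finset.Ico (2 ^ (l - 2 * Nat.log 2 l)) (2 ^ (l + 2 * Nat.log 2 l)), s b)
    {A Λ : ℕ} (hA : 2 * l₀ + 4 ≤ A) (hΛ : Nat.log 2 A ≤ Λ) (hΛA : 16 * Λ ≤ A) (hΛ0 : 0 < Λ) :
    κ * A ^ 2 / (128 * Λ ^ 2) ≤ ∑ b ∈ Finset.range (2 ^ A), s b := by
  have hΛ0' : (0 : ℝ) < Λ := by exact_mod_cast hΛ0
  have key : ∀ t : ℕ, A / 2 + 4 * t * Λ ≤ A →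
      t * (κ * A / (4 * Λ)) ≤ ∑ b ∈ Finset.range (2 ^ (A / 2 + 4 * t * Λ)), s b := by
    intro t
    induction t with
    | zero => intro _; simpa using Finset.sum_nonneg fun b _ => hs b
    | succ t ih =>
      intro ht
      have ht' : A / 2 + 4 * t * Λ + 4 * Λ ≤ A := by linarith
      rw [show A / 2 + 4 * (t + 1) * Λ = A / 2 + 4 * t * Λ + 4 * Λ by ring]
      generalize hx : A / 2 + 4 * t * Λ = x at ih ht'
      have hxA : A / 2 ≤ x := by rw [← hx]; exact Nat.le_add_right _ _
      have hw := h (x + 2 * Λ) (by omega)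
      have hlog : Nat.log 2 (x + 2 * Λ) ≤ Λ := (Nat.log_mono_right (by omega)).trans hΛ
      have hlog0 : 0 < Nat.log 2 (x + 2 * Λ) := Nat.log_pos one_lt_two (by omega)
      generalize Nat.log 2 (x + 2 * Λ) = y at hw hlog hlog0
      have h1 : κ * A / (4 * Λ) ≤ κ * (x + 2 * Λ : ℕ) / y := by
        have hy : (y : ℝ) ≤ Λ := by exact_mod_cast hlog
        have hy0 : (0 : ℝ) < y := by exact_mod_cast hlog0
        have h2 : (A : ℝ) ≤ 4 * (x + 2 * Λ : ℕ) := by exact_mod_cast (by omega : A ≤ 4 * (x + 2 * Λ))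
        rw [div_le_div_iff₀ (by positivity) hy0]
        have h3 : (A : ℝ) * y ≤ 4 * (x + 2 * Λ : ℕ) * Λ := by gcongr
        nlinarith
      have h2 : ∑ b ∈ Finset.Ico (2 ^ (x + 2 * Λ - 2 * y)) (2 ^ (x + 2 * Λ + 2 * y)), s b ≤
          ∑ b ∈ Finset.Ico (2 ^ x) (2 ^ (x + 4 * Λ)), s b := by
        refine Finset.sum_le_sum_of_subset_of_nonneg (Finset.Ico_subset_Ico ?_ ?_)
          fun b _ _ => hs b
        · exact Nat.pow_le_pow_right two_pos (by omega)
        · exact Nat.pow_le_pow_right two_pos (by omega)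
      have h3 := Finset.sum_range_add_sum_Ico s
        (Nat.pow_le_pow_right two_pos (Nat.le_add_right x (4 * Λ)))
      have h4 := ih (by omega)
      push_cast
      linarith
  have hmul : A / (16 * Λ) * (16 * Λ) ≤ A := Nat.div_mul_le_self _ _
  have ht : A / 2 + 4 * (A / (16 * Λ)) * Λ ≤ A := by
    generalize A / (16 * Λ) = r at hmul
    have : r * (16 * Λ) = 16 * (r * Λ) := by ring
    have : 4 * r * Λ = 4 * (r * Λ) := by ring
    omega
  have hr : (A : ℝ) / (32 * Λ) ≤ (A / (16 * Λ) : ℕ) := by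
    have h1 : A < A / (16 * Λ) * (16 * Λ) + 16 * Λ := Nat.lt_div_mul_add (by omega)
    have h2 : 1 ≤ A / (16 * Λ) := Nat.div_pos hΛA (by omega)
    generalize A / (16 * Λ) = r at h1 h2
    rw [div_le_iff₀ (by positivity)]
    have h3 : A ≤ r * (32 * Λ) := by nlinarith
    exact_mod_cast h3
  calc κ * A ^ 2 / (128 * Λ ^ 2) = A / (32 * Λ) * (κ * A / (4 * Λ)) := by
        field_simp; ring
    _ ≤ (A / (16 * Λ) : ℕ) * (κ * A / (4 * Λ)) := by gcongr
    _ ≤ _ := key _ ht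
    _ ≤ _ := by
      refine Finset.sum_le_sum_of_subset_of_nonneg (Finset.range_subset_range.2 ?_)
        fun b _ _ => hs b
      exact Nat.pow_le_pow_right two_pos ht

theorem le_latency_of_silent (D : LocalProtocol) (h : ∀ i, 1 ≤ i → oneProb D i = 0) {n : ℕ}
    (hn : 1 ≤ n) {q : ℝ} (hq : q < 1) (L : ℕ) : (L : ℕ∞) ≤ latency D.toGlobal oblivious n q := by
  have hF : MeasurableSet {X : Unit → AttemptSeq | ∀ i, X i ∈ silentBefore (L + 1)} := by
    have : {X : Unit → AttemptSeq | ∀ i, X i ∈ silentBefore (L + 1)} =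
        Set.univ.pi fun _ => silentBefore (L + 1) := by ext; simp
    rw [this]
    exact MeasurableSet.univ_pi fun _ => measurableSet_silentBefore _
  refine le_latency_of_pi (ι := Unit) (by simpa using hn) (fun _ => 0) () L hF ?_ ?_
  · rw [pi_measureReal_box]
    have := measureReal_inter_silentBefore (fun i h1 (_ : i < L + 1) => h i h1) Set.univ
    rw [Set.univ_inter, probReal_univ] at this
    simpa [this] using hq
  · rintro X hX
    right
    rintro t ht ⟨h1, h2⟩
    have := hX () t h1 (by omega)
    rw [Nat.sub_zero, this] at h2
    cases h2

theorem two_pow_rpow_neg (l : ℕ) (k : ℝ) :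
    ((2 ^ l : ℕ) : ℝ) ^ (-k) = (2 : ℝ) ^ (-(k * l)) := by
  push_cast
  rw [← Real.rpow_natCast, ← Real.rpow_mul two_pos.le]
  congr 1
  ring

theorem two_pow_mul_le {C l x : ℕ} (hx : C + 4 ≤ x) (hl : l < 2 ^ (x + 1)) (hxl : 2 * x ≤ l) :
    2 ^ (l - 2 * x) * (2 * (C * l)) ≤ 2 ^ (l - 2) := by
  have hC : C ≤ 2 ^ (x - 4) :=
    Nat.lt_two_pow_self.le.trans (Nat.pow_le_pow_right two_pos (by omega))
  calc 2 ^ (l - 2 * x) * (2 * (C * l))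
      ≤ 2 ^ (l - 2 * x) * (2 * (2 ^ (x - 4) * 2 ^ (x + 1))) := by gcongr
    _ = 2 ^ (l - 2) := by
      rw [← pow_add, ← pow_succ', ← pow_add]
      congr 1
      omega

theorem two_pow_mul_pow_le {p : ℝ} (hp : p ≤ 1) {C l x : ℕ} (hC : (1 - p) ^ C ≤ 1 / 4) :
    ((2 ^ (l - 2 * x) : ℕ) : ℝ) * (1 - p) ^ (C * l) ≤ (1 / 2) ^ l := by
  have h1 : (1 - p) ^ (C * l) ≤ (1 / 4) ^ l := by
    rw [pow_mul]
    exact pow_le_pow_left₀ (pow_nonneg (by linarith) C) hC l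
  have h2 : ((2 ^ (l - 2 * x) : ℕ) : ℝ) ≤ 2 ^ l := by
    exact_mod_cast Nat.pow_le_pow_right two_pos (Nat.sub_le _ _)
  calc _ ≤ (2 : ℝ) ^ l * (1 / 4) ^ l :=
        mul_le_mul h2 h1 (pow_nonneg (by linarith) _) (by positivity)
    _ = (1 / 2) ^ l := by rw [← mul_pow]; norm_num

/-- Cells of length `2 ^ (3 * x + 3)` make each guess succeed with probability at least `2 ^ (-4 *
x)`. At most `k * l / (8 * x)` guesses then cost only `n ^ (-k / 2)`. -/
theorem le_latency_two_pow_of_light_window (D : LocalProtocol) {a : ℕ} (ha : 1 ≤ a)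
    (hsil : ∀ i, 1 ≤ i → i < a → oneProb D i = 0) {C c l x j : ℕ} {k : ℝ}
    (hC : (1 - oneProb D a) ^ C ≤ 1 / 4) (hc : (1 / 2) ^ c ≤ oneProb D a) (hxC : C + 4 ≤ x)
    (hxc : c + 3 ≤ x) (hlx : l < 2 ^ (x + 1)) (hxl : 4 * x ≤ l) (hj : 0 < j) (hjl : j ≤ l)
    (hjk : 8 * x * j ≤ k * l) (hkl : 4 < k * l)
    (hsum : ∑ b ∈ Finset.Ico (2 ^ (l - 2 * x)) (2 ^ (l + 2 * x)), oneProb D (b + 1) ≤ (j : ℝ) / 2) :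
    ((2 ^ (l + 2 * x) : ℕ) : ℕ∞) ≤ whpLatency D.toGlobal oblivious k (2 ^ l) := by
  have hM : 2 ^ (l + 2 * x) = 2 ^ (l - x - 3) * 2 ^ (3 * x + 3) := by
    rw [← pow_add]
    congr 1
    omega
  rw [hM] at hsum ⊢
  rw [whpLatency, two_pow_rpow_neg]
  refine le_latency_of_lottery D ha hsil (m := 2 ^ (l - 2 * x)) (g := C * l) (q := 2 ^ (3 * x + 3))
    (N := 2 ^ (l - x - 3)) (j := j) (by positivity) (by positivity) hj ?_ hsum ?_ ?_
  · have h1 := two_pow_mul_le hxC hlx (by omega)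
    have h2 : 2 ^ (l - x - 3) * j ≤ 2 ^ (l - 2) := by
      calc 2 ^ (l - x - 3) * j ≤ 2 ^ (l - x - 3) * 2 ^ (x + 1) := by gcongr; omega
        _ = 2 ^ (l - 2) := by
          rw [← pow_add]
          congr 1
          omega
    have h3 : 2 ^ l = 4 * 2 ^ (l - 2) := by
      rw [show 4 = 2 ^ 2 from rfl, ← pow_add]
      congr 1
      omega
    have h4 : 0 < 2 ^ (l - 2) := by positivity
    omega
  · refine (two_pow_mul_pow_le (oneProb_le_one D a) hC).trans ?_
    calc ((1 : ℝ) / 2) ^ l ≤ (1 / 2) ^ 1 := pow_le_pow_of_le_one (by norm_num) (by norm_num) (by omega)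
      _ = 1 / 2 := pow_one _
  · have h1 : ((1 : ℝ) / 2) ^ (4 * x) ≤ oneProb D a / (2 ^ (3 * x + 3) : ℕ) := by
      rw [le_div_iff₀ (by positivity)]
      refine le_trans ?_ hc
      push_cast
      calc ((1 : ℝ) / 2) ^ (4 * x) * 2 ^ (3 * x + 3)
          = (1 / 2) ^ (x - 3) * ((1 / 2) ^ (3 * x + 3) * 2 ^ (3 * x + 3)) := by
            rw [← mul_assoc, ← pow_add]
            congr 2
            omega
        _ = (1 / 2) ^ (x - 3) := by rw [← mul_pow]; norm_num
        _ ≤ (1 / 2) ^ c := pow_le_pow_of_le_one (by norm_num) (by norm_num) (by omega)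
    have h2 : (2 : ℝ) ^ (-(k * l / 2)) ≤ (oneProb D a / (2 ^ (3 * x + 3) : ℕ)) ^ j := by
      refine le_trans ?_ (pow_le_pow_left₀ (by positivity) h1 j)
      rw [← pow_mul, one_div, inv_pow, ← Real.rpow_natCast, ← Real.rpow_neg two_pos.le]
      refine Real.rpow_le_rpow_of_exponent_le one_le_two ?_
      push_cast
      linarith
    have h3 : (2 : ℝ) ^ (-(k * l)) < (2 : ℝ) ^ (-(k * l / 2)) / 4 := by
      have : (2 : ℝ) ^ (-(k * l / 2)) / 4 = 2 ^ (-(k * l / 2) - 2) := by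
        rw [Real.rpow_sub two_pos]
        norm_num
      rw [this]
      exact Real.rpow_lt_rpow_of_exponent_lt one_lt_two (by linarith)
    linarith

theorem sum_Icc_one_eq_sum_range (f : ℕ → ℝ) (m : ℕ) :
    ∑ i ∈ Finset.Icc 1 m, f i = ∑ b ∈ Finset.range m, f (b + 1) := by
  induction m with
  | zero => simp
  | succ m ih => rw [Finset.sum_Icc_succ_top (by omega), ih, Finset.sum_range_succ]

/-- Two groups of `n / 8` uniformly woken parties: `hsum` makes the expected number of hits per
group and late slot at least `3 * l`. A miss has probability at most `8 ^ (-l)`, which beats the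
number of slots, at most `l * 2 ^ l`. -/
theorem le_latency_two_pow_of_heavy_prefix (D : LocalProtocol) {a : ℕ} (ha : 1 ≤ a)
    (hsil : ∀ i, 1 ≤ i → i < a → oneProb D i = 0) {C l x T : ℕ} {k : ℝ}
    (hC : (1 - oneProb D a) ^ C ≤ 1 / 4) (hxC : C + 4 ≤ x)
    (hlx : l < 2 ^ (x + 1)) (hxl : 4 * x ≤ l) (haT : a ≤ T) (hlT : 2 ^ l ≤ T) (hTl : T ≤ l * 2 ^ l)
    (hsum : 3 * l * T ≤
      2 ^ (l - 3) * ∑ b ∈ Finset.range (2 ^ (l - 2 * x)), oneProb D (b + 1))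
    (hkl : 1 < k * l) :
    ((T - a : ℕ) : ℕ∞) ≤ whpLatency D.toGlobal oblivious k (2 ^ l) := by
  rw [whpLatency, two_pow_rpow_neg]
  have hmT : 2 ^ (l - 2 * x) ≤ T := (Nat.pow_le_pow_right two_pos (Nat.sub_le _ _)).trans hlT
  refine le_latency_of_uniform_jam D ha hsil (m := 2 ^ (l - 2 * x)) (g := C * l)
    (h := 2 ^ (l - 3)) (T := T) ?_ hmT (by omega) ?_
  · have h1 := two_pow_mul_le hxC hlx (by omega)
    have h2 : 2 ^ l = 8 * 2 ^ (l - 3) := by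
      rw [show 8 = 2 ^ 3 from rfl, ← pow_add]
      congr 1
      omega
    have h3 : 2 ^ (l - 2) = 2 * 2 ^ (l - 3) := by
      rw [← pow_succ']
      congr 1
      omega
    have h4 : 0 < 2 ^ (l - 3) := by positivity
    omega
  · rw [sum_Icc_one_eq_sum_range]
    have hT0 : (0 : ℝ) < T := by exact_mod_cast lt_of_lt_of_le (by positivity) hlT
    have hS : ∑ b ∈ Finset.range (2 ^ (l - 2 * x)), oneProb D (b + 1) ≤ T := by
      refine (Finset.sum_le_sum fun b _ => oneProb_le_one D (b + 1)).trans ?_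
      rw [Finset.sum_const, Finset.card_range, nsmul_one]
      exact_mod_cast hmT
    generalize ∑ b ∈ Finset.range (2 ^ (l - 2 * x)), oneProb D (b + 1) = S at hsum hS
    have hS0 : 0 ≤ 1 - S / T := sub_nonneg.2 ((div_le_one hT0).2 hS)
    have hpow : (1 - S / T) ^ 2 ^ (l - 3) ≤ (1 / 8 : ℝ) ^ l := by
      calc (1 - S / T) ^ 2 ^ (l - 3) ≤ Real.exp (-(S / T)) ^ 2 ^ (l - 3) :=
            pow_le_pow_left₀ hS0 (Real.one_sub_le_exp_neg _) _
        _ = Real.exp (-(2 ^ (l - 3) * S / T)) := by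
            rw [← Real.exp_nat_mul]
            congr 1
            push_cast
            ring
        _ ≤ Real.exp (-(3 * l)) := by
            refine Real.exp_le_exp.2 (neg_le_neg ?_)
            rwa [le_div_iff₀ hT0]
        _ = (Real.exp (-1) ^ 3) ^ l := by
            rw [← pow_mul, ← Real.exp_nat_mul]
            congr 1
            push_cast
            ring
        _ ≤ (1 / 8 : ℝ) ^ l := by
            have h1 : Real.exp (-1) ≤ 1 / 2 := by
              have := Real.exp_neg_one_lt_d9
              linarith
            have h2 : Real.exp (-1) ^ 3 ≤ (1 / 2) ^ 3 :=
              pow_le_pow_left₀ (Real.exp_pos _).le h1 3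
            exact pow_le_pow_left₀ (by positivity) (h2.trans (by norm_num)) l
    have hl : (l : ℝ) ≤ 2 ^ l := by exact_mod_cast Nat.lt_two_pow_self.le
    have hhalf : ((1 : ℝ) / 2) ^ l ≤ 1 / 16 := by
      calc ((1 : ℝ) / 2) ^ l ≤ (1 / 2) ^ 4 :=
            pow_le_pow_of_le_one (by norm_num) (by norm_num) (by omega)
        _ = 1 / 16 := by norm_num
    have h1 : ((2 ^ (l - 2 * x) : ℕ) : ℝ) * (2 * (1 - oneProb D a) ^ (C * l)) ≤ 1 / 8 := by
      have := two_pow_mul_pow_le (x := x) (l := l) (oneProb_le_one D a) hC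
      linarith
    have h2 : ((T - a : ℕ) : ℝ) * (2 * (1 - S / T) ^ 2 ^ (l - 3)) ≤ 1 / 8 := by
      have h3 : ((T - a : ℕ) : ℝ) ≤ 2 ^ l * 2 ^ l := by
        have h4 : ((T - a : ℕ) : ℝ) ≤ T := by exact_mod_cast Nat.sub_le _ _
        have h5 : (T : ℝ) ≤ l * 2 ^ l := by exact_mod_cast hTl
        have h6 : (l : ℝ) * 2 ^ l ≤ 2 ^ l * 2 ^ l := by gcongr
        linarith
      calc ((T - a : ℕ) : ℝ) * (2 * (1 - S / T) ^ 2 ^ (l - 3))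
          ≤ (2 ^ l * 2 ^ l) * (2 * (1 / 8 : ℝ) ^ l) := by gcongr
        _ = 2 * (2 * 2 * (1 / 8 : ℝ)) ^ l := by rw [mul_pow, mul_pow]; ring
        _ = 2 * (1 / 2) ^ l := by norm_num
        _ ≤ 1 / 8 := by linarith
    have h3 : (2 : ℝ) ^ (-(k * l)) < 1 / 2 := by
      calc (2 : ℝ) ^ (-(k * l)) < 2 ^ (-1 : ℝ) :=
            Real.rpow_lt_rpow_of_exponent_lt one_lt_two (by linarith)
        _ = 1 / 2 := by rw [Real.rpow_neg_one]; norm_num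
    linarith

theorem half_le_natFloor {y : ℝ} (hy : 1 ≤ y) : y / 2 ≤ ⌊y⌋₊ := by
  have h1 := Nat.lt_floor_add_one y
  have h2 : (1 : ℝ) ≤ ⌊y⌋₊ := by exact_mod_cast Nat.le_floor (by simpa using hy)
  linarith

theorem isOmega_whpLatency_of_silent (D : LocalProtocol) (h : ∀ i, 1 ≤ i → oneProb D i = 0) {k : ℝ}
    (hk : 0 < k) :
    IsOmega (whpLatency D.toGlobal oblivious k)
      fun n : ℕ => (n : ℝ) * Real.log n / Real.log (Real.log n) ^ 2 := by
  refine isOmega_of_frequently_two_pow one_pos (Eventually.frequently ?_)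
  filter_upwards [eventually_ge_atTop 1] with l hl
  refine ⟨_, Nat.le_ceil _, le_latency_of_silent D h Nat.one_le_two_pow ?_ _⟩
  rw [two_pow_rpow_neg]
  have : (0 : ℝ) < l := by exact_mod_cast hl
  exact Real.rpow_lt_one_of_one_lt_of_neg one_lt_two (by nlinarith)

theorem isOmega_whpLatency_of_first_attempt (D : LocalProtocol) {a : ℕ} (ha : 1 ≤ a)
    (hsil : ∀ i, 1 ≤ i → i < a → oneProb D i = 0) (hp : 0 < oneProb D a) {k : ℝ} (hk : 0 < k) :
    IsOmega (whpLatency D.toGlobal oblivious k)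
      fun n : ℕ => (n : ℝ) * Real.log n / Real.log (Real.log n) ^ 2 := by
  obtain ⟨C, hC⟩ : ∃ C : ℕ, (1 - oneProb D a) ^ C < 1 / 4 :=
    exists_pow_lt_of_lt_one (by norm_num) (by linarith)
  obtain ⟨c, hc⟩ : ∃ c : ℕ, (1 / 2 : ℝ) ^ c < oneProb D a :=
    exists_pow_lt_of_lt_one hp (by norm_num)
  -- The condition `8 * κ ≤ k` keeps the lottery with `κ * l / x` guesses affordable.
  obtain ⟨κ, hκ0, hκ1, hκk⟩ : ∃ κ : ℝ, 0 < κ ∧ κ ≤ 1 ∧ 8 * κ ≤ k :=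
    ⟨min 1 (k / 8), by positivity, min_le_left _ _, by linarith [min_le_right 1 (k / 8)]⟩
  obtain ⟨R, hR⟩ := exists_nat_ge (49152 / κ)
  have hRκ : 49152 ≤ R * κ := (div_le_iff₀ hκ0).1 hR
  have hR1 : 49152 ≤ R := by
    have : (49152 : ℝ) ≤ R := by nlinarith [Nat.cast_nonneg (α := ℝ) R]
    exact_mod_cast this
  have hkl : ∀ᶠ l : ℕ in atTop, 4 < k * l :=
    (tendsto_natCast_atTop_atTop.const_mul_atTop hk).eventually_gt_atTop 4
  have hgood : ∀ᶠ l : ℕ in atTop, C + c + 4 ≤ Nat.log 2 l ∧ R * Nat.log 2 l ^ 2 ≤ l ∧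
      2 * a + 2 ≤ l ∧ 4 < k * l :=
    (tendsto_natLog_two.eventually_ge_atTop _).and ((eventually_mul_sq_natLog_le R).and
      ((eventually_ge_atTop _).and hkl))
  have hratio : ∀ l : ℕ, C + c + 4 ≤ Nat.log 2 l → R * Nat.log 2 l ^ 2 ≤ l →
      49152 * (Nat.log 2 l : ℝ) ^ 2 ≤ κ * l ∧ 32 * Nat.log 2 l ≤ l := by
    intro l h1 h2
    generalize Nat.log 2 l = x at h1 h2
    constructor
    · have h3 : (R : ℝ) * x ^ 2 ≤ l := by exact_mod_cast h2
      calc 49152 * (x : ℝ) ^ 2 ≤ R * κ * x ^ 2 := by gcongr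
        _ = κ * (R * x ^ 2) := by ring
        _ ≤ κ * l := by gcongr
    · refine le_trans ?_ h2
      calc 32 * x ≤ R * x := by gcongr; omega
        _ ≤ R * x ^ 2 := by gcongr; exact Nat.le_self_pow two_ne_zero x
  have hfloor : ∀ l : ℕ, C + c + 4 ≤ Nat.log 2 l → R * Nat.log 2 l ^ 2 ≤ l →
      1 ≤ κ * l / Nat.log 2 l := by
    intro l h1 h2
    have h3 := (hratio l h1 h2).1
    have h4 : (1 : ℝ) ≤ Nat.log 2 l := by exact_mod_cast (by omega : 1 ≤ Nat.log 2 l)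
    rw [le_div_iff₀ (by linarith)]
    nlinarith
  by_cases hlight : ∃ᶠ l : ℕ in atTop,
      ∑ b ∈ Finset.Ico (2 ^ (l - 2 * Nat.log 2 l)) (2 ^ (l + 2 * Nat.log 2 l)), oneProb D (b + 1) ≤
        (⌊κ * l / Nat.log 2 l⌋₊ : ℝ) / 2
  · refine isOmega_of_frequently_two_pow one_pos ((hlight.and_eventually hgood).mono ?_)
    rintro l ⟨hsum, h1, h2, h3, h4⟩
    have h5 := hfloor l h1 h2
    have h6 := (hratio l h1 h2).2
    have h7 : l < 2 ^ (Nat.log 2 l + 1) := Nat.lt_pow_succ_log_self one_lt_two l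
    generalize Nat.log 2 l = x at *
    have hx : (1 : ℝ) ≤ x := by exact_mod_cast (by omega : 1 ≤ x)
    have hx0 : (0 : ℝ) < x := by linarith
    have hl0 : (0 : ℝ) ≤ l := Nat.cast_nonneg l
    have hjy : (⌊κ * l / x⌋₊ : ℝ) ≤ κ * l / x := Nat.floor_le (by linarith)
    have hjx : x * (⌊κ * l / x⌋₊ : ℝ) ≤ κ * l := by
      rw [le_div_iff₀ hx0] at hjy
      linarith
    have hj0 : 0 < ⌊κ * l / x⌋₊ := Nat.floor_pos.2 h5
    have hjl : (⌊κ * l / x⌋₊ : ℝ) ≤ l := by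
      nlinarith [Nat.cast_nonneg (α := ℝ) ⌊κ * l / x⌋₊]
    refine ⟨_, ?_, le_latency_two_pow_of_light_window D ha hsil hC.le hc.le (by omega) (by omega) h7
      (by omega) hj0 (by exact_mod_cast hjl) (by nlinarith) h4 hsum⟩
    have h8 : (l : ℝ) ≤ 2 ^ (2 * x) := by
      exact_mod_cast h7.le.trans (Nat.pow_le_pow_right two_pos (by omega))
    push_cast
    rw [one_mul, pow_add]
    calc (2 : ℝ) ^ l * l / x ^ 2 ≤ 2 ^ l * l := div_le_self (by positivity) (one_le_pow₀ hx)
      _ ≤ 2 ^ l * 2 ^ (2 * x) := by gcongr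
  · rw [not_frequently] at hlight
    obtain ⟨l₀, hl₀⟩ := eventually_atTop.1 (hlight.and hgood)
    have hwin : ∀ l, l₀ ≤ l → κ / 4 * l / Nat.log 2 l ≤
        ∑ b ∈ Finset.Ico (2 ^ (l - 2 * Nat.log 2 l)) (2 ^ (l + 2 * Nat.log 2 l)),
          oneProb D (b + 1) := by
      intro l hl
      obtain ⟨h1, h2, h3, -⟩ := hl₀ l hl
      rw [not_le] at h1
      have h4 := half_le_natFloor (hfloor l h2 h3)
      have h5 : κ / 4 * l / Nat.log 2 l = κ * l / Nat.log 2 l / 2 / 2 := by ring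
      rw [h5]
      linarith
    refine isOmega_of_frequently_two_pow (c := κ / 49152 / 4) (by positivity)
      (Eventually.frequently ?_)
    filter_upwards [hgood, eventually_ge_atTop (4 * l₀ + 8)] with l ⟨h1, h2, h3, h4⟩ hl
    obtain ⟨h5, h6⟩ := hratio l h1 h2
    have h7 : l < 2 ^ (Nat.log 2 l + 1) := Nat.lt_pow_succ_log_self one_lt_two l
    have hsum := le_sum_of_window_sums (fun i => oneProb_nonneg D (i + 1))
      (by positivity : 0 ≤ κ / 4) hwin (A := l - 2 * Nat.log 2 l) (Λ := Nat.log 2 l) (by omega)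
      (Nat.log_mono_right (Nat.sub_le _ _)) (by omega) (by omega)
    generalize Nat.log 2 l = x at *
    have hx : (1 : ℝ) ≤ x := by exact_mod_cast (by omega : 1 ≤ x)
    have hx0 : (0 : ℝ) < x := by linarith
    have hl0 : (0 : ℝ) ≤ l := Nat.cast_nonneg l
    have hA : (l : ℝ) / 2 ≤ (l - 2 * x : ℕ) := by
      rw [div_le_iff₀ two_pos]
      exact_mod_cast (by omega : l ≤ (l - 2 * x) * 2)
    generalize ((l - 2 * x : ℕ) : ℝ) = A at hA hsum
    -- The largest horizon the prefix sum allows: `49152 = 3 * 8 * (4 * 4 * 128)` collects the `3 *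
    -- l` hits, the group size `2 ^ l / 8`, and the constants of the prefix sum with `κ / 4` and `A
    -- ≥ l / 2`.
    set Y : ℝ := κ / 49152 * (2 ^ l * l / x ^ 2) with hY
    have hYl : (2 : ℝ) ^ l ≤ Y := by
      have h8 : (1 : ℝ) ≤ κ / 49152 * (l / x ^ 2) := by
        rw [div_mul_div_comm, le_div_iff₀ (by positivity)]
        linarith
      calc (2 : ℝ) ^ l ≤ 2 ^ l * (κ / 49152 * (l / x ^ 2)) :=
            le_mul_of_one_le_right (by positivity) h8
        _ = Y := by rw [hY]; ring
    have hY0 : 0 ≤ Y := le_trans (by positivity) hYl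
    have hlpow : (l : ℝ) ≤ 2 ^ l := by exact_mod_cast Nat.lt_two_pow_self.le
    have haY : (2 : ℝ) * a + 2 ≤ Y := by
      have : (2 : ℝ) * a + 2 ≤ l := by exact_mod_cast h3
      linarith
    have hlT : 2 ^ l ≤ ⌊Y⌋₊ := Nat.le_floor (by exact_mod_cast hYl)
    have hT := Nat.floor_le hY0
    have haT : a ≤ ⌊Y⌋₊ := Nat.le_floor (by linarith [Nat.cast_nonneg (α := ℝ) a])
    have hTl : ⌊Y⌋₊ ≤ l * 2 ^ l := by
      have h8 : Y ≤ l * 2 ^ l := by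
        calc Y ≤ 1 * (2 ^ l * l) := by
              rw [hY]
              gcongr
              · linarith
              · exact div_le_self (by positivity) (one_le_pow₀ hx)
          _ = l * 2 ^ l := by ring
      exact_mod_cast hT.trans h8
    refine ⟨⌊Y⌋₊ - a, ?_, le_latency_two_pow_of_heavy_prefix D ha hsil hC.le (by omega) h7
      (by omega) haT hlT hTl ?_ (by linarith)⟩
    · rw [Nat.cast_sub haT]
      have h8 := Nat.lt_floor_add_one Y
      have h9 : κ / 49152 / 4 * (2 ^ l * l / x ^ 2) = Y / 4 := by rw [hY]; ring
      rw [h9]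
      linarith [Nat.cast_nonneg (α := ℝ) a]
    · have h8 : (2 : ℝ) ^ l = 2 ^ (l - 3) * 8 := by
        rw [show (8 : ℝ) = 2 ^ 3 by norm_num, ← pow_add]
        congr 1
        omega
      calc 3 * l * (⌊Y⌋₊ : ℝ) ≤ 3 * l * Y := by gcongr
        _ = 2 ^ (l - 3) * (κ / 4 * (l / 2) ^ 2 / (128 * x ^ 2)) := by
            rw [hY, h8]
            field_simp
            ring
        _ ≤ 2 ^ (l - 3) * (κ / 4 * A ^ 2 / (128 * x ^ 2)) := by gcongr
        _ ≤ _ := by gcongr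

theorem isOmega_whpLatency (D : LocalProtocol) {k : ℝ} (hk : 0 < k) :
    IsOmega (whpLatency D.toGlobal oblivious k)
      fun n : ℕ => (n : ℝ) * Real.log n / Real.log (Real.log n) ^ 2 := by
  classical
  by_cases h : ∃ i, 1 ≤ i ∧ oneProb D i ≠ 0
  · refine isOmega_whpLatency_of_first_attempt D (Nat.find_spec h).1 (fun i h1 h2 => ?_)
      ((oneProb_nonneg D _).lt_of_ne' (Nat.find_spec h).2) hk
    by_contra h3
    exact Nat.find_min h h2 ⟨h1, h3⟩
  · refine isOmega_whpLatency_of_silent D (fun i hi => ?_) hk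
    by_contra h3
    exact h ⟨i, hi, h3⟩

/-- Eventually the exponent is at most `2`, and `(log log n) ^ 4 = o(log n)`. -/
theorem not_isNearLinear_of_isOmega {ℓ : ℕ → ℕ∞}
    (h : IsOmega ℓ fun n : ℕ => (n : ℝ) * Real.log n / Real.log (Real.log n) ^ 2) :
    ¬ IsNearLinear ℓ := by
  rintro ⟨ε, hε, hℓ⟩
  obtain ⟨c, hc, hfreq⟩ := h
  have h1 : ∀ᶠ x : ℝ in atTop, ‖x ^ 4‖ ≤ c / 2 * ‖Real.exp x‖ :=
    (Real.isLittleO_pow_exp_atTop (n := 4)).def (by positivity)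
  refine hfreq ?_
  filter_upwards [hℓ, hε.eventually_le_const one_pos, tendsto_log_log_natCast.eventually h1,
    tendsto_log_log_natCast.eventually_ge_atTop 1, tendsto_log_natCast.eventually_gt_atTop 0,
    eventually_gt_atTop 0] with n hn hεn hx hx1 hlog hn0 hle
  have hn0' : (0 : ℝ) < n := by exact_mod_cast hn0
  rw [Real.exp_log hlog, Real.norm_of_nonneg (by positivity), Real.norm_of_nonneg hlog.le] at hx
  generalize Real.log (Real.log n) = y at *
  have hy0 : 0 < y := by linarith
  have h2 := (ENNReal.ofReal_le_ofReal_iff (by positivity)).1 (hle.trans hn)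
  have h3 : y ^ (1 + ε n) ≤ y ^ 2 := by
    rw [← Real.rpow_two]
    exact Real.rpow_le_rpow_of_exponent_le hx1 (by linarith)
  have h4 : c * (n * Real.log n / y ^ 2) ≤ n * y ^ 2 := h2.trans (by gcongr)
  rw [mul_div_assoc', div_le_iff₀ (by positivity)] at h4
  have h5 : (n : ℝ) * (c * Real.log n) ≤ n * y ^ 4 := by linarith
  have h6 := le_of_mul_le_mul_left h5 hn0'
  have h7 : 0 < c * Real.log n := by positivity
  linarith

end ContentionResolution

theorem mainTheorem5 :
    (∃ D : ContentionResolution.GlobalProtocol, ∀ k : ℝ, 0 < k →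
      ContentionResolution.IsNearLinear
        (ContentionResolution.whpLatency D ContentionResolution.adaptive k)) ∧
    (∀ D : ContentionResolution.LocalProtocol, ∀ k : ℝ, 0 < k →
      ContentionResolution.IsOmega
        (ContentionResolution.whpLatency D.toGlobal ContentionResolution.oblivious k)
        (fun n : ℕ => (n : ℝ) * Real.log n / Real.log (Real.log n) ^ 2)) ∧
    (∀ D : ContentionResolution.LocalProtocol, ∀ k : ℝ, 0 < k →
      ¬ ContentionResolution.IsNearLinear
        (ContentionResolution.whpLatency D.toGlobal ContentionResolution.oblivious k)) := by
  exact ⟨⟨ContentionResolution.levelProtocol,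
      fun k _ => ContentionResolution.isNearLinear_levelProtocol k⟩,
    fun D _ hk => ContentionResolution.isOmega_whpLatency D hk,
    fun D _ hk => ContentionResolution.not_isNearLinear_of_isOmega
      (ContentionResolution.isOmega_whpLatency D hk)⟩
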